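/- **Setting.** Consider the Fock space of finitely many free fields on four-dimensional Minkowski space. Every field has a statistics, a ghost number $\le 1$ and a canonical dimension $\ge 1$; operators act on the dense domain $D$ of vectors with finitely many particles and continuous, rapidly decreasing wave functions. Wick polynomials are the distribution-valued operators on $D$ given by finite linear combinations of normal ordered products of fields and their derivatives (each derivative counts one in the canonical dimension $\omega$), and $gh$ is the ghost number; the statistics of all Wick polynomials below is their ghost number mod 2. Let $Q$ be a gauge charge: $Q^2=0$, $Q$ has an adjoint on $D$, and the graded commutator $d_Q=[Q,\cdot]$ maps every field to a linear combination of derivatives of fields, raising the ghost number by one and the canonical dimension by at most one. Let $T,\,T^\mu,\,T^{[\mu\nu]}$ be Wick polynomials (written $T^I$, $|I|\le 2$) with $gh(T^I)=|I|$, $\omega(T^I)\le 4$, $$d_QT=i\,\partial_\mu T^\mu,\qquad d_QT^\mu=i\,\partial_\nu T^{[\mu\nu]},\qquad d_QT^{[\mu\nu]}=0,$$ which commute in the graded sense at space-like distances. Let $T^{I,J}(x_1,x_2)=T(T^I(x_1),T^J(x_2))$ be second order chronological products: distribution-valued operators, antisymmetric in the indices of $I$ and of $J$, with $T^{I,J}(x_1,x_2)=(-1)^{|I||J|}T^{J,I}(x_2,x_1)$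 and $T^{I,J}(x_1,x_2)=T^I(x_1)T^J(x_2)$ whenever $x_1$ does not lie in the closed causal past of $x_2$. Define the anomalies $A^{I,J}$ by $$d_QT^{I,J}=i\Big(\tfrac{\partial}{\partial x_1^\mu}T^{I\mu,J}+(-1)^{|I|}\tfrac{\partial}{\partial x_2^\mu}T^{I,J\mu}\Big)+A^{I,J}$$ (components with more than two indices in one place are zero) and put $A_1=A^{\emptyset,\emptyset}$, $A_2^\mu=A^{\mu,\emptyset}$, $A_3^{[\mu\nu]}=A^{\mu\nu,\emptyset}$, $A_4^{\mu;\nu}=A^{\mu,\nu}$, $A_5^{[\mu\nu];\rho}=A^{\mu\nu,\rho}$, $A_6^{[\mu\nu];[\rho\sigma]}=A^{\mu\nu,\rho\sigma}$. As anomalies are, by definition, they are quasi-local and respect power counting: $A^{I,J}=\sum_k[\partial_{\rho_1}\cdots\partial_{\rho_k}\delta](x_2-x_1)\,W^{I,J;\rho_1\dots\rho_k}(x_1)$, a finite sum, with Wick polynomials $W^{I,J;\rho_1\dots\rho_k}$ of ghost number $|I|+|J|+1$ and canonical dimension $\le 5-k$. A *finite renormalization* is a replacement $T^{I,J}\to T^{I,J}+R^{I,J}$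 where $R^{I,J}$ has the same (anti)symmetries as $T^{I,J}$ and is quasi-local with coefficients of ghost number $|I|+|J|$ and canonical dimension $\le 4-k$. **Theorem (second-order anomalies, $n=2$).** Finite renormalizations lead from chronological products to chronological products, and there is one after which $$A_1=\delta(x_1-x_2)W(x_1),\quad A_2^\mu=\delta(x_1-x_2)W^\mu(x_1),\quad A_3^{[\mu\nu]}=\delta(x_1-x_2)W^{[\mu\nu]}(x_1),$$ $$A_4^{\mu;\nu}=-\delta(x_1-x_2)W^{[\mu\nu]}(x_1),\quad A_5^{[\mu\nu];\rho}=0,\quad A_6^{[\mu\nu];[\rho\sigma]}=0,$$ where $W,W^\mu,W^{[\mu\nu]}$ are Wick polynomials of ghost numbers $1,2,3$ and canonical dimension $\le 5$. Whenever the anomalies have this form, the descent equations $$d_QW=-i\,\partial_\mu W^\mu,\qquad d_QW^\mu=-i\,\partial_\nu W^{[\mu\nu]},\qquad d_QW^{[\mu\nu]}=0$$ hold. Moreover $W$ and $W^\mu$ are determined up to relative coboundaries and $W^{[\mu\nu]}$ up to a coboundary: if $(W,W^\mu,W^{[\mu\nu]})$ is obtained by some finite renormalization, then the triples obtained by arbitrary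 finite renormalizations leading to this form are exactly $$W+d_QB-i\,\partial_\mu B^\mu,\qquad W^\mu+d_QB^\mu-i\,\partial_\nu B^{[\mu\nu]},\qquad W^{[\mu\nu]}+d_QB^{[\mu\nu]}$$ with arbitrary Wick polynomials $B,B^\mu,B^{[\mu\nu]}$ of ghost numbers $0,1,2$ and canonical dimension $\le 4$. -/

import Mathlib

open MeasureTheory
open scoped SchwartzMap LineDeriv

namespace CausalGauge

noncomputable section

/-! ### Minkowski space and mass shells -/

/-- Four-dimensional Minkowski space with coordinates `x 0` (time) and `x 1, x 2, x 3`. The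
Euclidean norm serves only to define Schwartz functions. -/
abbrev Mink : Type := EuclideanSpace ℝ (Fin 4)

/-- The space of spatial momenta. -/
abbrev Mom : Type := EuclideanSpace ℝ (Fin 3)

/-- The closed forward light cone. -/
def ForwardCone : Set Mink :=
  {z | 0 ≤ z 0 ∧ (z 1) ^ 2 + (z 2) ^ 2 + (z 3) ^ 2 ≤ (z 0) ^ 2}

/-- `x ≥ y` in the causal sense: `x` does not lie in the closed causal past of `y`. -/
def CausallyLater (x y : Mink) : Prop := y - x ∉ ForwardCone

/-- `x - y` is space-like. -/
def Spacelike (x y : Mink) : Prop :=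
  (x 0 - y 0) ^ 2 < (x 1 - y 1) ^ 2 + (x 2 - y 2) ^ 2 + (x 3 - y 3) ^ 2

/-- The energy of a particle of mass `m` and momentum `p`. -/
def energy (m : ℝ) (p : Mom) : ℝ := Real.sqrt (m ^ 2 + ‖p‖ ^ 2)

/-- The covariant components `p_μ` of the four-momentum (signature `+ - - -`). -/
def fourMom (m : ℝ) (p : Mom) : Fin 4 → ℝ := Fin.cons (energy m p) (fun i => - p i)

/-- The Lorentz invariant measure `d³p / (2 ω(p))` on the mass shell. -/
def shellMeasure (m : ℝ) : Measure Mom :=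
  volume.withDensity fun p => ENNReal.ofReal (1 / (2 * energy m p))

lemma continuous_energy (m : ℝ) : Continuous (energy m) := by
  unfold energy; fun_prop

lemma norm_le_energy (m : ℝ) (p : Mom) : ‖p‖ ≤ energy m p := by
  unfold energy
  apply Real.le_sqrt_of_sq_le
  nlinarith [sq_nonneg m]

lemma energy_le (m : ℝ) (p : Mom) : energy m p ≤ |m| + ‖p‖ := by
  unfold energy
  rw [Real.sqrt_le_left (by positivity)]
  nlinarith [sq_abs m, mul_nonneg (abs_nonneg m) (norm_nonneg p)]

lemma integrable_shell (m : ℝ) :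
    Integrable (fun p : Mom => (1 + ‖p‖) ^ (-(5 : ℕ) : ℝ)) (shellMeasure m) := by
  unfold shellMeasure
  have hmeas : Measurable fun p : Mom => 1 / (2 * energy m p) :=
    measurable_const.div ((continuous_energy m).measurable.const_mul 2)
  rw [integrable_withDensity_iff hmeas.ennreal_ofReal (by simp)]
  have key : Integrable (fun p : Mom => (fun y : ℝ =>
      (1 + y) ^ (-(5 : ℕ) : ℝ) * (1 / (2 * Real.sqrt (m ^ 2 + y ^ 2)))) ‖p‖) volume := by
    rw [integrable_fun_norm_addHaar volume (f := fun y : ℝ =>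
      (1 + y) ^ (-(5 : ℕ) : ℝ) * (1 / (2 * Real.sqrt (m ^ 2 + y ^ 2))))]
    have hI : IntegrableOn (fun y : ℝ => (y + 1) ^ (-(2 : ℝ))) (Set.Ioi 0) :=
      integrableOn_add_rpow_Ioi_of_lt (by norm_num) (by norm_num)
    refine Integrable.mono' hI ?_ ?_
    · apply Measurable.aestronglyMeasurable
      fun_prop
    · refine (ae_restrict_iff' measurableSet_Ioi).2 (Filter.Eventually.of_forall fun y hy => ?_)
      have hy : 0 < y := hy
      have h1 : y ≤ Real.sqrt (m ^ 2 + y ^ 2) := by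
        apply Real.le_sqrt_of_sq_le; nlinarith [sq_nonneg m]
      have hs : 0 < Real.sqrt (m ^ 2 + y ^ 2) := lt_of_lt_of_le hy h1
      have hd : Module.finrank ℝ Mom - 1 = 2 := by simp
      rw [hd, Real.norm_of_nonneg (by positivity), smul_eq_mul]
      have e1 : (1 + y) ^ (-(5 : ℕ) : ℝ) = (y + 1) ^ (-(2 : ℝ)) * ((y + 1) ^ 3)⁻¹ := by
        rw [add_comm 1 y]
        have : (-(5 : ℕ) : ℝ) = -(2 : ℝ) + -((3 : ℕ) : ℝ) := by norm_num
        rw [this, Real.rpow_add (by positivity), Real.rpow_neg (by positivity) ((3 : ℕ) : ℝ),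
          Real.rpow_natCast]
      rw [e1]
      have hb : y ^ 2 * (((y + 1) ^ 3)⁻¹ * (1 / (2 * Real.sqrt (m ^ 2 + y ^ 2)))) ≤ 1 := by
        rw [one_div, ← mul_inv, ← div_eq_mul_inv, div_le_one (by positivity)]
        have h3 : y ≤ (y + 1) ^ 3 := by nlinarith [sq_nonneg y, mul_pos hy hy]
        calc y ^ 2 = y * y := by ring
          _ ≤ (y + 1) ^ 3 * Real.sqrt (m ^ 2 + y ^ 2) := by gcongr
          _ ≤ (y + 1) ^ 3 * (2 * Real.sqrt (m ^ 2 + y ^ 2)) := by gcongr; linarith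
      calc _ = (y + 1) ^ (-(2 : ℝ)) *
            (y ^ 2 * (((y + 1) ^ 3)⁻¹ * (1 / (2 * Real.sqrt (m ^ 2 + y ^ 2))))) := by ring
        _ ≤ (y + 1) ^ (-(2 : ℝ)) * 1 := by gcongr
        _ = _ := mul_one _
  refine key.congr (Filter.Eventually.of_forall fun p => ?_)
  have : 0 ≤ 1 / (2 * energy m p) := by unfold energy; positivity
  simp only [ENNReal.toReal_ofReal this]
  rfl

instance shellMeasure_temperate (m : ℝ) : (shellMeasure m).HasTemperateGrowth :=
  ⟨⟨5, integrable_shell m⟩⟩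

/-- A continuous, polynomially bounded function on momentum space. -/
def IsAmplitude (g : Mom → ℂ) : Prop :=
  Continuous g ∧ ∃ (C : ℝ) (k : ℕ), ∀ p, ‖g p‖ ≤ C * (1 + ‖p‖) ^ k

lemma IsAmplitude.mul {g h : Mom → ℂ} (hg : IsAmplitude g) (hh : IsAmplitude h) :
    IsAmplitude fun p => g p * h p := by
  obtain ⟨hgc, C, k, hC⟩ := hg
  obtain ⟨hhc, D, l, hD⟩ := hh
  refine ⟨hgc.mul hhc, C * D, k + l, fun p => ?_⟩
  rw [norm_mul, pow_add]
  calc ‖g p‖ * ‖h p‖ ≤ (C * (1 + ‖p‖) ^ k) * (D * (1 + ‖p‖) ^ l) :=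
        mul_le_mul (hC p) (hD p) (norm_nonneg _) ((norm_nonneg _).trans (hC p))
    _ = _ := by ring

lemma IsAmplitude.of_bounded {g : Mom → ℂ} (hg : Continuous g) (C : ℝ) (hC : ∀ p, ‖g p‖ ≤ C) :
    IsAmplitude g := ⟨hg, C, 0, by simpa using hC⟩

lemma IsAmplitude.pow {g : Mom → ℂ} (hg : IsAmplitude g) (n : ℕ) :
    IsAmplitude fun p => g p ^ n := by
  induction n with
  | zero => simpa using IsAmplitude.of_bounded (continuous_const (y := (1 : ℂ))) 1 (by simp)
  | succ n ih => simpa only [pow_succ] using ih.mul hg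

lemma IsAmplitude.prod {ι : Type*} (s : Finset ι) {g : ι → Mom → ℂ}
    (hg : ∀ i, IsAmplitude (g i)) : IsAmplitude fun p => ∏ i ∈ s, g i p := by
  classical
  induction s using Finset.induction_on with
  | empty => simpa using IsAmplitude.of_bounded (continuous_const (y := (1 : ℂ))) 1 (by simp)
  | insert a s ha ih => simpa only [Finset.prod_insert ha] using (hg a).mul ih

lemma IsAmplitude.conj {g : Mom → ℂ} (hg : IsAmplitude g) :
    IsAmplitude fun p => (starRingEnd ℂ) (g p) := by
  obtain ⟨hc, C, k, hC⟩ := hg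
  exact ⟨Complex.continuous_conj.comp hc, C, k, by simpa using hC⟩

lemma continuous_fourMom (m : ℝ) (μ : Fin 4) : Continuous fun p => fourMom m p μ := by
  refine Fin.cases ?_ (fun i => ?_) μ
  · simpa [fourMom] using continuous_energy m
  · simp only [fourMom, Fin.cons_succ]; fun_prop

lemma isAmplitude_fourMom (m : ℝ) (μ : Fin 4) :
    IsAmplitude fun p => -Complex.I * (fourMom m p μ : ℂ) := by
  have hc := continuous_fourMom m μ
  refine ⟨by fun_prop, 1 + |m|, 1, fun p => ?_⟩
  have hb : |fourMom m p μ| ≤ |m| + ‖p‖ := by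
    refine Fin.cases ?_ (fun i => ?_) μ
    · simp only [fourMom, Fin.cons_zero]
      rw [abs_of_nonneg (by unfold energy; positivity)]
      exact energy_le m p
    · simp only [fourMom, Fin.cons_succ, abs_neg]
      have := PiLp.norm_apply_le p i
      rw [Real.norm_eq_abs] at this
      linarith [abs_nonneg m]
  simp only [norm_mul, norm_neg, Complex.norm_I, one_mul, Complex.norm_real, Real.norm_eq_abs,
    pow_one]
  nlinarith [abs_nonneg m, norm_nonneg p, mul_nonneg (abs_nonneg m) (norm_nonneg p)]

/-- The amplitude of `∂^α e^{-ip·x}`, that is `(-ip)^α e^{-ip·x}`, on the shell of mass `m`. -/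
def planeWave (m : ℝ) (α : Fin 4 → ℕ) (x : Mink) (p : Mom) : ℂ :=
  (∏ μ, (-Complex.I * (fourMom m p μ : ℂ)) ^ α μ) *
    Complex.exp (-Complex.I * ((∑ μ, fourMom m p μ * x μ : ℝ) : ℂ))

lemma isAmplitude_planeWave (m : ℝ) (α : Fin 4 → ℕ) (x : Mink) :
    IsAmplitude (planeWave m α x) := by
  refine (IsAmplitude.prod _ fun μ => (isAmplitude_fourMom m μ).pow (α μ)).mul ?_
  have h (μ : Fin 4) := continuous_fourMom m μ
  refine IsAmplitude.of_bounded (by fun_prop) 1 fun p => le_of_eq ?_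
  rw [Complex.norm_exp]
  simp

/-! ### Free fields and Fock space -/

/-- The sign `(-1)^x`. -/
def sgn (x : ZMod 2) : ℂ := if x = 0 then 1 else -1

/-- The data of a finite system of free fields: particle species with mass and statistics
(`0` Bose, `1` Fermi), and fields
`φ_a(x) = ∑_σ ∫ (u_{aσ}(p) e^{-ip·x} c_σ(p) + v_{aσ}(p) e^{ip·x} c_σ(p)^*) d³p/(2ω_σ(p))`
where `c_σ(p)`, `c_σ(p)^*` annihilate and create a particle of species `σ`. Each field has a
statistics, a ghost number and a canonical dimension. -/
structure FieldContent where
  Species : Type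
  [speciesFintype : Fintype Species]
  mass : Species → ℝ
  mass_nonneg : ∀ σ, 0 ≤ mass σ
  stat : Species → ZMod 2
  Field : Type
  [fieldFintype : Fintype Field]
  fieldStat : Field → ZMod 2
  ghost : Field → ℤ
  dim : Field → ℚ
  ghost_le_one : ∀ a, ghost a ≤ 1
  one_le_dim : ∀ a, 1 ≤ dim a
  u : Field → Species → Mom → ℂ
  v : Field → Species → Mom → ℂ
  u_amp : ∀ a σ, IsAmplitude (u a σ)
  v_amp : ∀ a σ, IsAmplitude (v a σ)
  u_stat : ∀ a σ p, u a σ p ≠ 0 → stat σ = fieldStat a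
  v_stat : ∀ a σ p, v a σ p ≠ 0 → stat σ = fieldStat a

attribute [instance] FieldContent.speciesFintype FieldContent.fieldFintype

variable (F : FieldContent)

/-- Families of `n`-particle wave functions. -/
abbrev WaveFamily : Type := (n : ℕ) → (Fin n → F.Species) → (Fin n → Mom) → ℂ

/-- The wave functions of finitely many particles that are continuous, rapidly decreasing, and of
the right (graded) permutation symmetry. -/
def fockSubmodule : Submodule ℂ (WaveFamily F) where
  carrier := {ψ |
    (∀ n s, Continuous (ψ n s)) ∧
    (∀ n s (k : ℕ), ∃ C : ℝ, ∀ p, (1 + ‖p‖) ^ k * ‖ψ n s p‖ ≤ C) ∧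
    (∀ n (i j : Fin n), (i : ℕ) + 1 = j → ∀ s p,
      ψ n (s ∘ Equiv.swap i j) (p ∘ Equiv.swap i j)
        = sgn (F.stat (s i) * F.stat (s j)) * ψ n s p) ∧
    (∃ N, ∀ n, N < n → ∀ s p, ψ n s p = 0)}
  zero_mem' := ⟨fun _ _ => continuous_const, fun _ _ _ => ⟨0, by simp⟩,
    fun _ _ _ _ _ _ => by simp, 0, fun _ _ _ _ => rfl⟩
  add_mem' := by
    rintro ψ χ ⟨hc, hd, hs, N, hN⟩ ⟨hc', hd', hs', N', hN'⟩
    refine ⟨fun n s => (hc n s).add (hc' n s), fun n s k => ?_, fun n i j hij s p => ?_,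
      max N N', fun n hn s p => ?_⟩
    · obtain ⟨C, hC⟩ := hd n s k
      obtain ⟨C', hC'⟩ := hd' n s k
      refine ⟨C + C', fun p => ?_⟩
      calc (1 + ‖p‖) ^ k * ‖ψ n s p + χ n s p‖
          ≤ (1 + ‖p‖) ^ k * (‖ψ n s p‖ + ‖χ n s p‖) := by gcongr; exact norm_add_le _ _
        _ ≤ C + C' := by rw [mul_add]; exact add_le_add (hC p) (hC' p)
    · simp only [Pi.add_apply, hs n i j hij, hs' n i j hij, mul_add]
    · simp [hN n (lt_of_le_of_lt (le_max_left _ _) hn) s p,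
        hN' n (lt_of_le_of_lt (le_max_right _ _) hn) s p]
  smul_mem' := by
    rintro c ψ ⟨hc, hd, hs, N, hN⟩
    refine ⟨fun n s => (hc n s).const_smul c, fun n s k => ?_, fun n i j hij s p => ?_,
      N, fun n hn s p => ?_⟩
    · obtain ⟨C, hC⟩ := hd n s k
      refine ⟨‖c‖ * C, fun p => ?_⟩
      calc (1 + ‖p‖) ^ k * ‖c • ψ n s p‖ = ‖c‖ * ((1 + ‖p‖) ^ k * ‖ψ n s p‖) := by
            rw [norm_smul]; ring
        _ ≤ ‖c‖ * C := by gcongr; exact hC p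
    · simp only [Pi.smul_apply, smul_eq_mul, hs n i j hij]; ring
    · simp [hN n hn s p]

/-- The dense domain `D` of the Fock space on which all operators act. -/
def Fock : Type := fockSubmodule F

instance : AddCommGroup (Fock F) := inferInstanceAs (AddCommGroup (fockSubmodule F))

instance : Module ℂ (Fock F) := inferInstanceAs (Module ℂ (fockSubmodule F))

variable {F}

/-- The family of wave functions of a vector of `D`. -/
def Fock.wave (ψ : Fock F) : WaveFamily F := (show fockSubmodule F from ψ).1

lemma Fock.wave_mem (ψ : Fock F) : ψ.wave ∈ fockSubmodule F :=
  (show fockSubmodule F from ψ).2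

lemma Fock.ext {ψ χ : Fock F} (h : ψ.wave = χ.wave) : ψ = χ := Subtype.ext h

lemma Fock.wave_add (ψ χ : Fock F) : (ψ + χ).wave = ψ.wave + χ.wave := rfl

lemma Fock.wave_smul (c : ℂ) (ψ : Fock F) : (c • ψ).wave = c • ψ.wave := rfl

/-- The scalar product of the Fock space (conjugate linear in the first argument). -/
def pair (χ ψ : Fock F) : ℂ :=
  ∑ᶠ n : ℕ, ∑ s : Fin n → F.Species,
    ∫ p, (starRingEnd ℂ) (χ.wave n s p) * ψ.wave n s p
      ∂(Measure.pi fun i => shellMeasure (F.mass (s i)))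

/-- The integrand of the annihilation operator is dominated by an integrable function. -/
lemma annihilate_bound {g : Mom → ℂ} (hg : IsAmplitude g) (ψ : Fock F) (n : ℕ)
    (s : Fin (n + 1) → F.Species) (k : ℕ) :
    ∃ C : ℝ, 0 ≤ C ∧ ∀ (q : Mom) (p : Fin n → Mom),
      (1 + ‖p‖) ^ k * ‖g q * ψ.wave (n + 1) s (Fin.cons q p)‖ ≤
        C * (1 + ‖q‖) ^ (-(5 : ℕ) : ℝ) := by
  obtain ⟨-, C, l, hC⟩ := hg
  obtain ⟨C', hC'⟩ := ψ.wave_mem.2.1 (n + 1) s (k + (l + 5))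
  have hC0 : 0 ≤ C := by
    have := (norm_nonneg _).trans (hC 0)
    simpa using this
  have hC0' : 0 ≤ C' := le_trans (by positivity) (hC' 0)
  refine ⟨C * C', by positivity, fun q p => ?_⟩
  set r : Fin (n + 1) → Mom := Fin.cons q p
  have hq : ‖q‖ ≤ ‖r‖ := by simpa [r] using norm_le_pi_norm r 0
  have hp : ‖p‖ ≤ ‖r‖ := by
    refine (pi_norm_le_iff_of_nonneg (norm_nonneg _)).2 fun i => ?_
    simpa [r] using norm_le_pi_norm r i.succ
  rw [Real.rpow_neg (by positivity), Real.rpow_natCast, ← div_eq_mul_inv,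
    le_div_iff₀ (by positivity), norm_mul]
  calc (1 + ‖p‖) ^ k * (‖g q‖ * ‖ψ.wave (n + 1) s r‖) * (1 + ‖q‖) ^ 5
      ≤ (1 + ‖r‖) ^ k * ((C * (1 + ‖r‖) ^ l) * ‖ψ.wave (n + 1) s r‖) * (1 + ‖r‖) ^ 5 := by
        gcongr
        exact (hC q).trans (by gcongr)
    _ = C * ((1 + ‖r‖) ^ (k + (l + 5)) * ‖ψ.wave (n + 1) s r‖) := by ring
    _ ≤ C * C' := by gcongr; exact hC' r

lemma annihilate_continuous {g : Mom → ℂ} (hg : IsAmplitude g) (ψ : Fock F) (n : ℕ)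
    (s : Fin (n + 1) → F.Species) :
    Continuous fun qp : Mom × (Fin n → Mom) =>
      g qp.1 * ψ.wave (n + 1) s (Fin.cons qp.1 qp.2) := by
  refine (hg.1.comp continuous_fst).mul ((ψ.wave_mem.1 (n + 1) s).comp ?_)
  refine continuous_pi fun i => ?_
  refine Fin.cases ?_ (fun j => ?_) i
  · simpa using continuous_fst
  · simp only [Fin.cons_succ]; fun_prop

lemma annihilate_integrable {g : Mom → ℂ} (hg : IsAmplitude g) (ψ : Fock F) (n : ℕ)
    (s : Fin (n + 1) → F.Species) (p : Fin n → Mom) (m : ℝ) :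
    Integrable (fun q => g q * ψ.wave (n + 1) s (Fin.cons q p)) (shellMeasure m) := by
  obtain ⟨C, -, hC⟩ := annihilate_bound hg ψ n s 0
  refine Integrable.mono' ((integrable_shell m).const_mul C) ?_
    (Filter.Eventually.of_forall fun q => by simpa using hC q p)
  have h1 : Continuous fun q : Mom => (q, p) := by fun_prop
  exact ((annihilate_continuous hg ψ n s).comp h1).aestronglyMeasurable

/-- Wave functions of `∑_σ ∫ g_σ(q) c_σ(q) ψ d³q/(2ω_σ(q))`. -/
def annihilateWave (g : F.Species → Mom → ℂ) (w : WaveFamily F) : WaveFamily F := fun n s p =>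
  (Real.sqrt (n + 1) : ℂ) * ∑ σ,
    ∫ q, g σ q * w (n + 1) (Fin.cons σ s) (Fin.cons q p) ∂(shellMeasure (F.mass σ))

lemma annihilateWave_mem (g : F.Species → Mom → ℂ) (hg : ∀ σ, IsAmplitude (g σ)) (ψ : Fock F) :
    annihilateWave g ψ.wave ∈ fockSubmodule F := by
  refine ⟨fun n s => ?_, fun n s k => ?_, fun n i j hij s p => ?_, ?_⟩
  · refine continuous_const.mul (continuous_finsetSum _ fun σ _ => ?_)
    obtain ⟨C, -, hC⟩ := annihilate_bound (hg σ) ψ n (Fin.cons σ s) 0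
    refine continuous_of_dominated (bound := fun q => C * (1 + ‖q‖) ^ (-(5 : ℕ) : ℝ))
      (fun p => (annihilate_integrable (hg σ) ψ n _ p _).aestronglyMeasurable)
      (fun p => Filter.Eventually.of_forall fun q => by simpa using hC q p)
      ((integrable_shell _).const_mul C) (Filter.Eventually.of_forall fun q => ?_)
    exact (annihilate_continuous (hg σ) ψ n _).comp (Continuous.prodMk_right q)
  · choose C hC0 hC using fun σ => annihilate_bound (hg σ) ψ n (Fin.cons σ s) k
    refine ⟨Real.sqrt (n + 1) * ∑ σ, C σ *
      ∫ q, (1 + ‖q‖) ^ (-(5 : ℕ) : ℝ) ∂(shellMeasure (F.mass σ)), fun p => ?_⟩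
    unfold annihilateWave
    rw [norm_mul, Complex.norm_real, Real.norm_of_nonneg (Real.sqrt_nonneg _), mul_left_comm]
    gcongr
    refine (mul_le_mul_of_nonneg_left (norm_sum_le _ _) (by positivity)).trans ?_
    rw [Finset.mul_sum]
    refine Finset.sum_le_sum (fun σ _ => ?_)
    rw [← integral_const_mul]
    refine (mul_le_mul_of_nonneg_left (norm_integral_le_integral_norm _)
      (by positivity)).trans ?_
    rw [← integral_const_mul]
    refine integral_mono (((annihilate_integrable (hg σ) ψ n _ p _).norm).const_mul _)
      ((integrable_shell _).const_mul _) fun q => hC σ q p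
  · unfold annihilateWave
    rw [mul_left_comm]
    refine congrArg _ ?_
    rw [Finset.mul_sum]
    refine Finset.sum_congr rfl fun σ _ => ?_
    rw [← integral_const_mul]
    congr 1
    funext q
    have hcons : ∀ {β : Type} (b : β) (t : Fin n → β),
        (Fin.cons b (t ∘ Equiv.swap i j) : Fin (n + 1) → β)
          = (Fin.cons b t : Fin (n + 1) → β) ∘ Equiv.swap i.succ j.succ := by
      intro β b t
      funext l
      refine Fin.cases ?_ (fun l => ?_) l
      · simp [Equiv.swap_apply_of_ne_of_ne, (Fin.succ_ne_zero _).symm]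
      · have : (Equiv.swap i.succ j.succ) l.succ = (Equiv.swap i j l).succ := by
          simp only [Equiv.swap_apply_def, Fin.succ_inj]
          split_ifs <;> rfl
        simp [this]
    rw [hcons σ s, hcons q p, ψ.wave_mem.2.2.1 (n + 1) i.succ j.succ (by simp [hij])]
    simp only [Fin.cons_succ]
    ring
  · obtain ⟨N, hN⟩ := ψ.wave_mem.2.2.2
    refine ⟨N, fun n hn s p => ?_⟩
    simp [annihilateWave, hN (n + 1) (by omega)]

/-- The annihilation operator `∑_σ ∫ g_σ(q) c_σ(q) d³q/(2ω_σ(q))`. -/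
def annihilate (g : F.Species → Mom → ℂ) (hg : ∀ σ, IsAmplitude (g σ)) :
    Fock F →ₗ[ℂ] Fock F where
  toFun ψ := (⟨annihilateWave g ψ.wave, annihilateWave_mem g hg ψ⟩ : fockSubmodule F)
  map_add' ψ χ := by
    refine Fock.ext ?_
    change annihilateWave g (ψ.wave + χ.wave)
      = annihilateWave g ψ.wave + annihilateWave g χ.wave
    funext n s p
    simp only [annihilateWave, Pi.add_apply, ← mul_add, ← Finset.sum_add_distrib]
    refine congrArg _ (Finset.sum_congr rfl fun σ _ => ?_)
    rw [← integral_add (annihilate_integrable (hg σ) ψ n _ p _)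
      (annihilate_integrable (hg σ) χ n _ p _)]
    simp only [mul_add]
  map_smul' c ψ := by
    refine Fock.ext ?_
    change annihilateWave g (c • ψ.wave) = c • annihilateWave g ψ.wave
    funext n s p
    simp only [annihilateWave, Pi.smul_apply, smul_eq_mul]
    rw [mul_left_comm c, Finset.mul_sum _ _ c]
    refine congrArg _ (Finset.sum_congr rfl fun σ _ => ?_)
    rw [← integral_const_mul]
    simp only [mul_left_comm c]

/-! ### Wick monomials and Wick polynomials -/

variable (F) in
/-- The symbol `∂^α φ_a`. -/
abbrev Jet : Type := F.Field × (Fin 4 → ℕ)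

/-- The positive frequency (annihilation) part of `∂^α φ_a(x)`. -/
def posPart (j : Jet F) (x : Mink) : Fock F →ₗ[ℂ] Fock F :=
  annihilate (fun σ p => F.u j.1 σ p * planeWave (F.mass σ) j.2 x p)
    fun σ => (F.u_amp j.1 σ).mul (isAmplitude_planeWave _ _ _)

/-- The adjoint (again an annihilation operator) of the negative frequency (creation) part of
`∂^α φ_a(x)`. -/
def negPartAdj (j : Jet F) (x : Mink) : Fock F →ₗ[ℂ] Fock F :=
  annihilate (fun σ p => (starRingEnd ℂ) (F.v j.1 σ p) * planeWave (F.mass σ) j.2 x p)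
    fun σ => (F.v_amp j.1 σ).conj.mul (isAmplitude_planeWave _ _ _)

/-- Statistics of the monomial `:∂^{α₁}φ_{a₁} ⋯ ∂^{αₖ}φ_{aₖ}:`. -/
def monoStat (L : List (Jet F)) : ZMod 2 := (L.map fun j => F.fieldStat j.1).sum

/-- Ghost number of a Wick monomial. -/
def monoGhost (L : List (Jet F)) : ℤ := (L.map fun j => F.ghost j.1).sum

/-- Canonical dimension of a Wick monomial; each derivative counts one. -/
def monoDim (L : List (Jet F)) : ℚ :=
  (L.map fun j => F.dim j.1 + ((∑ μ, j.2 μ : ℕ) : ℚ)).sum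

/-- The matrix element `⟨χ, :∂^{α₁}φ_{a₁} ⋯ ∂^{αₖ}φ_{aₖ}:(x) ψ⟩`, by the normal ordering rule
`:φ L: = φ^{(-)} :L: ± :L: φ^{(+)}`. -/
def wickForm : List (Jet F) → Mink → Fock F → Fock F → ℂ
  | [], _, χ, ψ => pair χ ψ
  | j :: L, x, χ, ψ => wickForm L x (negPartAdj j x χ) ψ
      + sgn (F.fieldStat j.1 * monoStat L) * wickForm L x χ (posPart j x ψ)

variable (F) in
/-- Maps from test functions on `E` to operators on the domain `D`. -/
abbrev OpMap (E : Type) [NormedAddCommGroup E] [NormedSpace ℝ E] : Type :=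
  𝓢(E, ℂ) →ₗ[ℂ] Fock F →ₗ[ℂ] Fock F

/-- A distribution-valued operator: all matrix elements are tempered distributions. -/
def IsOpDistribution {E : Type} [NormedAddCommGroup E] [NormedSpace ℝ E] (A : OpMap F E) : Prop :=
  ∀ χ ψ : Fock F, Continuous fun f => pair χ (A f ψ)

/-- `W` is a Wick polynomial of ghost number `g` and canonical dimension at most `d`: a finite
linear combination of Wick monomials of ghost number `g`, of the statistics that `g` prescribes,
and of canonical dimension at most `d`. -/
def IsWick (g : ℤ) (d : ℚ) (W : OpMap F Mink) : Prop :=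
  ∃ P : List (Jet F) →₀ ℂ,
    (∀ L ∈ P.support, monoGhost L = g ∧ monoStat L = (g : ZMod 2) ∧ monoDim L ≤ d) ∧
    ∀ f χ ψ, pair χ (W f ψ) = P.sum fun L c => c * ∫ x, f x * wickForm L x χ ψ

/-! ### The gauge charge -/

variable (F) in
/-- A gauge charge: an operator `Q` with an adjoint on `D`, `Q² = 0`, whose graded commutator
with each field is a linear combination of (derivatives of) fields, raising the ghost number by
one and the canonical dimension by at most one. The commutator is given on the positive and
negative frequency parts, on the latter after taking adjoints. -/
structure GaugeCharge where
  Q : Fock F →ₗ[ℂ] Fock F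
  Qadj : Fock F →ₗ[ℂ] Fock F
  adjoint : ∀ χ ψ, pair χ (Q ψ) = pair (Qadj χ) ψ
  sq_zero : Q ∘ₗ Q = 0
  coeff : F.Field → (Jet F →₀ ℂ)
  coeff_spec : ∀ a, ∀ j ∈ (coeff a).support,
    F.ghost j.1 = F.ghost a + 1 ∧ F.fieldStat j.1 = F.fieldStat a + 1 ∧
      F.dim j.1 + ((∑ μ, j.2 μ : ℕ) : ℚ) ≤ F.dim a + 1
  comm_pos : ∀ a α x,
    Q ∘ₗ posPart (a, α) x - sgn (F.fieldStat a) • (posPart (a, α) x ∘ₗ Q)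
      = (coeff a).sum fun j c => c • posPart (j.1, α + j.2) x
  comm_neg : ∀ a α x,
    negPartAdj (a, α) x ∘ₗ Qadj - sgn (F.fieldStat a) • (Qadj ∘ₗ negPartAdj (a, α) x)
      = (coeff a).sum fun j c => (starRingEnd ℂ) c • negPartAdj (j.1, α + j.2) x

/-- The graded commutator `d_Q A = Q A - (-1)^k A Q` with an operator of ghost number `k`. -/
def dQ (G : GaugeCharge F) (k : ℕ) {E : Type} [NormedAddCommGroup E] [NormedSpace ℝ E]
    (A : OpMap F E) : OpMap F E where
  toFun f := G.Q ∘ₗ A f - (-1 : ℂ) ^ k • (A f ∘ₗ G.Q)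
  map_add' f g := by
    simp only [map_add, LinearMap.comp_add, LinearMap.add_comp, smul_add]; abel
  map_smul' c f := by
    simp only [map_smul, LinearMap.comp_smul, LinearMap.smul_comp, RingHom.id_apply, smul_sub]
    rw [smul_comm ((-1 : ℂ) ^ k) c, ← smul_sub]

/-! ### Distributions in one and two variables -/

/-- The coordinate vector `e_μ`. -/
def basisVec (μ : Fin 4) : Mink := EuclideanSpace.single μ 1

/-- The distributional derivative of `A` in the direction `e`. -/
def dirDeriv {E : Type} [NormedAddCommGroup E] [NormedSpace ℝ E] (e : E) (A : OpMap F E) :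
    OpMap F E :=
  -(A ∘ₗ (LineDeriv.lineDerivOpCLM ℂ 𝓢(E, ℂ) e).toLinearMap)

/-- `∂_μ W`. -/
def pd (μ : Fin 4) (W : OpMap F Mink) : OpMap F Mink := dirDeriv (basisVec μ) W

/-- `∂/∂x₁^μ C`. -/
def pd₁ (μ : Fin 4) (C : OpMap F (Mink × Mink)) : OpMap F (Mink × Mink) :=
  dirDeriv (basisVec μ, 0) C

/-- `∂/∂x₂^μ C`. -/
def pd₂ (μ : Fin 4) (C : OpMap F (Mink × Mink)) : OpMap F (Mink × Mink) :=
  dirDeriv (0, basisVec μ) C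

/-- The exchange `h(x₁, x₂) ↦ h(x₂, x₁)` of test functions. -/
def swapTest : 𝓢(Mink × Mink, ℂ) →L[ℂ] 𝓢(Mink × Mink, ℂ) :=
  SchwartzMap.compCLMOfContinuousLinearEquiv ℂ (ContinuousLinearEquiv.prodComm ℝ Mink Mink)

/-- The restriction `h ↦ h(x, x)` of test functions to the diagonal. -/
def diagTest : 𝓢(Mink × Mink, ℂ) →L[ℂ] 𝓢(Mink, ℂ) :=
  SchwartzMap.compCLMOfAntilipschitz ℂ (K := 1)
    (g := ((ContinuousLinearMap.id ℝ Mink).prod (ContinuousLinearMap.id ℝ Mink)))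
    (ContinuousLinearMap.hasTemperateGrowth _)
    (AntilipschitzWith.of_le_mul_dist fun x y => by simp [Prod.dist_eq])

/-- `δ(x₁ - x₂) W(x₁)`. -/
def deltaMul (W : OpMap F Mink) : OpMap F (Mink × Mink) := W ∘ₗ diagTest.toLinearMap

/-- `[∂_{μ₁} ⋯ ∂_{μₖ} δ](x₂ - x₁) W(x₁)`. -/
def deltaDerivMul {k : ℕ} (μ : Fin k → Fin 4) (W : OpMap F Mink) : OpMap F (Mink × Mink) :=
  (-1 : ℂ) ^ k • (W ∘ₗ diagTest.toLinearMap ∘ₗ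
    (LineDeriv.iteratedLineDerivOpCLM ℂ 𝓢(Mink × Mink, ℂ)
      (fun i => ((0, basisVec (μ i)) : Mink × Mink))).toLinearMap)

/-- A quasi-local operator
`∑_{k ≤ K} [∂_{μ₁} ⋯ ∂_{μₖ} δ](x₂ - x₁) W^{μ₁ ⋯ μₖ}(x₁)` whose coefficients are Wick polynomials
of ghost number `g` and canonical dimension at most `d - k`. -/
def IsQuasiLocal (g : ℤ) (d : ℚ) (A : OpMap F (Mink × Mink)) : Prop :=
  ∃ (K : ℕ) (W : (k : ℕ) → (Fin k → Fin 4) → OpMap F Mink),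
    (∀ (k : ℕ) (μ : Fin k → Fin 4), IsWick g (d - (k : ℚ)) (W k μ)) ∧
    A = ∑ k ∈ Finset.range (K + 1), ∑ μ : Fin k → Fin 4, deltaDerivMul μ (W k μ)

/-! ### Cochains, chronological products, anomalies -/

/-- A collection of Lorentz indices. -/
abbrev Idx : Type := List (Fin 4)

/-- A family `X, X^μ, X^{[μν]}`: antisymmetric in two indices, no components with more. -/
def IsMultivector {V : Type} [AddCommGroup V] (X : Idx → V) : Prop :=
  (∀ μ ν, X [μ, ν] = -X [ν, μ]) ∧ ∀ I : Idx, 2 < I.length → X I = 0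

variable (F) in
/-- Families `C^{I,J}(x₁, x₂)`. -/
abbrev Cochain : Type := Idx → Idx → OpMap F (Mink × Mink)

/-- Antisymmetry in the indices of `I` and of `J`, and the graded symmetry
`C^{I,J}(x₁,x₂) = (-1)^{|I||J|} C^{J,I}(x₂,x₁)`. -/
def IsCochain (C : Cochain F) : Prop :=
  (∀ J, IsMultivector fun I => C I J) ∧ (∀ I, IsMultivector (C I)) ∧
  ∀ I J, C I J = (-1 : ℂ) ^ (I.length * J.length) • (C J I ∘ₗ swapTest.toLinearMap)

/-- `(δC)^{I,J} = ∂/∂x₁^μ C^{Iμ,J} + (-1)^{|I|} ∂/∂x₂^μ C^{I,Jμ}`. -/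
def coDelta (C : Cochain F) : Cochain F := fun I J =>
  ∑ μ, pd₁ μ (C (I ++ [μ]) J) + (-1 : ℂ) ^ I.length • ∑ μ, pd₂ μ (C I (J ++ [μ]))

/-- The interaction `T, T^μ, T^{[μν]}`: Wick polynomials with `gh(T^I) = |I|`, canonical dimension
at most four, `d_Q T^I = i ∂_μ T^{Iμ}`, commuting in the graded sense at space-like distances. -/
structure IsInteraction (G : GaugeCharge F) (T : Idx → OpMap F Mink) : Prop where
  multivector : IsMultivector T
  wick : ∀ I : Idx, IsWick I.length 4 (T I)
  distribution : ∀ I, IsOpDistribution (T I)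
  descent : ∀ I : Idx, dQ G I.length (T I) = Complex.I • ∑ μ, pd μ (T (I ++ [μ]))
  causal : ∀ (I J : Idx) (f g : 𝓢(Mink, ℂ)),
    (∀ x ∈ tsupport f, ∀ y ∈ tsupport g, Spacelike x y) →
    T I f ∘ₗ T J g = (-1 : ℂ) ^ (I.length * J.length) • (T J g ∘ₗ T I f)

/-- Second order chronological products `T^{I,J}(x₁,x₂) = T(T^I(x₁), T^J(x₂))`:
distribution-valued operators with the graded symmetry, such that
`T^{I,J}(x₁,x₂) = T^I(x₁) T^J(x₂)` for `x₁ ≥ x₂`. -/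
structure IsChronological (T : Idx → OpMap F Mink) (T₂ : Cochain F) : Prop where
  cochain : IsCochain T₂
  distribution : ∀ I J, IsOpDistribution (T₂ I J)
  causality : ∀ (I J : Idx) (f g : 𝓢(Mink, ℂ)) (h : 𝓢(Mink × Mink, ℂ)),
    (∀ x y, h (x, y) = f x * g y) →
    (∀ x ∈ tsupport f, ∀ y ∈ tsupport g, CausallyLater x y) →
    T₂ I J h = T I f ∘ₗ T J g

/-- The anomalies `A^{I,J} = d_Q T^{I,J} - i (δT)^{I,J}`. -/
def anomaly (G : GaugeCharge F) (T₂ : Cochain F) : Cochain F := fun I J =>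
  dQ G (I.length + J.length) (T₂ I J) - Complex.I • coDelta T₂ I J

/-- A finite renormalization `T^{I,J} → T^{I,J} + R^{I,J}`: quasi-local, with the graded symmetry,
`gh(R^{I,J}) = |I| + |J|`, and the power counting bound `4 + 4 - 4`. -/
structure IsFiniteRenormalization (R : Cochain F) : Prop where
  cochain : IsCochain R
  quasiLocal : ∀ I J : Idx, IsQuasiLocal (I.length + J.length) 4 (R I J)

/-- The normal form of the second order anomalies: `A₁ = δ W`, `A₂^μ = δ W^μ`,
`A₃^{[μν]} = δ W^{[μν]}`, `A₄^{μ;ν} = - δ W^{[μν]}`, `A₅ = 0`, `A₆ = 0`, with Wick polynomials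
`gh(W^I) = |I| + 1` of canonical dimension at most five. -/
structure IsNormalForm (A : Cochain F) (W : Idx → OpMap F Mink) : Prop where
  multivector : IsMultivector W
  wick : ∀ I : Idx, IsWick (I.length + 1) 5 (W I)
  A₁ : A [] [] = deltaMul (W [])
  A₂ : ∀ μ, A [μ] [] = deltaMul (W [μ])
  A₃ : ∀ μ ν, A [μ, ν] [] = deltaMul (W [μ, ν])
  A₄ : ∀ μ ν, A [μ] [ν] = -deltaMul (W [μ, ν])
  A₅ : ∀ μ ν ρ, A [μ, ν] [ρ] = 0
  A₆ : ∀ μ ν ρ σ, A [μ, ν] [ρ, σ] = 0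

/-- `W'` and `W` differ by the coboundary of Wick polynomials `B, B^μ, B^{[μν]}` with
`gh(B^I) = |I|` and canonical dimension at most four: `W` and `W^μ` by the relative coboundaries
`d_Q B - i ∂_μ B^μ` and `d_Q B^μ - i ∂_ν B^{[μν]}`, `W^{[μν]}` by the coboundary
`d_Q B^{[μν]}`. -/
def DifferByCoboundary (G : GaugeCharge F) (W W' : Idx → OpMap F Mink) : Prop :=
  ∃ B : Idx → OpMap F Mink, IsMultivector B ∧ (∀ I : Idx, IsWick I.length 4 (B I)) ∧
    W' [] = W [] + dQ G 0 (B []) - Complex.I • ∑ μ, pd μ (B [μ]) ∧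
    (∀ μ, W' [μ] = W [μ] + dQ G 1 (B [μ]) - Complex.I • ∑ ν, pd ν (B [μ, ν])) ∧
    ∀ μ ν, W' [μ, ν] = W [μ, ν] + dQ G 2 (B [μ, ν])

end

end CausalGauge

open CausalGauge

open MeasureTheory
open scoped SchwartzMap LineDeriv

namespace CausalGauge

noncomputable section

variable {F : FieldContent}

/-! ### Operators on distributions in two variables -/

/-! Quasi-local operators behave like polynomials in a relative derivative with Wick polynomials as
coefficients. Derivatives are split into the total one, `dT` = ∂₁ + ∂₂, which acts on the
coefficients only, and the relative one, `dR` = (∂₂ - ∂₁)/2, which raises the order of the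
derivatives of δ. Multiplication `mZ` by z = x₂ - x₁ commutes with `dT`, satisfies the Weyl relation
with `dR` and annihilates δW, and the exchange of the variables acts on order k as (-1)^k.
Consequences are Euler's identity `sum_dR_mZ`, a well-defined leading part (`eq_zero_of_mem_ordLe`,
`exists_top`), and explicit homotopies. Removing derivatives of δ thereby becomes a question about
index symmetries of the coefficients.

On cochains d_Q and δ commute and both square to zero, so the anomaly A = (d_Q - iδ)T₂ obeys the
consistency condition (d_Q + iδ)A = 0, and a renormalization R adds (d_Q - iδ)R to it. The core is
`exists_forall_mem_ordLe_zero`: a quasi-local cochain C with (d_Q - cδ)C free of derivatives of δ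
can be freed of derivatives by adding some (d_Q + cδ)R. The proof is by induction on the number n of
indices. Once components with fewer indices are derivative-free, the condition makes δC
derivative-free in degree n - 1; this constrains the leading parts in degree n so much that δR, with
R in degree n + 1, removes them, while d_Q R affects degree n + 1 only. Since each field has ghost
number at most 1 and dimension at least 1, a Wick polynomial whose ghost number exceeds its
dimension vanishes. Hence degree n ≤ 4 allows at most 4 - n derivatives, and only the degrees 0 to 3
need an argument.

When all components are derivative-free, so is δA. Its first-order part then forces A₄ = -A₃ and A₅
= A₆ = 0 (`exists_isLocalForm`), and the descent equations are the consistency condition read in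
this form.

For uniqueness the core statement is used again, on the difference of two renormalizations with
normal-form anomalies, with ghost number and dimension one lower. A term (d_Q + iδ)S does not change
the anomaly, so the difference may be replaced by a derivative-free cochain with coefficients B,
whose anomaly is d_Q B - i∂B. Conversely every B defines such a renormalization.

The analytic input is that Wick polynomials are stable under ∂_μ and d_Q with dimension raised by at
most one (`IsWick.pdL`, `IsWick.dQ`), that operators are determined by their matrix elements, and
that δW determines W (`dlt_injective`). -/

/-- The relative coordinate `(x₂ - x₁)_μ`. -/
def relCoord (μ : Fin 4) : Mink × Mink →L[ℝ] ℝ :=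
  (EuclideanSpace.proj μ : Mink →L[ℝ] ℝ) ∘L
    (ContinuousLinearMap.snd ℝ Mink Mink - ContinuousLinearMap.fst ℝ Mink Mink)

lemma relCoord_apply (μ : Fin 4) (z : Mink × Mink) : relCoord μ z = z.2 μ - z.1 μ := rfl

/-- The relative coordinate as a complex-valued function. -/
def relCoordC (μ : Fin 4) (z : Mink × Mink) : ℂ := (relCoord μ z : ℂ)

lemma relCoordC_temperate (μ : Fin 4) : (relCoordC μ).HasTemperateGrowth := by
  unfold relCoordC
  exact (Complex.ofRealCLM ∘L relCoord μ).hasTemperateGrowth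

/-- Multiplication of test functions by `(x₂ - x₁)_μ`. -/
def mulTest (μ : Fin 4) : 𝓢(Mink × Mink, ℂ) →L[ℂ] 𝓢(Mink × Mink, ℂ) :=
  SchwartzMap.smulLeftCLM ℂ (relCoordC μ)

lemma mulTest_apply (μ : Fin 4) (h : 𝓢(Mink × Mink, ℂ)) (z : Mink × Mink) :
    mulTest μ h z = relCoordC μ z * h z := by
  simp [mulTest, relCoordC_temperate]

lemma swapTest_apply (h : 𝓢(Mink × Mink, ℂ)) (z : Mink × Mink) :
    swapTest h z = h z.swap := rfl

lemma diagTest_apply (h : 𝓢(Mink × Mink, ℂ)) (x : Mink) : diagTest h x = h (x, x) := rfl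

lemma lineDeriv_mulTest (e : Mink × Mink) (μ : Fin 4) (h : 𝓢(Mink × Mink, ℂ)) :
    ∂_{e} (mulTest μ h) = relCoordC μ e • h + mulTest μ (∂_{e} h) := by
  ext z
  rw [SchwartzMap.lineDerivOp_apply_eq_fderiv, add_apply, smul_apply,
    mulTest_apply, SchwartzMap.lineDerivOp_apply_eq_fderiv]
  have h1 : HasFDerivAt (relCoordC μ) (Complex.ofRealCLM ∘L relCoord μ) z :=
    (Complex.ofRealCLM ∘L relCoord μ).hasFDerivAt
  have h2 := (h1.mul (h.hasFDerivAt z)).fderiv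
  have h3 : (mulTest μ h : Mink × Mink → ℂ) = relCoordC μ * h :=
    funext fun z => mulTest_apply μ h z
  rw [h3, h2]
  simp [relCoordC]
  ring

lemma lineDeriv_swapTest (e : Mink × Mink) (h : 𝓢(Mink × Mink, ℂ)) :
    ∂_{e} (swapTest h) = swapTest (∂_{e.swap} h) :=
  SchwartzMap.lineDerivOp_compCLMOfContinuousLinearEquiv ℂ e _ h

lemma mulTest_swapTest (μ : Fin 4) (h : 𝓢(Mink × Mink, ℂ)) :
    mulTest μ (swapTest h) = -swapTest (mulTest μ h) := by
  ext z
  simp [mulTest_apply, swapTest_apply, relCoordC, relCoord_apply]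
  ring

lemma lineDeriv_diagTest (e : Mink) (h : 𝓢(Mink × Mink, ℂ)) :
    ∂_{e} (diagTest h) = diagTest (∂_{((e, e) : Mink × Mink)} h) := by
  ext x
  rw [SchwartzMap.lineDerivOp_apply_eq_fderiv, diagTest_apply,
    SchwartzMap.lineDerivOp_apply_eq_fderiv]
  have h1 : HasFDerivAt (fun x : Mink => (x, x))
      ((ContinuousLinearMap.id ℝ Mink).prod (ContinuousLinearMap.id ℝ Mink)) x :=
    (hasFDerivAt_id x).prodMk (hasFDerivAt_id x)
  have h2 := (HasFDerivAt.comp (f := fun x : Mink => (x, x)) x (h.hasFDerivAt (x, x)) h1).fderiv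
  have h3 : (diagTest h : Mink → ℂ) = h ∘ fun x => (x, x) := rfl
  rw [h3, h2]
  simp

lemma diagTest_swapTest (h : 𝓢(Mink × Mink, ℂ)) : diagTest (swapTest h) = diagTest h := by
  ext x; rfl

lemma diagTest_mulTest (μ : Fin 4) (h : 𝓢(Mink × Mink, ℂ)) : diagTest (mulTest μ h) = 0 := by
  ext x
  simp [diagTest_apply, mulTest_apply, relCoordC, relCoord_apply]

/-- Derivatives of Schwartz functions commute. -/
lemma lineDeriv_comm {E : Type} [NormedAddCommGroup E] [NormedSpace ℝ E] (e e' : E)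
    (h : 𝓢(E, ℂ)) : ∂_{e} (∂_{e'} h) = ∂_{e'} (∂_{e} h) := by
  ext z
  have key : ∀ a b : E, (∂_{a} (∂_{b} h) : 𝓢(E, ℂ)) z = fderiv ℝ (fderiv ℝ h) z a b := by
    intro a b
    rw [SchwartzMap.lineDerivOp_apply_eq_fderiv]
    have h3 : (∂_{b} h : 𝓢(E, ℂ)) = fun z => fderiv ℝ h z b :=
      funext fun z => SchwartzMap.lineDerivOp_apply_eq_fderiv b h z
    have h4 : DifferentiableAt ℝ (fderiv ℝ h) z :=
      ((h.smooth 2).fderiv_right (m := 1) (by norm_num)).differentiable (by norm_num) z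
    rw [h3, fderiv_clm_apply h4 (by fun_prop)]
    simp
  rw [key, key]
  have hs : IsSymmSndFDerivAt ℝ h z :=
    ((h.smooth 2).contDiffAt).isSymmSndFDerivAt (by simp)
  exact hs e e'

variable (F) in
/-- Distribution-valued operators in two variables. -/
abbrev Op₂ : Type := OpMap F (Mink × Mink)

/-- Precomposition with an operation on test functions. -/
def pre {E E' : Type} [NormedAddCommGroup E] [NormedSpace ℝ E] [NormedAddCommGroup E']
    [NormedSpace ℝ E'] (t : 𝓢(E, ℂ) →L[ℂ] 𝓢(E', ℂ)) : OpMap F E' →ₗ[ℂ] OpMap F E :=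
  LinearMap.lcomp ℂ _ t.toLinearMap

lemma pre_apply {E E' : Type} [NormedAddCommGroup E] [NormedSpace ℝ E] [NormedAddCommGroup E']
    [NormedSpace ℝ E'] (t : 𝓢(E, ℂ) →L[ℂ] 𝓢(E', ℂ)) (A : OpMap F E') (h : 𝓢(E, ℂ)) :
    pre t A h = A (t h) := rfl

/-- `∂_μ` as a linear map. -/
def pdL (μ : Fin 4) : OpMap F Mink →ₗ[ℂ] OpMap F Mink :=
  -pre (LineDeriv.lineDerivOpCLM ℂ 𝓢(Mink, ℂ) (basisVec μ))

lemma pd_eq (μ : Fin 4) (W : OpMap F Mink) : pd μ W = pdL μ W := rfl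

/-- `∂/∂x₁^μ` as a linear map. -/
def d₁ (μ : Fin 4) : Op₂ F →ₗ[ℂ] Op₂ F :=
  -pre (LineDeriv.lineDerivOpCLM ℂ 𝓢(Mink × Mink, ℂ) ((basisVec μ, 0) : Mink × Mink))

/-- `∂/∂x₂^μ` as a linear map. -/
def d₂ (μ : Fin 4) : Op₂ F →ₗ[ℂ] Op₂ F :=
  -pre (LineDeriv.lineDerivOpCLM ℂ 𝓢(Mink × Mink, ℂ) ((0, basisVec μ) : Mink × Mink))

lemma pd₁_eq (μ : Fin 4) (A : Op₂ F) : pd₁ μ A = d₁ μ A := rfl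

lemma pd₂_eq (μ : Fin 4) (A : Op₂ F) : pd₂ μ A = d₂ μ A := rfl

/-- `∂/∂x₁^μ + ∂/∂x₂^μ`. -/
def dT (μ : Fin 4) : Op₂ F →ₗ[ℂ] Op₂ F := d₁ μ + d₂ μ

/-- Half the difference of `∂/∂x₂^μ` and `∂/∂x₁^μ`. -/
def dR (μ : Fin 4) : Op₂ F →ₗ[ℂ] Op₂ F := (2⁻¹ : ℂ) • (d₂ μ - d₁ μ)

/-- Multiplication by `(x₂ - x₁)_μ`. -/
def mZ (μ : Fin 4) : Op₂ F →ₗ[ℂ] Op₂ F := pre (mulTest μ)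

/-- The exchange of the two variables. -/
def sw : Op₂ F →ₗ[ℂ] Op₂ F := pre swapTest

lemma sw_eq (A : Op₂ F) : A ∘ₗ swapTest.toLinearMap = sw A := rfl

/-- `W ↦ δ(x₁ - x₂) W(x₁)` as a linear map. -/
def dlt : OpMap F Mink →ₗ[ℂ] Op₂ F := pre diagTest

/-- Separates the part of a derivative that differentiates the coefficient from the part that raises
the order of δ; all leading-order computations use this form. -/
lemma d₁_eq (μ : Fin 4) (A : Op₂ F) : d₁ μ A = (2⁻¹ : ℂ) • dT μ A - dR μ A := by
  simp only [dT, dR, LinearMap.add_apply, LinearMap.smul_apply, LinearMap.sub_apply]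
  module

lemma d₂_eq (μ : Fin 4) (A : Op₂ F) : d₂ μ A = (2⁻¹ : ℂ) • dT μ A + dR μ A := by
  simp only [dT, dR, LinearMap.add_apply, LinearMap.smul_apply, LinearMap.sub_apply]
  module

lemma d₁_apply (μ : Fin 4) (A : Op₂ F) (h : 𝓢(Mink × Mink, ℂ)) :
    d₁ μ A h = -A (∂_{((basisVec μ, 0) : Mink × Mink)} h) := rfl

lemma d₂_apply (μ : Fin 4) (A : Op₂ F) (h : 𝓢(Mink × Mink, ℂ)) :
    d₂ μ A h = -A (∂_{((0, basisVec μ) : Mink × Mink)} h) := rfl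

lemma d₁_d₁ (μ ν : Fin 4) (A : Op₂ F) : d₁ μ (d₁ ν A) = d₁ ν (d₁ μ A) := by
  refine LinearMap.ext fun h => ?_
  simp only [d₁_apply, lineDeriv_comm _ ((basisVec ν, 0) : Mink × Mink)]

lemma d₂_d₂ (μ ν : Fin 4) (A : Op₂ F) : d₂ μ (d₂ ν A) = d₂ ν (d₂ μ A) := by
  refine LinearMap.ext fun h => ?_
  simp only [d₂_apply, lineDeriv_comm _ ((0, basisVec ν) : Mink × Mink)]

lemma d₁_d₂ (μ ν : Fin 4) (A : Op₂ F) : d₁ μ (d₂ ν A) = d₂ ν (d₁ μ A) := by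
  refine LinearMap.ext fun h => ?_
  simp only [d₁_apply, d₂_apply, lineDeriv_comm _ ((0, basisVec ν) : Mink × Mink)]

lemma dR_dR (μ ν : Fin 4) (A : Op₂ F) : dR μ (dR ν A) = dR ν (dR μ A) := by
  simp only [dR, LinearMap.smul_apply, LinearMap.sub_apply, map_smul, map_sub, d₁_d₁ μ ν,
    d₂_d₂ μ ν, d₁_d₂ ν μ, d₁_d₂ μ ν]
  module

lemma dT_dR (μ ν : Fin 4) (A : Op₂ F) : dT μ (dR ν A) = dR ν (dT μ A) := by
  simp only [dT, dR, LinearMap.smul_apply, LinearMap.sub_apply, LinearMap.add_apply, map_smul,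
    map_sub, map_add, d₁_d₁ μ ν, d₂_d₂ μ ν, d₁_d₂ ν μ, d₁_d₂ μ ν]
  module

lemma relCoordC_fst (μ ν : Fin 4) :
    relCoordC ν ((basisVec μ, 0) : Mink × Mink) = if μ = ν then -1 else 0 := by
  simp only [relCoordC, relCoord_apply, basisVec]
  split_ifs with h <;> simp [h, eq_comm]

lemma relCoordC_snd (μ ν : Fin 4) :
    relCoordC ν ((0, basisVec μ) : Mink × Mink) = if μ = ν then 1 else 0 := by
  simp only [relCoordC, relCoord_apply, basisVec]
  split_ifs with h <;> simp [h, eq_comm]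

lemma d₁_mZ (μ ν : Fin 4) (A : Op₂ F) :
    d₁ μ (mZ ν A) = mZ ν (d₁ μ A) - (if μ = ν then (1 : ℂ) else 0) • A := by
  refine LinearMap.ext fun h => ?_
  simp only [mZ, pre_apply, d₁_apply, LinearMap.sub_apply, LinearMap.smul_apply,
    lineDeriv_mulTest, relCoordC_fst, map_add, map_smul]
  split_ifs <;> simp

lemma d₂_mZ (μ ν : Fin 4) (A : Op₂ F) :
    d₂ μ (mZ ν A) = mZ ν (d₂ μ A) + (if μ = ν then (1 : ℂ) else 0) • A := by
  refine LinearMap.ext fun h => ?_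
  simp only [mZ, pre_apply, d₂_apply, LinearMap.add_apply, LinearMap.smul_apply,
    lineDeriv_mulTest, relCoordC_snd, map_add, map_smul]
  split_ifs <;> simp

/-- Both variables contribute the same constant to the commutator, and the factor 1/2 in `dR`
normalises the sum to one: `mZ` and `dR` form a Weyl algebra. -/
lemma mZ_dR (μ ν : Fin 4) (A : Op₂ F) :
    mZ ν (dR μ A) = dR μ (mZ ν A) - (if μ = ν then (1 : ℂ) else 0) • A := by
  simp only [dR, LinearMap.smul_apply, LinearMap.sub_apply, d₁_mZ, d₂_mZ, map_smul, map_sub]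
  module

lemma mZ_dT (μ ν : Fin 4) (A : Op₂ F) : mZ ν (dT μ A) = dT μ (mZ ν A) := by
  simp only [dT, LinearMap.add_apply, d₁_mZ, d₂_mZ, map_add]
  module

lemma mZ_mZ (μ ν : Fin 4) (A : Op₂ F) : mZ μ (mZ ν A) = mZ ν (mZ μ A) := by
  refine LinearMap.ext fun h => ?_
  simp only [mZ, pre_apply]
  congr 1
  ext z
  simp only [mulTest_apply]
  ring

lemma sw_sw (A : Op₂ F) : sw (sw A) = A := by
  refine LinearMap.ext fun h => ?_
  simp only [sw, pre_apply]
  congr 1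

lemma sw_d₁ (μ : Fin 4) (A : Op₂ F) : sw (d₁ μ A) = d₂ μ (sw A) := by
  refine LinearMap.ext fun h => ?_
  simp only [sw, pre_apply, d₁_apply, d₂_apply, lineDeriv_swapTest, Prod.swap]

lemma sw_d₂ (μ : Fin 4) (A : Op₂ F) : sw (d₂ μ A) = d₁ μ (sw A) := by
  refine LinearMap.ext fun h => ?_
  simp only [sw, pre_apply, d₁_apply, d₂_apply, lineDeriv_swapTest, Prod.swap]

/-- The symmetric choice of the relative derivative makes the exchange a mere sign; the derivative
in x₂ alone does not have this property. -/
lemma sw_dR (μ : Fin 4) (A : Op₂ F) : sw (dR μ A) = -dR μ (sw A) := by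
  simp only [dR, LinearMap.smul_apply, LinearMap.sub_apply, map_smul, map_sub, sw_d₁, sw_d₂]
  module

lemma sw_mZ (μ : Fin 4) (A : Op₂ F) : sw (mZ μ A) = -mZ μ (sw A) := by
  refine LinearMap.ext fun h => ?_
  simp only [sw, mZ, pre_apply, LinearMap.neg_apply, mulTest_swapTest, map_neg]

lemma sw_dlt (W : OpMap F Mink) : sw (dlt W) = dlt W := by
  refine LinearMap.ext fun h => ?_
  simp only [sw, dlt, pre_apply, diagTest_swapTest]

lemma mZ_dlt (μ : Fin 4) (W : OpMap F Mink) : mZ μ (dlt W) = 0 := by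
  refine LinearMap.ext fun h => ?_
  simp only [mZ, dlt, pre_apply, diagTest_mulTest, map_zero, LinearMap.zero_apply]

/-- Chain rule for h(x, x): the derivative along the diagonal is the sum of the two partial
derivatives. -/
lemma dT_dlt (μ : Fin 4) (W : OpMap F Mink) : dT μ (dlt W) = dlt (pdL μ W) := by
  refine LinearMap.ext fun h => ?_
  have h1 : (∂_{((basisVec μ, basisVec μ) : Mink × Mink)} h : 𝓢(Mink × Mink, ℂ))
      = ∂_{((basisVec μ, 0) : Mink × Mink)} h + ∂_{((0, basisVec μ) : Mink × Mink)} h := by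
    rw [← LineDeriv.lineDerivOp_left_add]; simp
  change -(W (diagTest _)) + -(W (diagTest _)) = -(W (∂_{basisVec μ} (diagTest h)))
  rw [lineDeriv_diagTest, h1, map_add, map_add, neg_add]
  rfl

/-! ### Test functions with prescribed restriction to the diagonal -/

/-- The Schwartz function `(x, z) ↦ f x * g z`. -/
def tensorTest (f g : 𝓢(Mink, ℂ)) : 𝓢(Mink × Mink, ℂ) where
  toFun w := f w.1 * g w.2
  smooth' := ((f.smooth ⊤).comp contDiff_fst).mul ((g.smooth ⊤).comp contDiff_snd)
  decay' k n := by
    have hcomp : ∀ (f : 𝓢(Mink, ℂ)) (l : Mink × Mink →L[ℝ] Mink), ‖l‖ ≤ 1 → ∀ i w,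
        ‖iteratedFDeriv ℝ i (fun w => f (l w)) w‖ ≤ ‖iteratedFDeriv ℝ i f (l w)‖ := by
      intro f l hl i w
      have h1 := l.iteratedFDeriv_comp_right (f.smooth i) w (le_refl _)
      change ‖iteratedFDeriv ℝ i (f ∘ l) w‖ ≤ _
      rw [h1]
      refine (ContinuousMultilinearMap.norm_compContinuousLinearMap_le _ _).trans ?_
      refine mul_le_of_le_one_right (norm_nonneg _) ?_
      exact Finset.prod_le_one (fun _ _ => norm_nonneg _) fun _ _ => hl
    choose Cf hCf using fun k i => f.decay k i
    choose Cg hCg using fun k i => g.decay k i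
    refine ⟨∑ i ∈ Finset.range (n + 1), (n.choose i : ℝ) *
      (Cf k i * Cg 0 (n - i) + Cf 0 i * Cg k (n - i)), fun w => ?_⟩
    have hmul := norm_iteratedFDeriv_mul_le (𝕜 := ℝ) (N := n) (n := n)
      ((f.smooth n).comp (contDiff_fst (E := Mink) (F := Mink)))
      ((g.smooth n).comp (contDiff_snd (E := Mink) (F := Mink))) w (le_refl _)
    refine (mul_le_mul_of_nonneg_left hmul (by positivity)).trans ?_
    rw [Finset.mul_sum]
    refine Finset.sum_le_sum fun i _ => ?_
    have h1 := hcomp f (ContinuousLinearMap.fst ℝ Mink Mink)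
      (ContinuousLinearMap.norm_fst_le ..) i w
    have h2 := hcomp g (ContinuousLinearMap.snd ℝ Mink Mink) (ContinuousLinearMap.norm_snd_le ..)
      (n - i) w
    set a := ‖iteratedFDeriv ℝ i f w.1‖
    set b := ‖iteratedFDeriv ℝ (n - i) g w.2‖
    -- The norm of a pair is the larger of the two norms, so the weight can be placed on a single
    -- factor and the other one needs only its unweighted bound.
    have hk : ‖w‖ ^ k ≤ ‖w.1‖ ^ k + ‖w.2‖ ^ k := by
      rw [Prod.norm_def]
      rcases max_choice ‖w.1‖ ‖w.2‖ with h | h <;> rw [h]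
      · exact le_add_of_nonneg_right (by positivity)
      · exact le_add_of_nonneg_left (by positivity)
    have e1 : ‖w.1‖ ^ k * a ≤ Cf k i := (hCf k i).2 w.1
    have e2 : a ≤ Cf 0 i := by simpa using (hCf 0 i).2 w.1
    have e3 : ‖w.2‖ ^ k * b ≤ Cg k (n - i) := (hCg k (n - i)).2 w.2
    have e4 : b ≤ Cg 0 (n - i) := by simpa using (hCg 0 (n - i)).2 w.2
    have ha : 0 ≤ a := norm_nonneg _
    have hb : 0 ≤ b := norm_nonneg _
    have hw1 : 0 ≤ ‖w.1‖ ^ k := by positivity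
    calc ‖w‖ ^ k * ((n.choose i : ℝ) * ‖iteratedFDeriv ℝ i (f ∘ Prod.fst) w‖ *
            ‖iteratedFDeriv ℝ (n - i) (g ∘ Prod.snd) w‖)
        ≤ (‖w.1‖ ^ k + ‖w.2‖ ^ k) * ((n.choose i : ℝ) * a * b) := by
          gcongr
          · exact h1
          · exact h2
      _ = (n.choose i : ℝ) * ((‖w.1‖ ^ k * a) * b + a * (‖w.2‖ ^ k * b)) := by ring
      _ ≤ _ := by
          gcongr
          · exact le_trans (by positivity) e1
          · exact le_trans ha e2

/-- The shear `(x₁, x₂) ↦ (x₁, x₂ - x₁)`. -/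
def shear : (Mink × Mink) ≃L[ℝ] (Mink × Mink) :=
  ContinuousLinearEquiv.equivOfInverse
    ((ContinuousLinearMap.fst ℝ Mink Mink).prod
      (ContinuousLinearMap.snd ℝ Mink Mink - ContinuousLinearMap.fst ℝ Mink Mink))
    ((ContinuousLinearMap.fst ℝ Mink Mink).prod
      (ContinuousLinearMap.snd ℝ Mink Mink + ContinuousLinearMap.fst ℝ Mink Mink))
    (fun w => by simp) (fun w => by simp)

lemma exists_schwartz_one_at_zero : ∃ g : 𝓢(Mink, ℂ), g 0 = 1 := by
  let b : ContDiffBump (0 : Mink) := ⟨1, 2, by norm_num, by norm_num⟩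
  have h1 : HasCompactSupport fun x => (b x : ℂ) :=
    b.hasCompactSupport.comp_left (g := Complex.ofReal) Complex.ofReal_zero
  have h2 : ContDiff ℝ (⊤ : ℕ∞) fun x => (b x : ℂ) := by
    have h3 : ContDiff ℝ (⊤ : ℕ∞) b := b.contDiff
    exact Complex.ofRealCLM.contDiff.comp h3
  refine ⟨h1.toSchwartzMap h2, ?_⟩
  change ((b 0 : ℝ) : ℂ) = 1
  rw [b.one_of_mem_closedBall (Metric.mem_closedBall_self (by norm_num)), Complex.ofReal_one]

/-- A preimage of f is f(x₁) g(x₂ - x₁) with g(0) = 1, a Schwartz function because the shear is a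
linear isomorphism. -/
lemma diagTest_surjective : Function.Surjective diagTest := by
  intro f
  obtain ⟨g, hg⟩ := exists_schwartz_one_at_zero
  refine ⟨SchwartzMap.compCLMOfContinuousLinearEquiv ℂ shear (tensorTest f g), ?_⟩
  ext x
  change f x * g (x - x) = f x
  simp [hg]

/-- Every test function on Minkowski space is the restriction of one to the diagonal. This
uniqueness of the coefficient turns identities between quasi-local operators into identities between
Wick polynomials. -/
lemma dlt_injective : Function.Injective (dlt : OpMap F Mink → Op₂ F) := by
  intro W W' h
  refine LinearMap.ext fun f => ?_
  obtain ⟨u, rfl⟩ := diagTest_surjective f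
  exact LinearMap.congr_fun h u

/-! ### The scalar product -/

/-- The invariant measure on the momenta of `n` particles of species `s`. -/
def shellPi (F : FieldContent) {n : ℕ} (s : Fin n → F.Species) : Measure (Fin n → Mom) :=
  Measure.pi fun i => shellMeasure (F.mass (s i))

/-- An integrable weight on the momenta of `n` particles. -/
def weight (n : ℕ) (p : Fin n → Mom) : ℝ := ∏ i, (1 + ‖p i‖) ^ (-(5 : ℕ) : ℝ)

instance shellMeasure_sigmaFinite (m : ℝ) : SigmaFinite (shellMeasure m) := by
  unfold shellMeasure
  exact SigmaFinite.withDensity_ofReal _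

lemma energy_pos_of_ne (m : ℝ) {p : Mom} (hp : p ≠ 0) : 0 < energy m p :=
  lt_of_lt_of_le (norm_pos_iff.2 hp) (norm_le_energy m p)

/-- The density is nonzero off p = 0, a Lebesgue null set, so Lebesgue measure is absolutely
continuous with respect to the shell measure. Full support is what makes the scalar product definite
on continuous wave functions. -/
instance shellMeasure_isOpenPos (m : ℝ) : (shellMeasure m).IsOpenPosMeasure := by
  have hmeas : Measurable fun p : Mom => ENNReal.ofReal (1 / (2 * energy m p)) :=
    (measurable_const.div ((continuous_energy m).measurable.const_mul 2)).ennreal_ofReal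
  have hac : (volume : Measure Mom) ≪ shellMeasure m := by
    refine withDensity_absolutelyContinuous' hmeas.aemeasurable ?_
    have h0 : ∀ᵐ p : Mom, p ≠ 0 := by simp [ae_iff]
    filter_upwards [h0] with p hp
    have := energy_pos_of_ne m hp
    simpa using this
  exact hac.isOpenPosMeasure

instance shellPi_isOpenPos {n : ℕ} (s : Fin n → F.Species) :
    (shellPi F s).IsOpenPosMeasure := by
  unfold shellPi; infer_instance

lemma weight_integrable {n : ℕ} (s : Fin n → F.Species) :
    Integrable (weight n) (shellPi F s) :=
  Integrable.fintype_prod_dep (f := fun _ (q : Mom) => (1 + ‖q‖) ^ (-(5 : ℕ) : ℝ))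
    fun i => integrable_shell (F.mass (s i))

/-- Each of the n momenta uses five powers of decay on its mass shell and is bounded by ‖p‖; hence
the exponent 5n. -/
lemma norm_le_weight {n : ℕ} {C a : ℝ} {p : Fin n → Mom} (ha : 0 ≤ a)
    (h : (1 + ‖p‖) ^ (5 * n) * a ≤ C) : a ≤ C * weight n p := by
  have hw : weight n p = (∏ i, (1 + ‖p i‖) ^ 5)⁻¹ := by
    unfold weight
    rw [← Finset.prod_inv_distrib]
    refine Finset.prod_congr rfl fun i _ => ?_
    rw [Real.rpow_neg (by positivity), Real.rpow_natCast]
  have hpos : 0 < ∏ i, (1 + ‖p i‖) ^ 5 := Finset.prod_pos fun i _ => by positivity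
  rw [hw, ← div_eq_mul_inv, le_div_iff₀ hpos]
  have : ∏ i, (1 + ‖p i‖) ^ 5 ≤ (1 + ‖p‖) ^ (5 * n) := by
    calc ∏ i, (1 + ‖p i‖) ^ 5 ≤ ∏ _i : Fin n, (1 + ‖p‖) ^ 5 := by
          refine Finset.prod_le_prod (fun _ _ => by positivity) fun i _ => ?_
          gcongr
          exact norm_le_pi_norm p i
      _ = _ := by simp [pow_mul]
  calc a * ∏ i, (1 + ‖p i‖) ^ 5 ≤ a * (1 + ‖p‖) ^ (5 * n) := by gcongr
    _ ≤ C := by linarith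

lemma one_add_norm_pow_bound {E : Type} [NormedAddCommGroup E] {C a : ℝ} {p : E} {k : ℕ}
    (ha : 0 ≤ a) (h : (1 + ‖p‖) ^ k * a ≤ C) : a ≤ C := by
  refine le_trans ?_ h
  exact le_mul_of_one_le_left ha (one_le_pow₀ (by linarith [norm_nonneg p]))

/-- The integrand of the scalar product. -/
def pairFun (χ ψ : Fock F) {n : ℕ} (s : Fin n → F.Species) (p : Fin n → Mom) : ℂ :=
  (starRingEnd ℂ) (χ.wave n s p) * ψ.wave n s p

lemma pair_integrable (χ ψ : Fock F) {n : ℕ} (s : Fin n → F.Species) :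
    Integrable (pairFun χ ψ s) (shellPi F s) := by
  obtain ⟨C, hC⟩ := χ.wave_mem.2.1 n s 0
  obtain ⟨D, hD⟩ := ψ.wave_mem.2.1 n s (5 * n)
  have hC0 : 0 ≤ C := le_trans (by positivity) (hC 0)
  refine Integrable.mono' ((weight_integrable s).const_mul (C * D)) ?_
    (Filter.Eventually.of_forall fun p => ?_)
  · exact ((Complex.continuous_conj.comp (χ.wave_mem.1 n s)).mul
      (ψ.wave_mem.1 n s)).aestronglyMeasurable
  · rw [pairFun, norm_mul, RCLike.norm_conj, mul_assoc]
    have h1 := one_add_norm_pow_bound (norm_nonneg _) (hC p)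
    gcongr
    exact norm_le_weight (norm_nonneg _) (hD p)

/-- The contribution of the `n`-particle states to the scalar product. -/
def pairN (χ ψ : Fock F) (n : ℕ) : ℂ :=
  ∑ s : Fin n → F.Species, ∫ p, pairFun χ ψ s p ∂(shellPi F s)

lemma pair_eq_finsum (χ ψ : Fock F) : pair χ ψ = ∑ᶠ n, pairN χ ψ n := rfl

lemma pairN_eq_zero {χ ψ : Fock F} {N : ℕ} (hN : ∀ n, N < n → ∀ s p, ψ.wave n s p = 0)
    {n : ℕ} (hn : N < n) : pairN χ ψ n = 0 := by
  simp [pairN, pairFun, hN n hn]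

lemma pair_eq_sum {χ ψ : Fock F} {N : ℕ} (hN : ∀ n, N < n → ∀ s p, ψ.wave n s p = 0) :
    pair χ ψ = ∑ n ∈ Finset.range (N + 1), pairN χ ψ n := by
  rw [pair_eq_finsum]
  refine finsum_eq_sum_of_support_subset _ fun n hn => ?_
  rw [Finset.coe_range, Set.mem_Iio]
  by_contra h
  exact hn (pairN_eq_zero hN (by omega))

lemma pairN_finite_support (χ ψ : Fock F) : (Function.support (pairN χ ψ)).Finite := by
  obtain ⟨N, hN⟩ := ψ.wave_mem.2.2.2
  refine (Set.finite_Iic N).subset fun n hn => ?_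
  rw [Set.mem_Iic]
  by_contra h
  exact hn (pairN_eq_zero hN (by omega))

lemma pair_add_right (χ ψ ψ' : Fock F) : pair χ (ψ + ψ') = pair χ ψ + pair χ ψ' := by
  rw [pair_eq_finsum, pair_eq_finsum, pair_eq_finsum,
    ← finsum_add_distrib (pairN_finite_support _ _) (pairN_finite_support _ _)]
  refine finsum_congr fun n => ?_
  rw [pairN, pairN, pairN, ← Finset.sum_add_distrib]
  refine Finset.sum_congr rfl fun s _ => ?_
  rw [← integral_add (pair_integrable _ _ _) (pair_integrable _ _ _)]
  refine integral_congr_ae (Filter.Eventually.of_forall fun p => ?_)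
  simp only [pairFun, Fock.wave_add, Pi.add_apply]
  ring

lemma pair_smul_right (χ ψ : Fock F) (c : ℂ) : pair χ (c • ψ) = c * pair χ ψ := by
  rw [pair_eq_finsum, pair_eq_finsum, mul_finsum (pairN χ ψ) c]
  refine finsum_congr fun n => ?_
  rw [pairN, pairN, Finset.mul_sum]
  refine Finset.sum_congr rfl fun s _ => ?_
  rw [← integral_const_mul]
  refine integral_congr_ae (Filter.Eventually.of_forall fun p => ?_)
  simp only [pairFun, Fock.wave_smul, Pi.smul_apply, smul_eq_mul]
  ring

lemma pair_conj (χ ψ : Fock F) : pair χ ψ = (starRingEnd ℂ) (pair ψ χ) := by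
  obtain ⟨N, hN⟩ := χ.wave_mem.2.2.2
  obtain ⟨N', hN'⟩ := ψ.wave_mem.2.2.2
  rw [pair_eq_sum (N := max N N') fun n hn => hN' n (lt_of_le_of_lt (le_max_right _ _) hn),
    pair_eq_sum (N := max N N') fun n hn => hN n (lt_of_le_of_lt (le_max_left _ _) hn), map_sum]
  refine Finset.sum_congr rfl fun n _ => ?_
  rw [pairN, pairN, map_sum]
  refine Finset.sum_congr rfl fun s _ => ?_
  rw [← integral_conj]
  refine integral_congr_ae (Filter.Eventually.of_forall fun p => ?_)
  simp only [pairFun, map_mul, Complex.conj_conj]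
  ring

lemma pair_add_left (χ χ' ψ : Fock F) : pair (χ + χ') ψ = pair χ ψ + pair χ' ψ := by
  rw [pair_conj, pair_add_right, map_add, ← pair_conj, ← pair_conj]

lemma pair_smul_left (χ ψ : Fock F) (c : ℂ) :
    pair (c • χ) ψ = (starRingEnd ℂ) c * pair χ ψ := by
  rw [pair_conj, pair_smul_right, map_mul, ← pair_conj]

lemma pairN_self_re_nonneg (ψ : Fock F) (n : ℕ) (s : Fin n → F.Species) :
    0 ≤ ∫ p, ‖ψ.wave n s p‖ ^ 2 ∂(shellPi F s) := integral_nonneg fun p => by positivity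

lemma pairFun_self (ψ : Fock F) {n : ℕ} (s : Fin n → F.Species) (p : Fin n → Mom) :
    pairFun ψ ψ s p = ((‖ψ.wave n s p‖ ^ 2 : ℝ) : ℂ) := by
  rw [pairFun, mul_comm, Complex.mul_conj, Complex.normSq_eq_norm_sq]

lemma pairN_self (ψ : Fock F) (n : ℕ) :
    pairN ψ ψ n = ((∑ s : Fin n → F.Species, ∫ p, ‖ψ.wave n s p‖ ^ 2 ∂(shellPi F s) : ℝ) : ℂ) := by
  rw [pairN, Complex.ofReal_sum]
  refine Finset.sum_congr rfl fun s _ => ?_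
  rw [← integral_complex_ofReal]
  exact integral_congr_ae (Filter.Eventually.of_forall fun p => pairFun_self ψ s p)

/-- The scalar product is definite. -/
lemma eq_zero_of_pair_self {ψ : Fock F} (h : pair ψ ψ = 0) : ψ = 0 := by
  refine Fock.ext ?_
  funext n s p
  change ψ.wave n s p = 0
  obtain ⟨N, hN⟩ := ψ.wave_mem.2.2.2
  by_cases hn : N < n
  · exact hN n hn s p
  rw [pair_eq_sum hN, Finset.sum_congr rfl fun n _ => pairN_self ψ n, ← Complex.ofReal_sum,
    Complex.ofReal_eq_zero,
    Finset.sum_eq_zero_iff_of_nonneg fun n _ =>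
      Finset.sum_nonneg fun s _ => pairN_self_re_nonneg ψ n s] at h
  have h1 := h n (Finset.mem_range.2 (by omega))
  rw [Finset.sum_eq_zero_iff_of_nonneg fun s _ => pairN_self_re_nonneg ψ n s] at h1
  have h2 := h1 s (Finset.mem_univ _)
  have hcont : Continuous fun p => ‖ψ.wave n s p‖ ^ 2 := (ψ.wave_mem.1 n s).norm.pow 2
  have hint : Integrable (fun p => ‖ψ.wave n s p‖ ^ 2) (shellPi F s) := by
    have := (pair_integrable ψ ψ s).norm
    refine this.congr (Filter.Eventually.of_forall fun p => ?_)
    simp only [pairFun_self, Complex.norm_real, norm_pow, norm_norm]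
  rw [integral_eq_zero_iff_of_nonneg (fun p => by positivity) hint] at h2
  -- Vanishing almost everywhere is vanishing everywhere, by continuity and full support of the
  -- measure.
  have h3 := (Continuous.ae_eq_iff_eq (shellPi F s) hcont continuous_const).1 h2
  have h4 : ‖ψ.wave n s p‖ ^ 2 = 0 := congrFun h3 p
  exact norm_eq_zero.1 ((pow_eq_zero_iff two_ne_zero).1 h4)

lemma pair_zero_right (χ : Fock F) : pair χ 0 = 0 := by
  have := pair_smul_right χ 0 0
  simpa using this

lemma pair_neg_right (χ ψ : Fock F) : pair χ (-ψ) = -pair χ ψ := by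
  rw [← neg_one_smul ℂ ψ, pair_smul_right, neg_one_mul]

lemma pair_sub_right (χ ψ ψ' : Fock F) : pair χ (ψ - ψ') = pair χ ψ - pair χ ψ' := by
  rw [sub_eq_add_neg, pair_add_right, pair_neg_right, sub_eq_add_neg]

/-- Operators are determined by their matrix elements. -/
lemma eq_zero_of_pair {E : Type} [NormedAddCommGroup E] [NormedSpace ℝ E] {A : OpMap F E}
    (h : ∀ f χ ψ, pair χ (A f ψ) = 0) : A = 0 :=
  LinearMap.ext fun f => LinearMap.ext fun ψ => eq_zero_of_pair_self (h f (A f ψ) ψ)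

/-! ### Families of Fock space vectors that depend on a point of Minkowski space -/

/-- A line derivative lives at parameter 0; knowing it at every base point gives the derivative
along the whole line, as dominated differentiation requires. -/
lemma hasLineDerivAt_shift {E : Type} [NormedAddCommGroup E] [NormedSpace ℝ E] {f f' : Mink → E}
    {e : Mink} (h : ∀ x, HasLineDerivAt ℝ f (f' x) x e) (x : Mink) (t : ℝ) :
    HasDerivAt (fun t : ℝ => f (x + t • e)) (f' (x + t • e)) t := by
  have h1 : HasDerivAt (fun r : ℝ => f ((x + t • e) + r • e)) (f' (x + t • e)) (t - t) := by
    rw [sub_self]; exact h (x + t • e)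
  have h2 := h1.comp_sub_const t t
  refine h2.congr_of_eventuallyEq (Filter.Eventually.of_forall fun r => ?_)
  simp only
  congr 1
  module

lemma hasLineDerivAt_mul {f g : Mink → ℂ} {f' g' : ℂ} {x e : Mink}
    (hf : HasLineDerivAt ℝ f f' x e) (hg : HasLineDerivAt ℝ g g' x e) :
    HasLineDerivAt ℝ (fun x => f x * g x) (f' * g x + f x * g') x e := by
  have := HasDerivAt.mul hf hg
  simpa using! this

lemma hasLineDerivAt_sum {ι : Type*} {s : Finset ι} {f : ι → Mink → ℂ} {f' : ι → ℂ}
    {x e : Mink} (hf : ∀ i, HasLineDerivAt ℝ (f i) (f' i) x e) :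
    HasLineDerivAt ℝ (fun x => ∑ i ∈ s, f i x) (∑ i ∈ s, f' i) x e :=
  HasDerivAt.fun_sum fun i _ => hf i

/-- The dominating function is uniform in x, so the whole line serves as the neighbourhood in the
dominated differentiation theorem. -/
lemma hasLineDerivAt_integral {α : Type} [MeasurableSpace α] {m : Measure α}
    {G G' : Mink → α → ℂ} {e : Mink} {b : α → ℝ}
    (hG : ∀ x, AEStronglyMeasurable (G x) m) (hG' : ∀ x, AEStronglyMeasurable (G' x) m)
    (hGb : ∀ x, Integrable (G x) m) (hb : ∀ x a, ‖G' x a‖ ≤ b a) (hbi : Integrable b m)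
    (hd : ∀ x a, HasLineDerivAt ℝ (fun x => G x a) (G' x a) x e) (x : Mink) :
    HasLineDerivAt ℝ (fun x => ∫ a, G x a ∂m) (∫ a, G' x a ∂m) x e := by
  have h := (hasDerivAt_integral_of_dominated_loc_of_deriv_le (μ := m) (x₀ := (0 : ℝ))
    (F := fun t a => G (x + t • e) a) (F' := fun t a => G' (x + t • e) a) (s := Set.univ)
    (bound := b) Filter.univ_mem (Filter.Eventually.of_forall fun t => hG _) (hGb _) (hG' _)
    (Filter.Eventually.of_forall fun a t _ => hb _ a) hbi
    (Filter.Eventually.of_forall fun a t _ =>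
      hasLineDerivAt_shift (f := fun x => G x a) (f' := fun x => G' x a) (fun x => hd x a) x t)).2
  simpa only [zero_smul, add_zero] using! h

/-- Vectors of `D` depending on `x` such that the wave functions are jointly continuous and
decrease rapidly, uniformly in `x`. -/
structure UniformFamily (Ψ : Mink → Fock F) : Prop where
  cont : ∀ n s, Continuous fun w : Mink × (Fin n → Mom) => (Ψ w.1).wave n s w.2
  bound : ∀ n s (k : ℕ), ∃ C : ℝ, ∀ x p, (1 + ‖p‖) ^ k * ‖(Ψ x).wave n s p‖ ≤ C
  fin : ∃ N, ∀ n, N < n → ∀ x s p, (Ψ x).wave n s p = 0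

/-- The family `Ψ'` is the derivative of `Ψ` in the direction `e`, pointwise. -/
def FamilyDeriv (e : Mink) (Ψ Ψ' : Mink → Fock F) : Prop :=
  ∀ n s p x, HasLineDerivAt ℝ (fun x => (Ψ x).wave n s p) ((Ψ' x).wave n s p) x e

lemma UniformFamily.const (ψ : Fock F) : UniformFamily fun _ => ψ where
  cont n s := (ψ.wave_mem.1 n s).comp continuous_snd
  bound n s k := by
    obtain ⟨C, hC⟩ := ψ.wave_mem.2.1 n s k
    exact ⟨C, fun _ => hC⟩
  fin := by
    obtain ⟨N, hN⟩ := ψ.wave_mem.2.2.2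
    exact ⟨N, fun n hn _ => hN n hn⟩

lemma FamilyDeriv.const (e : Mink) (ψ : Fock F) : FamilyDeriv e (fun _ => ψ) fun _ => 0 :=
  fun _ _ _ _ => hasDerivAt_const _ _

lemma UniformFamily.add {Ψ Ψ' : Mink → Fock F} (h : UniformFamily Ψ) (h' : UniformFamily Ψ') :
    UniformFamily fun x => Ψ x + Ψ' x where
  cont n s := (h.cont n s).add (h'.cont n s)
  bound n s k := by
    obtain ⟨C, hC⟩ := h.bound n s k
    obtain ⟨C', hC'⟩ := h'.bound n s k
    refine ⟨C + C', fun x p => ?_⟩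
    calc (1 + ‖p‖) ^ k * ‖(Ψ x).wave n s p + (Ψ' x).wave n s p‖
        ≤ (1 + ‖p‖) ^ k * (‖(Ψ x).wave n s p‖ + ‖(Ψ' x).wave n s p‖) := by
          gcongr; exact norm_add_le _ _
      _ ≤ C + C' := by rw [mul_add]; exact add_le_add (hC x p) (hC' x p)
  fin := by
    obtain ⟨N, hN⟩ := h.fin
    obtain ⟨N', hN'⟩ := h'.fin
    refine ⟨max N N', fun n hn x s p => ?_⟩
    simp [Fock.wave_add, hN n (lt_of_le_of_lt (le_max_left _ _) hn) x s p,
      hN' n (lt_of_le_of_lt (le_max_right _ _) hn) x s p]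

/-- The annihilation operator with amplitudes `a_σ(p) ∂^α e^{-ip·x}`. -/
def annPW (a : F.Species → Mom → ℂ) (ha : ∀ σ, IsAmplitude (a σ)) (α : Fin 4 → ℕ) (x : Mink) :
    Fock F →ₗ[ℂ] Fock F :=
  annihilate (fun σ p => a σ p * planeWave (F.mass σ) α x p)
    fun σ => (ha σ).mul (isAmplitude_planeWave _ _ _)

lemma posPart_eq (j : Jet F) (x : Mink) : posPart j x = annPW (F.u j.1) (F.u_amp j.1) j.2 x := rfl

lemma negPartAdj_eq (j : Jet F) (x : Mink) :
    negPartAdj j x = annPW (fun σ p => (starRingEnd ℂ) (F.v j.1 σ p))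
      (fun σ => (F.v_amp j.1 σ).conj) j.2 x := rfl

/-- The point x enters only through a phase, which is why all bounds on amplitudes are uniform in x.
-/
lemma norm_planeWave (m : ℝ) (α : Fin 4 → ℕ) (x : Mink) (p : Mom) :
    ‖planeWave m α x p‖ = ‖planeWave m α 0 p‖ := by
  simp only [planeWave, norm_mul, Complex.norm_exp]
  simp

lemma continuous_planeWave (m : ℝ) (α : Fin 4 → ℕ) :
    Continuous fun w : Mink × Mom => planeWave m α w.1 w.2 := by
  have h (μ : Fin 4) := continuous_fourMom m μ
  unfold planeWave
  fun_prop

lemma hasLineDerivAt_planeWave (m : ℝ) (α : Fin 4 → ℕ) (μ : Fin 4) (p : Mom) (x : Mink) :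
    HasLineDerivAt ℝ (fun x => planeWave m α x p) (planeWave m (α + Pi.single μ 1) x p) x
      (basisVec μ) := by
  have h1 : HasDerivAt (fun t : ℝ => ((∑ ν, fourMom m p ν * (x + t • basisVec μ) ν : ℝ) : ℂ))
      (fourMom m p μ : ℂ) 0 := by
    have h2 : ∀ t : ℝ, ((∑ ν, fourMom m p ν * (x + t • basisVec μ) ν : ℝ) : ℂ)
        = ((∑ ν, fourMom m p ν * x ν : ℝ) : ℂ) + (fourMom m p μ : ℂ) * (t : ℂ) := by
      intro t
      rw [← Complex.ofReal_mul, ← Complex.ofReal_add]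
      congr 1
      simp [basisVec, mul_add, Finset.sum_add_distrib]
    simp_rw [h2]
    have h3 : HasDerivAt (fun t : ℝ => (t : ℂ)) 1 0 := Complex.ofRealCLM.hasDerivAt
    simpa using (h3.const_mul (fourMom m p μ : ℂ)).const_add ((∑ ν, fourMom m p ν * x ν : ℝ) : ℂ)
  have h4 := ((h1.const_mul (-Complex.I)).cexp).const_mul
    (∏ ν, (-Complex.I * (fourMom m p ν : ℂ)) ^ α ν)
  have h5 : ∏ ν, (-Complex.I * (fourMom m p ν : ℂ)) ^ (Pi.single μ 1 : Fin 4 → ℕ) ν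
      = -Complex.I * (fourMom m p μ : ℂ) := by
    rw [Finset.prod_eq_single μ] <;> simp +contextual
  have h6 : planeWave m (α + Pi.single μ 1) x p
      = (∏ ν, (-Complex.I * (fourMom m p ν : ℂ)) ^ α ν) *
      (Complex.exp (-Complex.I * ((∑ ν, fourMom m p ν * (x + (0 : ℝ) • basisVec μ) ν : ℝ) : ℂ)) *
        (-Complex.I * (fourMom m p μ : ℂ))) := by
    simp only [planeWave, Pi.add_apply, pow_add, Finset.prod_mul_distrib, h5, zero_smul, add_zero]
    ring
  rw [h6]
  exact h4

lemma amplitude_bound {a : Mom → ℂ} (ha : IsAmplitude a) (m : ℝ) (α : Fin 4 → ℕ) :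
    ∃ (C : ℝ) (l : ℕ), 0 ≤ C ∧ ∀ x q, ‖a q * planeWave m α x q‖ ≤ C * (1 + ‖q‖) ^ l := by
  obtain ⟨-, C, l, hC⟩ := ha.mul (isAmplitude_planeWave m α 0)
  refine ⟨C, l, ?_, fun x q => ?_⟩
  · have := (norm_nonneg _).trans (hC 0)
    simpa using this
  · rw [norm_mul, norm_planeWave, ← norm_mul]
    exact hC q

/-- The integrand of `annPW`. -/
def annFun (a : F.Species → Mom → ℂ) (α : Fin 4 → ℕ) (Ψ : Mink → Fock F) (n : ℕ)
    (s : Fin n → F.Species) (σ : F.Species) (x : Mink) (p : Fin n → Mom) (q : Mom) : ℂ :=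
  (a σ q * planeWave (F.mass σ) α x q) * (Ψ x).wave (n + 1) (Fin.cons σ s) (Fin.cons q p)

lemma annPW_wave (a : F.Species → Mom → ℂ) (ha : ∀ σ, IsAmplitude (a σ)) (α : Fin 4 → ℕ)
    (Ψ : Mink → Fock F) (x : Mink) (n : ℕ) (s : Fin n → F.Species) (p : Fin n → Mom) :
    (annPW a ha α x (Ψ x)).wave n s p = (Real.sqrt (n + 1) : ℂ) *
      ∑ σ, ∫ q, annFun a α Ψ n s σ x p q ∂(shellMeasure (F.mass σ)) := rfl

lemma annFun_continuous {a : F.Species → Mom → ℂ} (ha : ∀ σ, IsAmplitude (a σ)) (α : Fin 4 → ℕ)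
    {Ψ : Mink → Fock F} (hΨ : UniformFamily Ψ) (n : ℕ) (s : Fin n → F.Species) (σ : F.Species) :
    Continuous fun w : (Mink × (Fin n → Mom)) × Mom => annFun a α Ψ n s σ w.1.1 w.1.2 w.2 := by
  have h1 : Continuous fun w : (Mink × (Fin n → Mom)) × Mom => a σ w.2 :=
    (ha σ).1.comp continuous_snd
  have h2 : Continuous fun w : (Mink × (Fin n → Mom)) × Mom =>
      planeWave (F.mass σ) α w.1.1 w.2 :=
    Continuous.comp (g := fun v : Mink × Mom => planeWave (F.mass σ) α v.1 v.2)
      (f := fun w : (Mink × (Fin n → Mom)) × Mom => (w.1.1, w.2))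
      (continuous_planeWave (F.mass σ) α) (by fun_prop)
  have h3 : Continuous fun w : (Mink × (Fin n → Mom)) × Mom =>
      (Fin.cons w.2 w.1.2 : Fin (n + 1) → Mom) := by
    refine continuous_pi fun i => ?_
    refine Fin.cases ?_ (fun j => ?_) i
    · simpa using continuous_snd
    · simp only [Fin.cons_succ]; fun_prop
  have h4 : Continuous fun w : (Mink × (Fin n → Mom)) × Mom =>
      (Ψ w.1.1).wave (n + 1) (Fin.cons σ s) (Fin.cons w.2 w.1.2) :=
    Continuous.comp (g := fun v : Mink × (Fin (n + 1) → Mom) =>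
        (Ψ v.1).wave (n + 1) (Fin.cons σ s) v.2)
      (f := fun w : (Mink × (Fin n → Mom)) × Mom => (w.1.1, (Fin.cons w.2 w.1.2 : Fin (n+1) → Mom)))
      (hΨ.cont (n + 1) (Fin.cons σ s)) (by fun_prop)
  exact (h1.mul h2).mul h4

lemma annFun_bound {a : F.Species → Mom → ℂ} (ha : ∀ σ, IsAmplitude (a σ)) (α : Fin 4 → ℕ)
    {Ψ : Mink → Fock F} (hΨ : UniformFamily Ψ) (n : ℕ) (s : Fin n → F.Species) (σ : F.Species)
    (k : ℕ) : ∃ C : ℝ, 0 ≤ C ∧ ∀ x p q,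
      (1 + ‖p‖) ^ k * ‖annFun a α Ψ n s σ x p q‖ ≤ C * (1 + ‖q‖) ^ (-(5 : ℕ) : ℝ) := by
  obtain ⟨C, l, hC0, hC⟩ := amplitude_bound (ha σ) (F.mass σ) α
  -- Of the decay, k powers are kept for p, l compensate the growth of the amplitude, and 5 make the
  -- integral over q converge.
  obtain ⟨C', hC'⟩ := hΨ.bound (n + 1) (Fin.cons σ s) (k + (l + 5))
  have hC0' : 0 ≤ C' := le_trans (by positivity) (hC' 0 0)
  refine ⟨C * C', by positivity, fun x p q => ?_⟩
  set r : Fin (n + 1) → Mom := Fin.cons q p with hr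
  have hq : ‖q‖ ≤ ‖r‖ := by simpa [r] using norm_le_pi_norm r 0
  have hp : ‖p‖ ≤ ‖r‖ := by
    refine (pi_norm_le_iff_of_nonneg (norm_nonneg _)).2 fun i => ?_
    simpa [r] using norm_le_pi_norm r i.succ
  rw [Real.rpow_neg (by positivity), Real.rpow_natCast, ← div_eq_mul_inv,
    le_div_iff₀ (by positivity), annFun, norm_mul, ← hr]
  set w := ‖(Ψ x).wave (n + 1) (Fin.cons σ s) r‖
  calc (1 + ‖p‖) ^ k * (‖a σ q * planeWave (F.mass σ) α x q‖ * w) * (1 + ‖q‖) ^ 5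
      ≤ (1 + ‖r‖) ^ k * ((C * (1 + ‖r‖) ^ l) * w) * (1 + ‖r‖) ^ 5 := by
        gcongr
        exact (hC x q).trans (by gcongr)
    _ = C * ((1 + ‖r‖) ^ (k + (l + 5)) * w) := by ring
    _ ≤ C * C' := by gcongr; exact hC' x r

lemma annFun_bound_zero {a : F.Species → Mom → ℂ} (ha : ∀ σ, IsAmplitude (a σ))
    (α : Fin 4 → ℕ) {Ψ : Mink → Fock F} (hΨ : UniformFamily Ψ) (n : ℕ) (s : Fin n → F.Species)
    (σ : F.Species) : ∃ C : ℝ, 0 ≤ C ∧ ∀ x p q,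
      ‖annFun a α Ψ n s σ x p q‖ ≤ C * (1 + ‖q‖) ^ (-(5 : ℕ) : ℝ) := by
  obtain ⟨C, h0, h⟩ := annFun_bound ha α hΨ n s σ 0
  exact ⟨C, h0, fun x p q => by simpa using h x p q⟩

lemma annFun_measurable {a : F.Species → Mom → ℂ} (ha : ∀ σ, IsAmplitude (a σ))
    (α : Fin 4 → ℕ) {Ψ : Mink → Fock F} (hΨ : UniformFamily Ψ) (n : ℕ) (s : Fin n → F.Species)
    (σ : F.Species) (x : Mink) (p : Fin n → Mom) (m : Measure Mom) :
    AEStronglyMeasurable (annFun a α Ψ n s σ x p) m :=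
  ((annFun_continuous ha α hΨ n s σ).comp
    (Continuous.prodMk_right (x, p))).aestronglyMeasurable

lemma annFun_integrable {a : F.Species → Mom → ℂ} (ha : ∀ σ, IsAmplitude (a σ))
    (α : Fin 4 → ℕ) {Ψ : Mink → Fock F} (hΨ : UniformFamily Ψ) (n : ℕ) (s : Fin n → F.Species)
    (σ : F.Species) (x : Mink) (p : Fin n → Mom) (m : ℝ) :
    Integrable (annFun a α Ψ n s σ x p) (shellMeasure m) := by
  obtain ⟨C, -, hC⟩ := annFun_bound_zero ha α hΨ n s σ
  exact Integrable.mono' ((integrable_shell m).const_mul C) (annFun_measurable ha α hΨ n s σ x p _)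
    (Filter.Eventually.of_forall fun q => hC x p q)

lemma UniformFamily.annPW {a : F.Species → Mom → ℂ} (ha : ∀ σ, IsAmplitude (a σ))
    (α : Fin 4 → ℕ) {Ψ : Mink → Fock F} (hΨ : UniformFamily Ψ) :
    UniformFamily fun x => annPW a ha α x (Ψ x) where
  cont n s := by
    simp only [annPW_wave]
    refine continuous_const.mul (continuous_finsetSum _ fun σ _ => ?_)
    obtain ⟨C, -, hC⟩ := annFun_bound_zero ha α hΨ n s σ
    refine continuous_of_dominated (bound := fun q => C * (1 + ‖q‖) ^ (-(5 : ℕ) : ℝ))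
      (fun w => annFun_measurable ha α hΨ n s σ _ _ _)
      (fun w => Filter.Eventually.of_forall fun q => hC _ _ q)
      ((integrable_shell _).const_mul C) (Filter.Eventually.of_forall fun q => ?_)
    exact (annFun_continuous ha α hΨ n s σ).comp (Continuous.prodMk_left q)
  bound n s k := by
    choose C hC0 hC using fun σ => annFun_bound ha α hΨ n s σ k
    refine ⟨Real.sqrt (n + 1) * ∑ σ, C σ *
      ∫ q, (1 + ‖q‖) ^ (-(5 : ℕ) : ℝ) ∂(shellMeasure (F.mass σ)), fun x p => ?_⟩
    rw [annPW_wave, norm_mul, Complex.norm_real, Real.norm_of_nonneg (Real.sqrt_nonneg _),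
      mul_left_comm]
    gcongr
    refine (mul_le_mul_of_nonneg_left (norm_sum_le _ _) (by positivity)).trans ?_
    rw [Finset.mul_sum]
    refine Finset.sum_le_sum (fun σ _ => ?_)
    rw [← integral_const_mul]
    refine (mul_le_mul_of_nonneg_left (norm_integral_le_integral_norm _)
      (by positivity)).trans ?_
    rw [← integral_const_mul]
    exact integral_mono (((annFun_integrable ha α hΨ n s σ x p _).norm).const_mul _)
      ((integrable_shell _).const_mul _) fun q => hC σ x p q
  fin := by
    obtain ⟨N, hN⟩ := hΨ.fin
    refine ⟨N, fun n hn x s p => ?_⟩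
    rw [annPW_wave]
    simp [annFun, hN (n + 1) (by omega)]

/-- Product rule under the integral: the derivative hits the plane wave, raising its multi-index, or
the vector. The bounds of `annFun_bound_zero` are uniform in x and dominate both terms. -/
lemma FamilyDeriv.annPW {a : F.Species → Mom → ℂ} (ha : ∀ σ, IsAmplitude (a σ))
    (α : Fin 4 → ℕ) {μ : Fin 4} {Ψ Ψ' : Mink → Fock F} (hΨ : UniformFamily Ψ)
    (hΨ' : UniformFamily Ψ') (hd : FamilyDeriv (basisVec μ) Ψ Ψ') :
    FamilyDeriv (basisVec μ) (fun x => annPW a ha α x (Ψ x))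
      fun x => CausalGauge.annPW a ha (α + Pi.single μ 1) x (Ψ x)
        + CausalGauge.annPW a ha α x (Ψ' x) := by
  intro n s p x
  have h1 : ∀ x, (CausalGauge.annPW a ha (α + Pi.single μ 1) x (Ψ x)
      + CausalGauge.annPW a ha α x (Ψ' x)).wave n s p = (Real.sqrt (n + 1) : ℂ) *
      ∑ σ, ∫ q, (annFun a (α + Pi.single μ 1) Ψ n s σ x p q + annFun a α Ψ' n s σ x p q)
        ∂(shellMeasure (F.mass σ)) := by
    intro x
    rw [Fock.wave_add, Pi.add_apply, Pi.add_apply, Pi.add_apply, annPW_wave, annPW_wave,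
      ← mul_add, ← Finset.sum_add_distrib]
    congr 1
    refine Finset.sum_congr rfl fun σ _ => ?_
    rw [integral_add (annFun_integrable ha _ hΨ n s σ x p _)
      (annFun_integrable ha _ hΨ' n s σ x p _)]
  rw [h1]
  simp only [annPW_wave]
  have h2 : HasLineDerivAt ℝ (fun x => ∑ σ, ∫ q, annFun a α Ψ n s σ x p q
      ∂(shellMeasure (F.mass σ)))
      (∑ σ, ∫ q, (annFun a (α + Pi.single μ 1) Ψ n s σ x p q + annFun a α Ψ' n s σ x p q)
        ∂(shellMeasure (F.mass σ))) x (basisVec μ) := by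
    refine hasLineDerivAt_sum fun σ => ?_
    obtain ⟨C, -, hC⟩ := annFun_bound_zero ha (α + Pi.single μ 1) hΨ n s σ
    obtain ⟨C', -, hC'⟩ := annFun_bound_zero ha α hΨ' n s σ
    have hm : ∀ x, AEStronglyMeasurable (fun q => annFun a (α + Pi.single μ 1) Ψ n s σ x p q
        + annFun a α Ψ' n s σ x p q) (shellMeasure (F.mass σ)) := fun x =>
      (annFun_measurable ha _ hΨ n s σ x p _).add (annFun_measurable ha _ hΨ' n s σ x p _)
    have hb : ∀ x q, ‖annFun a (α + Pi.single μ 1) Ψ n s σ x p q + annFun a α Ψ' n s σ x p q‖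
        ≤ C * (1 + ‖q‖) ^ (-(5 : ℕ) : ℝ) + C' * (1 + ‖q‖) ^ (-(5 : ℕ) : ℝ) := fun x q =>
      (norm_add_le _ _).trans (add_le_add (hC x p q) (hC' x p q))
    have hbi : Integrable (fun q : Mom => C * (1 + ‖q‖) ^ (-(5 : ℕ) : ℝ)
        + C' * (1 + ‖q‖) ^ (-(5 : ℕ) : ℝ)) (shellMeasure (F.mass σ)) :=
      ((integrable_shell _).const_mul C).add ((integrable_shell _).const_mul C')
    refine hasLineDerivAt_integral (G := fun x q => annFun a α Ψ n s σ x p q)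
      (fun x => annFun_measurable ha α hΨ n s σ x p _) hm
      (fun x => annFun_integrable ha α hΨ n s σ x p _) hb hbi (fun x q => ?_) x
    have h3 : HasLineDerivAt ℝ (fun x => a σ q * planeWave (F.mass σ) α x q)
        (a σ q * planeWave (F.mass σ) (α + Pi.single μ 1) x q) x (basisVec μ) :=
      HasDerivAt.const_mul (a σ q) (hasLineDerivAt_planeWave (F.mass σ) α μ q x)
    exact hasLineDerivAt_mul h3 (hd (n + 1) (Fin.cons σ s) (Fin.cons q p) x)
  exact HasDerivAt.const_mul _ h2

/-! ### Scalar products of families -/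

lemma pairFun_continuous {X Ψ : Mink → Fock F} (hX : UniformFamily X) (hΨ : UniformFamily Ψ)
    {n : ℕ} (s : Fin n → F.Species) :
    Continuous fun w : Mink × (Fin n → Mom) => pairFun (X w.1) (Ψ w.1) s w.2 :=
  (Complex.continuous_conj.comp (hX.cont n s)).mul (hΨ.cont n s)

lemma pairFun_bound {X Ψ : Mink → Fock F} (hX : UniformFamily X) (hΨ : UniformFamily Ψ)
    {n : ℕ} (s : Fin n → F.Species) :
    ∃ C : ℝ, ∀ x p, ‖pairFun (X x) (Ψ x) s p‖ ≤ C * weight n p := by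
  obtain ⟨C, hC⟩ := hX.bound n s 0
  obtain ⟨D, hD⟩ := hΨ.bound n s (5 * n)
  have hC0 : 0 ≤ C := le_trans (by positivity) (hC 0 0)
  refine ⟨C * D, fun x p => ?_⟩
  rw [pairFun, norm_mul, RCLike.norm_conj, mul_assoc]
  have h1 := one_add_norm_pow_bound (norm_nonneg _) (hC x p)
  gcongr
  exact norm_le_weight (norm_nonneg _) (hD x p)

lemma pair_family_eq_sum {Ψ : Mink → Fock F} (hΨ : UniformFamily Ψ) :
    ∃ N, ∀ M, N ≤ M → ∀ (X : Mink → Fock F) x, pair (X x) (Ψ x)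
      = ∑ n ∈ Finset.range (M + 1), ∑ s : Fin n → F.Species,
        ∫ p, pairFun (X x) (Ψ x) s p ∂(shellPi F s) := by
  obtain ⟨N, hN⟩ := hΨ.fin
  exact ⟨N, fun M hM X x => pair_eq_sum fun n hn => hN n (by omega) x⟩

lemma pair_family_continuous {X Ψ : Mink → Fock F} (hX : UniformFamily X)
    (hΨ : UniformFamily Ψ) : Continuous fun x => pair (X x) (Ψ x) := by
  obtain ⟨N, hN⟩ := pair_family_eq_sum hΨ
  rw [funext (hN N le_rfl X)]
  refine continuous_finsetSum _ fun n _ => continuous_finsetSum _ fun s _ => ?_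
  obtain ⟨C, hC⟩ := pairFun_bound hX hΨ s
  refine continuous_of_dominated (bound := fun p => C * weight n p)
    (fun x => (pair_integrable _ _ s).aestronglyMeasurable)
    (fun x => Filter.Eventually.of_forall fun p => hC x p)
    ((weight_integrable s).const_mul C) (Filter.Eventually.of_forall fun p => ?_)
  exact (pairFun_continuous hX hΨ s).comp (Continuous.prodMk_left p)

lemma pair_family_bounded {X Ψ : Mink → Fock F} (hX : UniformFamily X)
    (hΨ : UniformFamily Ψ) : ∃ C : ℝ, ∀ x, ‖pair (X x) (Ψ x)‖ ≤ C := by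
  obtain ⟨N, hN⟩ := pair_family_eq_sum hΨ
  choose C hC using fun (n : ℕ) (s : Fin n → F.Species) => pairFun_bound hX hΨ s
  refine ⟨∑ n ∈ Finset.range (N + 1), ∑ s : Fin n → F.Species,
    ∫ p, C n s * weight n p ∂(shellPi F s), fun x => ?_⟩
  rw [hN N le_rfl X x]
  refine (norm_sum_le _ _).trans (Finset.sum_le_sum fun n _ => ?_)
  refine (norm_sum_le _ _).trans (Finset.sum_le_sum fun s _ => ?_)
  refine (norm_integral_le_integral_norm _).trans ?_
  exact integral_mono (pair_integrable _ _ s).norm ((weight_integrable s).const_mul _)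
    fun p => hC n s x p

lemma pair_family_deriv {e : Mink} {X X' Ψ Ψ' : Mink → Fock F} (hX : UniformFamily X)
    (hX' : UniformFamily X') (hΨ : UniformFamily Ψ) (hΨ' : UniformFamily Ψ')
    (hdX : FamilyDeriv e X X') (hdΨ : FamilyDeriv e Ψ Ψ') (x : Mink) :
    HasLineDerivAt ℝ (fun x => pair (X x) (Ψ x)) (pair (X' x) (Ψ x) + pair (X x) (Ψ' x)) x e := by
  obtain ⟨N, hN⟩ := pair_family_eq_sum hΨ
  obtain ⟨N', hN'⟩ := pair_family_eq_sum hΨ'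
  rw [funext (hN (max N N') (le_max_left _ _) X), hN (max N N') (le_max_left _ _) X' x,
    hN' (max N N') (le_max_right _ _) X x]
  simp only [← Finset.sum_add_distrib]
  refine hasLineDerivAt_sum fun n => hasLineDerivAt_sum fun s => ?_
  rw [← integral_add (pair_integrable _ _ s) (pair_integrable _ _ s)]
  obtain ⟨C, hC⟩ := pairFun_bound hX' hΨ s
  obtain ⟨C', hC'⟩ := pairFun_bound hX hΨ' s
  refine hasLineDerivAt_integral (G := fun x p => pairFun (X x) (Ψ x) s p)
    (G' := fun x p => pairFun (X' x) (Ψ x) s p + pairFun (X x) (Ψ' x) s p)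
    (b := fun p => C * weight n p + C' * weight n p)
    (fun x => (pair_integrable _ _ s).aestronglyMeasurable)
    (fun x => (pair_integrable _ _ s).aestronglyMeasurable.add
      (pair_integrable _ _ s).aestronglyMeasurable)
    (fun x => pair_integrable _ _ s)
    (fun x p => (norm_add_le _ _).trans (add_le_add (hC x p) (hC' x p)))
    (((weight_integrable s).const_mul C).add ((weight_integrable s).const_mul C'))
    (fun x p => ?_) x
  have h1 : HasLineDerivAt ℝ (fun x => (starRingEnd ℂ) ((X x).wave n s p))
      ((starRingEnd ℂ) ((X' x).wave n s p)) x e := by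
    have := (Complex.conjCLE.toContinuousLinearMap.hasFDerivAt).comp_hasDerivAt (0 : ℝ)
      (hdX n s p x)
    exact this
  exact hasLineDerivAt_mul h1 (hdΨ n s p x)

/-! ### Wick polynomials -/

lemma sgn_add (a b : ZMod 2) : sgn (a + b) = sgn a * sgn b := by
  have h : ∀ a b : ZMod 2, (a + b = 0 ↔ a = b) := by decide
  have h' : ∀ a b : ZMod 2, a ≠ 0 → b ≠ 0 → a = b := by decide
  unfold sgn
  by_cases ha : a = 0 <;> by_cases hb : b = 0
  · simp [ha, hb]
  · simp [ha, hb]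
  · simp [ha, hb]
  · simp [hb, h, h' a b ha hb]

lemma sgn_mul_self (a : ZMod 2) : sgn a * sgn a = 1 := by
  unfold sgn; split_ifs <;> norm_num

lemma sgn_natCast (k : ℕ) : sgn (k : ZMod 2) = (-1) ^ k := by
  induction k with
  | zero => simp [sgn]
  | succ k ih => rw [Nat.cast_succ, sgn_add, ih, pow_succ]; simp [sgn]

/-- Canonical dimension of the symbol `∂^α φ_a`. -/
def jetDim (j : Jet F) : ℚ := F.dim j.1 + ((∑ μ, j.2 μ : ℕ) : ℚ)

lemma monoStat_cons (j : Jet F) (L : List (Jet F)) :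
    monoStat (j :: L) = F.fieldStat j.1 + monoStat L := by simp [monoStat]

lemma monoGhost_cons (j : Jet F) (L : List (Jet F)) :
    monoGhost (j :: L) = F.ghost j.1 + monoGhost L := by simp [monoGhost]

lemma monoDim_cons (j : Jet F) (L : List (Jet F)) :
    monoDim (j :: L) = jetDim j + monoDim L := by simp [monoDim, jetDim]

/-- Each factor has ghost number at most 1 and dimension at least 1. All power counting rests on
this inequality. -/
lemma monoGhost_le_monoDim (L : List (Jet F)) : (monoGhost L : ℚ) ≤ monoDim L := by
  induction L with
  | nil => simp [monoGhost, monoDim]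
  | cons j L ih =>
    rw [monoGhost_cons, monoDim_cons, Int.cast_add]
    refine add_le_add ?_ ih
    have h1 : (F.ghost j.1 : ℚ) ≤ 1 := by exact_mod_cast F.ghost_le_one j.1
    have h2 := F.one_le_dim j.1
    have h3 : (0 : ℚ) ≤ ((∑ μ, j.2 μ : ℕ) : ℚ) := Nat.cast_nonneg _
    unfold jetDim
    linarith

variable (F) in
/-- Sesquilinear forms on `D` that depend on a point. -/
abbrev FormField : Type := Mink → Fock F → Fock F → ℂ

variable (F) in
/-- The Wick monomials of ghost number `g`, statistics `st` and dimension at most `d`. -/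
def wickGen (g : ℤ) (st : ZMod 2) (d : ℚ) : Set (List (Jet F)) :=
  {L | monoGhost L = g ∧ monoStat L = st ∧ monoDim L ≤ d}

variable (F) in
/-- Forms of the Wick polynomials of ghost number `g`, statistics `st` and dimension at most
`d`. -/
def wickSpan (g : ℤ) (st : ZMod 2) (d : ℚ) : Submodule ℂ (FormField F) :=
  Submodule.span ℂ (wickForm '' wickGen F g st d)

lemma wickForm_mem {g : ℤ} {st : ZMod 2} {d : ℚ} {L : List (Jet F)} (h1 : monoGhost L = g)
    (h2 : monoStat L = st) (h3 : monoDim L ≤ d) : wickForm L ∈ wickSpan F g st d :=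
  Submodule.subset_span ⟨L, ⟨h1, h2, h3⟩, rfl⟩

lemma wickSpan_mono {g : ℤ} {st : ZMod 2} {d d' : ℚ} (h : d ≤ d') :
    wickSpan F g st d ≤ wickSpan F g st d' :=
  Submodule.span_mono (Set.image_mono fun _ hL => ⟨hL.1, hL.2.1, hL.2.2.trans h⟩)

/-- The vectors must be allowed to vary with x: peeling off the first factor of the monomial makes
them x-dependent, and the induction closes only in this generality. -/
lemma wickForm_family {X Ψ : Mink → Fock F} (hX : UniformFamily X) (hΨ : UniformFamily Ψ)
    (L : List (Jet F)) : Continuous (fun x => wickForm L x (X x) (Ψ x)) ∧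
      ∃ C : ℝ, ∀ x, ‖wickForm L x (X x) (Ψ x)‖ ≤ C := by
  induction L generalizing X Ψ with
  | nil => exact ⟨pair_family_continuous hX hΨ, pair_family_bounded hX hΨ⟩
  | cons j L ih =>
    obtain ⟨h1, C, hC⟩ := ih (hX.annPW (fun σ => (F.v_amp j.1 σ).conj) j.2) hΨ
    obtain ⟨h2, C', hC'⟩ := ih hX (hΨ.annPW (F.u_amp j.1) j.2)
    refine ⟨h1.add (continuous_const.mul h2),
      C + ‖sgn (F.fieldStat j.1 * monoStat L)‖ * C', fun x => ?_⟩
    refine (norm_add_le _ _).trans (add_le_add (hC x) ?_)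
    rw [norm_mul]
    exact mul_le_mul_of_nonneg_left (hC' x) (norm_nonneg _)

lemma wickForm_linear (L : List (Jet F)) (x : Mink) :
    (∀ χ ψ ψ', wickForm L x χ (ψ + ψ') = wickForm L x χ ψ + wickForm L x χ ψ') ∧
    (∀ (c : ℂ) χ ψ, wickForm L x χ (c • ψ) = c * wickForm L x χ ψ) ∧
    (∀ χ χ' ψ, wickForm L x (χ + χ') ψ = wickForm L x χ ψ + wickForm L x χ' ψ) ∧
    (∀ (c : ℂ) χ ψ, wickForm L x (c • χ) ψ = (starRingEnd ℂ) c * wickForm L x χ ψ) := by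
  induction L with
  | nil =>
    exact ⟨pair_add_right, fun c χ ψ => pair_smul_right χ ψ c, pair_add_left,
      fun c χ ψ => pair_smul_left χ ψ c⟩
  | cons j L ih =>
    obtain ⟨h1, h2, h3, h4⟩ := ih
    refine ⟨fun χ ψ ψ' => ?_, fun c χ ψ => ?_, fun χ χ' ψ => ?_, fun c χ ψ => ?_⟩ <;>
    simp only [wickForm, map_add, map_smul, h1, h2, h3, h4] <;> ring

/-- Regularity and sesquilinearity of the forms of Wick polynomials. -/
structure GoodForm (Φ : FormField F) : Prop where
  cont : ∀ χ ψ, Continuous fun x => Φ x χ ψ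
  bound : ∀ χ ψ, ∃ C : ℝ, ∀ x, ‖Φ x χ ψ‖ ≤ C
  add_right : ∀ x χ ψ ψ', Φ x χ (ψ + ψ') = Φ x χ ψ + Φ x χ ψ'
  smul_right : ∀ x (c : ℂ) χ ψ, Φ x χ (c • ψ) = c * Φ x χ ψ
  add_left : ∀ x χ χ' ψ, Φ x (χ + χ') ψ = Φ x χ ψ + Φ x χ' ψ
  smul_left : ∀ x (c : ℂ) χ ψ, Φ x (c • χ) ψ = (starRingEnd ℂ) c * Φ x χ ψ

lemma goodForm_of_mem {g : ℤ} {st : ZMod 2} {d : ℚ} {Φ : FormField F}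
    (h : Φ ∈ wickSpan F g st d) : GoodForm Φ := by
  induction h using Submodule.span_induction with
  | mem Φ h =>
    obtain ⟨L, -, rfl⟩ := h
    have h1 χ ψ := wickForm_family (UniformFamily.const χ) (UniformFamily.const ψ) L
    have h2 x := wickForm_linear L x
    exact ⟨fun χ ψ => (h1 χ ψ).1, fun χ ψ => (h1 χ ψ).2, fun x => (h2 x).1,
      fun x => (h2 x).2.1, fun x => (h2 x).2.2.1, fun x => (h2 x).2.2.2⟩
  | zero =>
    exact ⟨fun _ _ => continuous_const, fun _ _ => ⟨0, fun _ => by simp⟩, by simp, by simp,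
      by simp, by simp⟩
  | add Φ Φ' _ _ h h' =>
    refine ⟨fun χ ψ => (h.cont χ ψ).add (h'.cont χ ψ), fun χ ψ => ?_, fun x χ ψ ψ' => ?_,
      fun x c χ ψ => ?_, fun x χ χ' ψ => ?_, fun x c χ ψ => ?_⟩
    · obtain ⟨C, hC⟩ := h.bound χ ψ
      obtain ⟨C', hC'⟩ := h'.bound χ ψ
      exact ⟨C + C', fun x => (norm_add_le _ _).trans (add_le_add (hC x) (hC' x))⟩
    · simp only [Pi.add_apply, h.add_right, h'.add_right]; ring
    · simp only [Pi.add_apply, h.smul_right, h'.smul_right]; ring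
    · simp only [Pi.add_apply, h.add_left, h'.add_left]; ring
    · simp only [Pi.add_apply, h.smul_left, h'.smul_left]; ring
  | smul a Φ _ h =>
    refine ⟨fun χ ψ => (h.cont χ ψ).const_smul a, fun χ ψ => ?_, fun x χ ψ ψ' => ?_,
      fun x c χ ψ => ?_, fun x χ χ' ψ => ?_, fun x c χ ψ => ?_⟩
    · obtain ⟨C, hC⟩ := h.bound χ ψ
      refine ⟨‖a‖ * C, fun x => ?_⟩
      simp only [Pi.smul_apply, norm_smul]
      exact mul_le_mul_of_nonneg_left (hC x) (norm_nonneg _)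
    · simp only [Pi.smul_apply, smul_eq_mul, h.add_right]; ring
    · simp only [Pi.smul_apply, smul_eq_mul, h.smul_right]; ring
    · simp only [Pi.smul_apply, smul_eq_mul, h.add_left]; ring
    · simp only [Pi.smul_apply, smul_eq_mul, h.smul_left]; ring

lemma GoodForm.integrable {Φ : FormField F} (h : GoodForm Φ) (f : 𝓢(Mink, ℂ)) (χ ψ : Fock F) :
    Integrable fun x => f x * Φ x χ ψ := by
  obtain ⟨C, hC⟩ := h.bound χ ψ
  exact f.integrable.mul_bdd (h.cont χ ψ).aestronglyMeasurable (Filter.Eventually.of_forall hC)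

/-- The operator-valued distribution `W` is given by the form `Φ`. -/
def HasForm (W : OpMap F Mink) (Φ : FormField F) : Prop :=
  ∀ f χ ψ, pair χ (W f ψ) = ∫ x, f x * Φ x χ ψ

lemma linearCombination_apply (P : List (Jet F) →₀ ℂ) (x : Mink) (χ ψ : Fock F) :
    Finsupp.linearCombination ℂ (wickForm (F := F)) P x χ ψ
      = P.sum fun L c => c * wickForm L x χ ψ := by
  rw [Finsupp.linearCombination_apply, Finsupp.sum, Finsupp.sum, Finset.sum_apply,
    Finset.sum_apply, Finset.sum_apply]
  rfl

lemma linearCombination_form (P : List (Jet F) →₀ ℂ) (f : 𝓢(Mink, ℂ)) (χ ψ : Fock F) :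
    (P.sum fun L c => c * ∫ x, f x * wickForm L x χ ψ)
      = ∫ x, f x * Finsupp.linearCombination ℂ (wickForm (F := F)) P x χ ψ := by
  simp only [linearCombination_apply, Finsupp.sum, Finset.mul_sum]
  rw [integral_finsetSum]
  · refine Finset.sum_congr rfl fun L _ => ?_
    rw [← integral_const_mul]
    congr 1
    funext x
    ring
  · intro L _
    have h1 : wickForm L ∈ wickSpan F _ _ _ := wickForm_mem rfl rfl le_rfl
    have h2 := ((goodForm_of_mem h1).integrable f χ ψ).const_mul (P L)
    refine h2.congr (Filter.Eventually.of_forall fun x => ?_)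
    simp only
    ring

/-- Replaces the formal polynomial by the form it defines, so that linearity and span induction
become available. -/
lemma isWick_iff {g : ℤ} {d : ℚ} {W : OpMap F Mink} :
    IsWick g d W ↔ ∃ Φ ∈ wickSpan F g (g : ZMod 2) d, HasForm W Φ := by
  unfold IsWick wickSpan HasForm
  constructor
  · rintro ⟨P, hP, h⟩
    refine ⟨Finsupp.linearCombination ℂ wickForm P, ?_, fun f χ ψ => ?_⟩
    · rw [Finsupp.mem_span_image_iff_linearCombination]
      exact ⟨P, (Finsupp.mem_supported _ _).2 hP, rfl⟩
    · rw [h, linearCombination_form]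
  · rintro ⟨Φ, hΦ, h⟩
    rw [Finsupp.mem_span_image_iff_linearCombination] at hΦ
    obtain ⟨P, hP, rfl⟩ := hΦ
    exact ⟨P, fun L hL => (Finsupp.mem_supported _ _).1 hP hL, fun f χ ψ => by
      rw [h, linearCombination_form]⟩

lemma HasForm.add {W W' : OpMap F Mink} {Φ Φ' : FormField F} (hΦ : GoodForm Φ)
    (hΦ' : GoodForm Φ') (h : HasForm W Φ) (h' : HasForm W' Φ') : HasForm (W + W') (Φ + Φ') := by
  intro f χ ψ
  rw [LinearMap.add_apply, LinearMap.add_apply, pair_add_right, h, h',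
    ← integral_add (hΦ.integrable f χ ψ) (hΦ'.integrable f χ ψ)]
  congr 1
  funext x
  simp only [Pi.add_apply]
  ring

lemma HasForm.smul {W : OpMap F Mink} {Φ : FormField F} (c : ℂ) (h : HasForm W Φ) :
    HasForm (c • W) (c • Φ) := by
  intro f χ ψ
  rw [LinearMap.smul_apply, LinearMap.smul_apply, pair_smul_right, h, ← integral_const_mul]
  congr 1
  funext x
  simp only [Pi.smul_apply, smul_eq_mul]
  ring

lemma isWick_zero (g : ℤ) (d : ℚ) : IsWick g d (0 : OpMap F Mink) :=
  isWick_iff.2 ⟨0, zero_mem _, fun f χ ψ => by simp [pair_zero_right]⟩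

lemma IsWick.add {g : ℤ} {d : ℚ} {W W' : OpMap F Mink} (h : IsWick g d W) (h' : IsWick g d W') :
    IsWick g d (W + W') := by
  obtain ⟨Φ, hΦ, h⟩ := isWick_iff.1 h
  obtain ⟨Φ', hΦ', h'⟩ := isWick_iff.1 h'
  exact isWick_iff.2 ⟨Φ + Φ', add_mem hΦ hΦ',
    h.add (goodForm_of_mem hΦ) (goodForm_of_mem hΦ') h'⟩

lemma IsWick.smul {g : ℤ} {d : ℚ} {W : OpMap F Mink} (c : ℂ) (h : IsWick g d W) :
    IsWick g d (c • W) := by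
  obtain ⟨Φ, hΦ, h⟩ := isWick_iff.1 h
  exact isWick_iff.2 ⟨c • Φ, Submodule.smul_mem _ c hΦ, h.smul c⟩

variable (F) in
/-- The Wick polynomials of ghost number `g` and dimension at most `d`. -/
def wickSub (g : ℤ) (d : ℚ) : Submodule ℂ (OpMap F Mink) where
  carrier := {W | IsWick g d W}
  zero_mem' := isWick_zero g d
  add_mem' := IsWick.add
  smul_mem' := fun c _ => IsWick.smul c

lemma IsWick.mono {g : ℤ} {d d' : ℚ} {W : OpMap F Mink} (h : IsWick g d W) (hd : d ≤ d') :
    IsWick g d' W := by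
  obtain ⟨P, hP, h⟩ := h
  exact ⟨P, fun L hL => ⟨(hP L hL).1, (hP L hL).2.1, (hP L hL).2.2.trans hd⟩, h⟩

/-- A Wick polynomial whose ghost number exceeds its dimension vanishes. -/
lemma IsWick.eq_zero {g : ℤ} {d : ℚ} {W : OpMap F Mink} (h : IsWick g d W) (hgd : d < g) :
    W = 0 := by
  obtain ⟨P, hP, h⟩ := h
  have hP0 : P = 0 := by
    rw [← Finsupp.support_eq_empty, Finset.eq_empty_iff_forall_notMem]
    intro L hL
    obtain ⟨h1, -, h3⟩ := hP L hL
    have := monoGhost_le_monoDim L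
    rw [h1] at this
    linarith
  exact eq_zero_of_pair fun f χ ψ => by rw [h, hP0, Finsupp.sum_zero_index]

/-- A Wick polynomial is a distribution-valued operator. -/
lemma IsWick.isOpDistribution {g : ℤ} {d : ℚ} {W : OpMap F Mink} (h : IsWick g d W) :
    IsOpDistribution W := by
  obtain ⟨Φ, hΦ, h⟩ := isWick_iff.1 h
  intro χ ψ
  have hg := goodForm_of_mem hΦ
  obtain ⟨C, hC⟩ := hg.bound χ ψ
  -- The form is bounded in x, so the matrix element factors through the continuous map of Schwartz
  -- functions into L¹ and a bounded functional there.
  have hbc : ∀ f : 𝓢(Mink, ℂ), pair χ (W f ψ)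
      = ∫ x, (SchwartzMap.toLpCLM ℂ ℂ 1 volume f : Mink → ℂ) x * Φ x χ ψ := by
    intro f
    rw [h]
    refine integral_congr_ae ?_
    filter_upwards [f.coeFn_toLp 1 volume] with x hx
    rw [SchwartzMap.toLpCLM_apply, hx]
  have hcont : Continuous fun u : Lp ℂ 1 (volume : Measure Mink) => ∫ x, u x * Φ x χ ψ := by
    have hm := (hg.cont χ ψ).aestronglyMeasurable (μ := (volume : Measure Mink))
    have hint : ∀ u : Lp ℂ 1 (volume : Measure Mink), Integrable fun x => u x * Φ x χ ψ :=
      fun u => (L1.integrable_coeFn u).mul_bdd hm (Filter.Eventually.of_forall hC)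
    refine (LinearMap.mkContinuous
      { toFun := fun u : Lp ℂ 1 (volume : Measure Mink) => ∫ x, u x * Φ x χ ψ
        map_add' := fun u v => ?_
        map_smul' := fun c u => ?_ : Lp ℂ 1 (volume : Measure Mink) →ₗ[ℂ] ℂ } C
      fun u => ?_).continuous
    · rw [← integral_add (hint u) (hint v)]
      refine integral_congr_ae ?_
      filter_upwards [Lp.coeFn_add u v] with x hx
      rw [hx, Pi.add_apply, add_mul]
    · rw [RingHom.id_apply, smul_eq_mul, ← integral_const_mul]
      refine integral_congr_ae ?_
      filter_upwards [Lp.coeFn_smul c u] with x hx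
      rw [hx, Pi.smul_apply, smul_eq_mul, mul_assoc]
    · rw [L1.norm_eq_integral_norm, ← integral_const_mul]
      refine (norm_integral_le_integral_norm _).trans ?_
      refine integral_mono (hint u).norm ((L1.integrable_coeFn u).norm.const_mul C) fun x => ?_
      simp only [norm_mul]
      rw [mul_comm]
      exact mul_le_mul_of_nonneg_right (hC x) (norm_nonneg _)
  simp only [hbc]
  exact hcont.comp (SchwartzMap.toLpCLM ℂ ℂ 1 volume).continuous

/-! ### Derivatives of Wick polynomials -/

/-- Normal ordered multiplication of a form of statistics `st` by `∂^α φ_a`. -/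
def consForm (j : Jet F) (st : ZMod 2) : FormField F →ₗ[ℂ] FormField F where
  toFun Φ x χ ψ := Φ x (negPartAdj j x χ) ψ
    + sgn (F.fieldStat j.1 * st) * Φ x χ (posPart j x ψ)
  map_add' Φ Φ' := by funext x χ ψ; simp only [Pi.add_apply]; ring
  map_smul' c Φ := by
    funext x χ ψ; simp only [Pi.smul_apply, smul_eq_mul, RingHom.id_apply]; ring

lemma consForm_wickForm (j : Jet F) (L : List (Jet F)) :
    consForm j (monoStat L) (wickForm L) = wickForm (j :: L) := rfl

lemma consForm_mem (j : Jet F) {g g' : ℤ} {st st' : ZMod 2} {d d' : ℚ} {Φ : FormField F}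
    (h : Φ ∈ wickSpan F g st d) (hg : F.ghost j.1 + g = g') (hst : F.fieldStat j.1 + st = st')
    (hd : jetDim j + d ≤ d') :
    consForm j st Φ ∈ wickSpan F g' st' d' := by
  induction h using Submodule.span_induction with
  | mem Φ h =>
    obtain ⟨L, ⟨h1, h2, h3⟩, rfl⟩ := h
    rw [← h2, consForm_wickForm]
    refine wickForm_mem (by rw [monoGhost_cons, h1, hg]) (by rw [monoStat_cons, h2, hst]) ?_
    rw [monoDim_cons]
    linarith
  | zero => rw [map_zero]; exact zero_mem _
  | add _ _ _ _ h h' => rw [map_add]; exact add_mem h h'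
  | smul a _ _ h => rw [map_smul]; exact Submodule.smul_mem _ _ h

/-- The symbol `∂_μ ∂^α φ_a`. -/
def bump (μ : Fin 4) (j : Jet F) : Jet F := (j.1, j.2 + Pi.single μ 1)

lemma jetDim_bump (μ : Fin 4) (j : Jet F) : jetDim (bump μ j) = jetDim j + 1 := by
  have h : ∑ ν, (j.2 + (Pi.single μ 1 : Fin 4 → ℕ)) ν = ∑ ν, j.2 ν + 1 := by
    simp [Finset.sum_add_distrib]
  unfold jetDim bump
  rw [h]
  push_cast
  ring

/-- The product rule for Wick monomials. -/
lemma exists_wickForm_deriv (μ : Fin 4) (L : List (Jet F)) :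
    ∃ D ∈ wickSpan F (monoGhost L) (monoStat L) (monoDim L + 1),
      ∀ X X' Ψ Ψ' : Mink → Fock F, UniformFamily X → UniformFamily X' → UniformFamily Ψ →
        UniformFamily Ψ' → FamilyDeriv (basisVec μ) X X' → FamilyDeriv (basisVec μ) Ψ Ψ' →
        ∀ x, HasLineDerivAt ℝ (fun x => wickForm L x (X x) (Ψ x))
          (D x (X x) (Ψ x) + (wickForm L x (X' x) (Ψ x) + wickForm L x (X x) (Ψ' x))) x
          (basisVec μ) := by
  induction L with
  | nil =>
    refine ⟨0, zero_mem _, fun X X' Ψ Ψ' hX hX' hΨ hΨ' hdX hdΨ x => ?_⟩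
    simpa [wickForm] using pair_family_deriv hX hX' hΨ hΨ' hdX hdΨ x
  | cons j L ih =>
    obtain ⟨D, hD, h⟩ := ih
    -- The derivative falls either on the first symbol or on one of the remaining ones.
    refine ⟨wickForm (bump μ j :: L) + consForm j (monoStat L) D, add_mem ?_ ?_, ?_⟩
    · refine wickForm_mem ?_ ?_ ?_
      · rw [monoGhost_cons, monoGhost_cons]; rfl
      · rw [monoStat_cons, monoStat_cons]; rfl
      · rw [monoDim_cons, monoDim_cons, jetDim_bump]; linarith
    · refine consForm_mem j hD ?_ ?_ ?_
      · rw [monoGhost_cons]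
      · rw [monoStat_cons]
      · rw [monoDim_cons]; linarith
    · intro X X' Ψ Ψ' hX hX' hΨ hΨ' hdX hdΨ x
      have hva := fun σ => (F.v_amp j.1 σ).conj
      have hua := F.u_amp j.1
      -- The first factor is absorbed into the left or the right vector. The derivative of that
      -- family then supplies the term with the differentiated symbol.
      have e1 := h _ _ _ _ (hX.annPW hva j.2)
        ((hX.annPW hva (j.2 + Pi.single μ 1)).add (hX'.annPW hva j.2)) hΨ hΨ'
        (FamilyDeriv.annPW hva j.2 hX hX' hdX) hdΨ x
      have e2 := h _ _ _ _ hX hX' (hΨ.annPW hua j.2)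
        ((hΨ.annPW hua (j.2 + Pi.single μ 1)).add (hΨ'.annPW hua j.2)) hdX
        (FamilyDeriv.annPW hua j.2 hΨ hΨ' hdΨ) x
      have e3 := HasDerivAt.add e1 (HasDerivAt.const_mul (sgn (F.fieldStat j.1 * monoStat L)) e2)
      have hl := wickForm_linear L x
      unfold HasLineDerivAt
      convert! e3 using 1
      simp only [hl.1, hl.2.2.1, Pi.add_apply, wickForm, consForm, LinearMap.coe_mk,
        AddHom.coe_mk, posPart_eq, negPartAdj_eq, bump]
      ring

lemma exists_deriv_of_mem (μ : Fin 4) {g : ℤ} {st : ZMod 2} {d : ℚ} {Φ : FormField F}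
    (h : Φ ∈ wickSpan F g st d) : ∃ D ∈ wickSpan F g st (d + 1), ∀ χ ψ x,
      HasLineDerivAt ℝ (fun x => Φ x χ ψ) (D x χ ψ) x (basisVec μ) := by
  induction h using Submodule.span_induction with
  | mem Φ h =>
    obtain ⟨L, ⟨h1, h2, h3⟩, rfl⟩ := h
    obtain ⟨D, hD, h⟩ := exists_wickForm_deriv μ L
    refine ⟨D, ?_, fun χ ψ x => ?_⟩
    · rw [h1, h2] at hD
      exact wickSpan_mono (by linarith) hD
    · have := h _ _ _ _ (UniformFamily.const χ) (UniformFamily.const 0) (UniformFamily.const ψ)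
        (UniformFamily.const 0) (FamilyDeriv.const _ χ) (FamilyDeriv.const _ ψ) x
      have hl := wickForm_linear L x
      have z1 : wickForm L x 0 ψ = 0 := by simpa using hl.2.2.2 0 0 ψ
      have z2 : wickForm L x χ 0 = 0 := by simpa using hl.2.1 0 χ 0
      simpa [z1, z2] using this
  | zero => exact ⟨0, zero_mem _, fun χ ψ x => hasDerivAt_const _ _⟩
  | add Φ Φ' _ _ h h' =>
    obtain ⟨D, hD, h⟩ := h
    obtain ⟨D', hD', h'⟩ := h'
    exact ⟨D + D', add_mem hD hD', fun χ ψ x => HasDerivAt.add (h χ ψ x) (h' χ ψ x)⟩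
  | smul a Φ _ h =>
    obtain ⟨D, hD, h⟩ := h
    exact ⟨a • D, Submodule.smul_mem _ _ hD, fun χ ψ x => HasDerivAt.const_mul a (h χ ψ x)⟩

/-- Integration by parts moves the derivative from the test function to the form, where the product
rule applies. -/
lemma IsWick.pdL {g : ℤ} {d : ℚ} {W : OpMap F Mink} (h : IsWick g d W) (μ : Fin 4) :
    IsWick g (d + 1) (pdL μ W) := by
  obtain ⟨Φ, hΦ, h⟩ := isWick_iff.1 h
  obtain ⟨D, hD, hd⟩ := exists_deriv_of_mem μ hΦ
  refine isWick_iff.2 ⟨D, hD, fun f χ ψ => ?_⟩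
  have hgΦ := goodForm_of_mem hΦ
  have hgD := goodForm_of_mem hD
  change pair χ ((-W (∂_{basisVec μ} f)) ψ) = _
  rw [LinearMap.neg_apply, pair_neg_right, h]
  have h1 : ∀ x, HasLineDerivAt ℝ f ((∂_{basisVec μ} f : 𝓢(Mink, ℂ)) x) x (basisVec μ) := by
    intro x
    rw [SchwartzMap.lineDerivOp_apply_eq_fderiv]
    exact (f.hasFDerivAt x).hasLineDerivAt _
  have h2 := integral_bilinear_hasLineDerivAt_right_eq_neg_left_of_integrable
    (μ := (volume : Measure Mink)) (B := ContinuousLinearMap.mul ℝ ℂ) (f := f)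
    (f' := (∂_{basisVec μ} f : 𝓢(Mink, ℂ))) (g := fun x => Φ x χ ψ) (g' := fun x => D x χ ψ)
    (hgΦ.integrable (∂_{basisVec μ} f) χ ψ) (hgD.integrable f χ ψ) (hgΦ.integrable f χ ψ)
    (fun x _ => h1 x) (fun x _ => hd χ ψ x)
  simp only [ContinuousLinearMap.mul_apply'] at h2
  exact h2.symm

/-! ### The gauge variation of Wick polynomials -/

/-- Graded Leibniz rule: the commutator with the first factor replaces its symbol according to
`coeff`, the other factors follow by induction. On the left vector Q acts through its adjoint, so
that only commutators with annihilation operators occur. -/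
lemma exists_wickForm_gauge (G : GaugeCharge F) (L : List (Jet F)) :
    ∃ D ∈ wickSpan F (monoGhost L + 1) (monoStat L + 1) (monoDim L + 1), ∀ x χ ψ,
      wickForm L x (G.Qadj χ) ψ - sgn (monoStat L) * wickForm L x χ (G.Q ψ) = D x χ ψ := by
  induction L with
  | nil =>
    refine ⟨0, zero_mem _, fun x χ ψ => ?_⟩
    simp [wickForm, monoStat, sgn, G.adjoint]
  | cons j L ih =>
    obtain ⟨D, hD, h⟩ := ih
    set s := F.fieldStat j.1 with hs
    set N : FormField F := (G.coeff j.1).sum fun i c => c • wickForm ((i.1, j.2 + i.2) :: L)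
      with hN
    refine ⟨N + sgn s • consForm j (monoStat L + 1) D, add_mem ?_ (Submodule.smul_mem _ _ ?_), ?_⟩
    · refine Submodule.sum_mem _ fun i hi => Submodule.smul_mem _ _ ?_
      obtain ⟨h1, h2, h3⟩ := G.coeff_spec j.1 i hi
      refine wickForm_mem ?_ ?_ ?_
      · rw [monoGhost_cons, monoGhost_cons, h1]; ring
      · rw [monoStat_cons, monoStat_cons, h2]; ring
      · rw [monoDim_cons, monoDim_cons]
        have : ∑ ν, (j.2 + i.2) ν = ∑ ν, j.2 ν + ∑ ν, i.2 ν := by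
          simp [Finset.sum_add_distrib]
        simp only [jetDim, this, Nat.cast_add]
        linarith
    · refine consForm_mem j hD ?_ ?_ ?_
      · rw [monoGhost_cons]; ring
      · rw [monoStat_cons]; ring
      · rw [monoDim_cons]; linarith
    · intro x χ ψ
      have hl := wickForm_linear L x
      have hneg : negPartAdj j x (G.Qadj χ) = sgn s • G.Qadj (negPartAdj j x χ)
          + (G.coeff j.1).sum fun i c => (starRingEnd ℂ) c • negPartAdj (i.1, j.2 + i.2) x χ := by
        have := LinearMap.congr_fun (G.comm_neg j.1 j.2 x) χ
        rw [LinearMap.sub_apply, sub_eq_iff_eq_add'] at this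
        simpa [Finsupp.sum] using this
      have hpos : posPart j x (G.Q ψ) = sgn s • (G.Q (posPart j x ψ)
          - (G.coeff j.1).sum fun i c => c • posPart (i.1, j.2 + i.2) x ψ) := by
        have := LinearMap.congr_fun (G.comm_pos j.1 j.2 x) ψ
        simp only [LinearMap.sub_apply, Finsupp.sum, LinearMap.sum_apply, LinearMap.smul_apply,
          LinearMap.comp_apply] at this
        rw [Finsupp.sum, ← this, sub_sub_cancel, smul_smul, sgn_mul_self, one_smul]
      have hsumL : ∀ (S : Finset (Jet F)) (c : Jet F → ℂ) (v : Jet F → Fock F) (ψ : Fock F),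
          wickForm L x (∑ i ∈ S, (starRingEnd ℂ) (c i) • v i) ψ
            = ∑ i ∈ S, c i * wickForm L x (v i) ψ := by
        intro S c v ψ
        classical
        induction S using Finset.induction_on with
        | empty => simpa using hl.2.2.2 0 0 ψ
        | insert a S ha ih =>
          rw [Finset.sum_insert ha, Finset.sum_insert ha, hl.2.2.1, hl.2.2.2, ih,
            Complex.conj_conj]
      have hsumR : ∀ (S : Finset (Jet F)) (c : Jet F → ℂ) (v : Jet F → Fock F) (χ : Fock F),
          wickForm L x χ (∑ i ∈ S, c i • v i) = ∑ i ∈ S, c i * wickForm L x χ (v i) := by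
        intro S c v χ
        classical
        induction S using Finset.induction_on with
        | empty => simpa using hl.2.1 0 χ 0
        | insert a S ha ih =>
          rw [Finset.sum_insert ha, Finset.sum_insert ha, hl.1, hl.2.1, ih]
      have hsub : ∀ χ ψ ψ', wickForm L x χ (ψ - ψ')
          = wickForm L x χ ψ - wickForm L x χ ψ' := by
        intro χ ψ ψ'
        rw [sub_eq_add_neg, hl.1, ← neg_one_smul ℂ ψ', hl.2.1]
        ring
      have hNx : N x χ ψ = (∑ i ∈ (G.coeff j.1).support,
            G.coeff j.1 i * wickForm L x (negPartAdj (i.1, j.2 + i.2) x χ) ψ)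
          + sgn s * sgn (s * monoStat L) * sgn s * sgn (monoStat L) *
            ∑ i ∈ (G.coeff j.1).support,
              G.coeff j.1 i * wickForm L x χ (posPart (i.1, j.2 + i.2) x ψ) := by
        rw [hN, Finsupp.sum, Finset.sum_apply, Finset.sum_apply, Finset.sum_apply,
          Finset.mul_sum, ← Finset.sum_add_distrib]
        refine Finset.sum_congr rfl fun i hi => ?_
        obtain ⟨-, h2, -⟩ := G.coeff_spec j.1 i hi
        have h4 : sgn (F.fieldStat i.1 * monoStat L) = sgn (s * monoStat L) * sgn (monoStat L) := by
          rw [h2, add_mul, one_mul, sgn_add]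
        simp only [Pi.smul_apply, smul_eq_mul, wickForm, h4]
        linear_combination (-G.coeff j.1 i * sgn (s * monoStat L) * sgn (monoStat L) *
          wickForm L x χ (posPart (i.1, j.2 + i.2) x ψ)) * sgn_mul_self s
      have hA := h x (negPartAdj j x χ) ψ
      have hB := h x χ (posPart j x ψ)
      have hM : sgn (monoStat (j :: L)) = sgn s * sgn (monoStat L) := by
        rw [monoStat_cons, sgn_add]
      have hT : sgn (s * (monoStat L + 1)) = sgn (s * monoStat L) * sgn s := by
        rw [mul_add, mul_one, sgn_add]
      simp only [Pi.add_apply, Pi.smul_apply, smul_eq_mul, hNx, consForm, LinearMap.coe_mk,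
        AddHom.coe_mk, ← hs, hT, ← hA, ← hB, wickForm, hM, hneg, hpos, hl.2.2.1, hl.2.2.2, hl.2.1,
        Finsupp.sum, hsumL, hsumR, hsub]
      have hr : (starRingEnd ℂ) (sgn s) = sgn s := by unfold sgn; split_ifs <;> simp
      rw [hr]
      have hss := sgn_mul_self s
      linear_combination (-sgn (s * monoStat L) * wickForm L x (G.Qadj χ) (posPart j x ψ)) * hss

lemma exists_gauge_of_mem (G : GaugeCharge F) {g : ℤ} {st : ZMod 2} {d : ℚ} {Φ : FormField F}
    (h : Φ ∈ wickSpan F g st d) : ∃ D ∈ wickSpan F (g + 1) (st + 1) (d + 1), ∀ x χ ψ,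
      Φ x (G.Qadj χ) ψ - sgn st * Φ x χ (G.Q ψ) = D x χ ψ := by
  induction h using Submodule.span_induction with
  | mem Φ h =>
    obtain ⟨L, ⟨h1, h2, h3⟩, rfl⟩ := h
    obtain ⟨D, hD, h⟩ := exists_wickForm_gauge G L
    rw [h1, h2] at hD
    rw [h2] at h
    exact ⟨D, wickSpan_mono (by linarith) hD, h⟩
  | zero => exact ⟨0, zero_mem _, fun χ ψ x => by simp⟩
  | add Φ Φ' _ _ h h' =>
    obtain ⟨D, hD, h⟩ := h
    obtain ⟨D', hD', h'⟩ := h'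
    refine ⟨D + D', add_mem hD hD', fun x χ ψ => ?_⟩
    simp only [Pi.add_apply, ← h, ← h']
    ring
  | smul a Φ _ h =>
    obtain ⟨D, hD, h⟩ := h
    refine ⟨a • D, Submodule.smul_mem _ _ hD, fun x χ ψ => ?_⟩
    simp only [Pi.smul_apply, smul_eq_mul, ← h]
    ring

/-- The parity condition makes the sign in d_Q the one prescribed by the statistics of the
monomials, for which the Leibniz rule holds. -/
lemma IsWick.dQ (G : GaugeCharge F) {g : ℤ} {d : ℚ} {W : OpMap F Mink} (h : IsWick g d W)
    {k : ℕ} (hk : (k : ZMod 2) = (g : ZMod 2)) : IsWick (g + 1) (d + 1) (dQ G k W) := by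
  obtain ⟨Φ, hΦ, h⟩ := isWick_iff.1 h
  obtain ⟨D, hD, hd⟩ := exists_gauge_of_mem G hΦ
  refine isWick_iff.2 ⟨D, by simpa using hD, fun f χ ψ => ?_⟩
  have hg := goodForm_of_mem hΦ
  change pair χ (G.Q (W f ψ) - (-1 : ℂ) ^ k • W f (G.Q ψ)) = _
  rw [pair_sub_right, pair_smul_right, G.adjoint, h, h, ← integral_const_mul,
    ← integral_sub (hg.integrable f _ _) ((hg.integrable f _ _).const_mul _)]
  congr 1
  funext x
  rw [← hd, ← hk, sgn_natCast]
  ring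

/-! ### The gauge variation as a linear map -/

/-- `d_Q` as a linear map. -/
def dQL (G : GaugeCharge F) (k : ℕ) {E : Type} [NormedAddCommGroup E] [NormedSpace ℝ E] :
    OpMap F E →ₗ[ℂ] OpMap F E where
  toFun := dQ G k
  map_add' A B := by
    refine LinearMap.ext fun f => LinearMap.ext fun ψ => ?_
    change G.Q (A f ψ + B f ψ) - (-1 : ℂ) ^ k • (A f (G.Q ψ) + B f (G.Q ψ))
      = (G.Q (A f ψ) - (-1 : ℂ) ^ k • A f (G.Q ψ)) + (G.Q (B f ψ) - (-1 : ℂ) ^ k • B f (G.Q ψ))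
    rw [map_add]
    module
  map_smul' c A := by
    refine LinearMap.ext fun f => LinearMap.ext fun ψ => ?_
    change G.Q (c • A f ψ) - (-1 : ℂ) ^ k • (c • A f (G.Q ψ))
      = c • (G.Q (A f ψ) - (-1 : ℂ) ^ k • A f (G.Q ψ))
    rw [map_smul]
    module

section gauge

variable (G : GaugeCharge F) (k : ℕ) {E E' : Type} [NormedAddCommGroup E] [NormedSpace ℝ E]
  [NormedAddCommGroup E'] [NormedSpace ℝ E']

lemma dQ_eq (A : OpMap F E) : dQ G k A = dQL G k A := rfl

lemma dQL_apply (A : OpMap F E) (f : 𝓢(E, ℂ)) (ψ : Fock F) :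
    dQL G k A f ψ = G.Q (A f ψ) - (-1 : ℂ) ^ k • A f (G.Q ψ) := rfl

lemma dQL_pre (t : 𝓢(E, ℂ) →L[ℂ] 𝓢(E', ℂ)) (A : OpMap F E') :
    dQL G k (pre t A) = pre t (dQL G k A) := rfl

lemma dQL_dQL (A : OpMap F E) : dQL G (k + 1) (dQL G k A) = 0 := by
  refine LinearMap.ext fun f => LinearMap.ext fun ψ => ?_
  have h : ∀ ψ, G.Q (G.Q ψ) = 0 := fun ψ => LinearMap.congr_fun G.sq_zero ψ
  simp only [dQL_apply, map_sub, map_smul, h, LinearMap.zero_apply, pow_succ]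
  simp

lemma dQL_add_two : (dQL G (k + 2) : OpMap F E →ₗ[ℂ] OpMap F E) = dQL G k := by
  refine LinearMap.ext fun A => LinearMap.ext fun f => LinearMap.ext fun ψ => ?_
  simp only [dQL_apply, pow_add]
  norm_num

lemma dQL_d₁ (μ : Fin 4) (A : Op₂ F) : dQL G k (d₁ μ A) = d₁ μ (dQL G k A) := by
  simp only [d₁, LinearMap.neg_apply, map_neg, dQL_pre]

lemma dQL_d₂ (μ : Fin 4) (A : Op₂ F) : dQL G k (d₂ μ A) = d₂ μ (dQL G k A) := by
  simp only [d₂, LinearMap.neg_apply, map_neg, dQL_pre]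

lemma dQL_dR (μ : Fin 4) (A : Op₂ F) : dQL G k (dR μ A) = dR μ (dQL G k A) := by
  simp only [dR, LinearMap.smul_apply, LinearMap.sub_apply, map_smul, map_sub, dQL_d₁, dQL_d₂]

lemma dQL_mZ (μ : Fin 4) (A : Op₂ F) : dQL G k (mZ μ A) = mZ μ (dQL G k A) := rfl

lemma dQL_sw (A : Op₂ F) : dQL G k (sw A) = sw (dQL G k A) := rfl

lemma dQL_dlt (W : OpMap F Mink) : dQL G k (dlt W) = dlt (dQL G k W) := rfl

end gauge

/-! ### The order of a quasi-local operator -/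

variable (F) in
/-- The operators that are annihilated by products of `n + 1` relative coordinates. -/
def ordLe : ℕ → Submodule ℂ (Op₂ F)
  | 0 => ⨅ μ, LinearMap.ker (mZ μ)
  | n + 1 => ⨅ μ, (ordLe n).comap (mZ μ)

lemma mem_ordLe_zero {A : Op₂ F} : A ∈ ordLe F 0 ↔ ∀ μ, mZ μ A = 0 := by
  simp [ordLe, Submodule.mem_iInf]

lemma mem_ordLe_succ {n : ℕ} {A : Op₂ F} : A ∈ ordLe F (n + 1) ↔ ∀ μ, mZ μ A ∈ ordLe F n := by
  simp [ordLe, Submodule.mem_iInf]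

lemma ordLe_le_succ (n : ℕ) : ordLe F n ≤ ordLe F (n + 1) := by
  induction n with
  | zero =>
    intro A hA
    rw [mem_ordLe_succ]
    intro μ
    rw [mem_ordLe_zero.1 hA]
    exact zero_mem _
  | succ n ih =>
    intro A hA
    rw [mem_ordLe_succ] at hA ⊢
    exact fun μ => ih (hA μ)

lemma ordLe_mono : Monotone (ordLe F) := monotone_nat_of_le_succ ordLe_le_succ

/-- Commuting a coordinate past the derivative returns only a multiple of A, so one additional
coordinate suffices to annihilate. -/
lemma dR_mem_ordLe {n : ℕ} {A : Op₂ F} (h : A ∈ ordLe F n) (μ : Fin 4) :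
    dR μ A ∈ ordLe F (n + 1) := by
  induction n generalizing A with
  | zero =>
    refine mem_ordLe_succ.2 fun ν => ?_
    rw [mZ_dR, mem_ordLe_zero.1 h, map_zero, zero_sub]
    exact neg_mem (Submodule.smul_mem _ _ h)
  | succ n ih =>
    refine mem_ordLe_succ.2 fun ν => ?_
    rw [mZ_dR]
    exact sub_mem (ih (mem_ordLe_succ.1 h ν)) (Submodule.smul_mem _ _ h)

/-- Total derivatives commute with the relative coordinates and hence do not affect the order. -/
lemma dT_mem_ordLe {n : ℕ} {A : Op₂ F} (h : A ∈ ordLe F n) (μ : Fin 4) : dT μ A ∈ ordLe F n := by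
  induction n generalizing A with
  | zero =>
    refine mem_ordLe_zero.2 fun ν => ?_
    rw [mZ_dT, mem_ordLe_zero.1 h, map_zero]
  | succ n ih =>
    refine mem_ordLe_succ.2 fun ν => ?_
    rw [mZ_dT]
    exact ih (mem_ordLe_succ.1 h ν)

lemma sw_mem_ordLe {n : ℕ} {A : Op₂ F} (h : A ∈ ordLe F n) : sw A ∈ ordLe F n := by
  induction n generalizing A with
  | zero =>
    refine mem_ordLe_zero.2 fun ν => ?_
    rw [← neg_neg (mZ ν (sw A)), ← sw_mZ, mem_ordLe_zero.1 h, map_zero, neg_zero]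
  | succ n ih =>
    refine mem_ordLe_succ.2 fun ν => ?_
    rw [← neg_neg (mZ ν (sw A)), ← sw_mZ]
    exact neg_mem (ih (mem_ordLe_succ.1 h ν))

lemma dQL_mem_ordLe (G : GaugeCharge F) (k : ℕ) {n : ℕ} {A : Op₂ F} (h : A ∈ ordLe F n) :
    dQL G k A ∈ ordLe F n := by
  induction n generalizing A with
  | zero =>
    refine mem_ordLe_zero.2 fun ν => ?_
    rw [← dQL_mZ, mem_ordLe_zero.1 h, map_zero]
  | succ n ih =>
    refine mem_ordLe_succ.2 fun ν => ?_
    rw [← dQL_mZ]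
    exact ih (mem_ordLe_succ.1 h ν)

lemma dlt_mem_ordLe (W : OpMap F Mink) : dlt W ∈ ordLe F 0 :=
  mem_ordLe_zero.2 fun μ => mZ_dlt μ W

/-! ### Homogeneous quasi-local operators -/

variable (F) in
/-- Quasi-local operators that are homogeneous of order `k` in the derivatives of `δ` with respect
to the relative coordinate, with ghost number `g` and total dimension at most `d`. -/
def qlPure (g : ℤ) : ℕ → ℚ → Submodule ℂ (Op₂ F)
  | 0, d => (wickSub F g d).map dlt
  | k + 1, d => ⨆ μ, (qlPure g k (d - 1)).map (dR μ)

lemma dlt_mem_qlPure {g : ℤ} {d : ℚ} {W : OpMap F Mink} (h : IsWick g d W) :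
    dlt W ∈ qlPure F g 0 d := ⟨W, h, rfl⟩

lemma dR_mem_qlPure {g : ℤ} {k : ℕ} {d : ℚ} {A : Op₂ F} (h : A ∈ qlPure F g k d) (μ : Fin 4) :
    dR μ A ∈ qlPure F g (k + 1) (d + 1) := by
  refine Submodule.mem_iSup_of_mem μ ⟨A, ?_, rfl⟩
  rwa [add_sub_cancel_right]

/-- An induction principle for homogeneous quasi-local operators of positive order. -/
lemma qlPure_succ_le {g : ℤ} {k : ℕ} {d : ℚ} {S : Submodule ℂ (Op₂ F)}
    (h : ∀ μ, ∀ A ∈ qlPure F g k (d - 1), dR μ A ∈ S) : qlPure F g (k + 1) d ≤ S :=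
  iSup_le fun μ => Submodule.map_le_iff_le_comap.2 fun A hA => h μ A hA

/-- A total derivative commutes with the relative ones until it reaches the coefficient, where it
costs one unit of dimension. -/
lemma dT_mem_qlPure {g : ℤ} {k : ℕ} {d : ℚ} {A : Op₂ F} (h : A ∈ qlPure F g k d) (μ : Fin 4) :
    dT μ A ∈ qlPure F g k (d + 1) := by
  induction k generalizing d A with
  | zero =>
    obtain ⟨W, hW, rfl⟩ := h
    rw [dT_dlt]
    exact dlt_mem_qlPure (IsWick.pdL hW μ)
  | succ k ih =>
    suffices h' : qlPure F g (k + 1) d ≤ (qlPure F g (k + 1) (d + 1)).comap (dT μ) from h' h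
    refine qlPure_succ_le fun ν B hB => ?_
    rw [Submodule.mem_comap, dT_dR]
    have := dR_mem_qlPure (ih hB) ν
    rwa [sub_add_cancel] at this

lemma qlPure_le_ordLe (g : ℤ) (k : ℕ) (d : ℚ) : qlPure F g k d ≤ ordLe F k := by
  induction k generalizing d with
  | zero => rintro _ ⟨W, -, rfl⟩; exact dlt_mem_ordLe W
  | succ k ih => exact qlPure_succ_le fun μ A hA => dR_mem_ordLe (ih _ hA) μ

/-- By the Weyl relation a coordinate removes one relative derivative; the term in which it passes
all of them annihilates δW. -/
lemma mZ_mem_qlPure {g : ℤ} {k : ℕ} {d : ℚ} {A : Op₂ F} (h : A ∈ qlPure F g (k + 1) d)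
    (μ : Fin 4) : mZ μ A ∈ qlPure F g k (d - 1) := by
  induction k generalizing d A with
  | zero =>
    suffices h' : qlPure F g 1 d ≤ (qlPure F g 0 (d - 1)).comap (mZ μ) from h' h
    refine qlPure_succ_le fun ν B hB => ?_
    rw [Submodule.mem_comap, mZ_dR, mem_ordLe_zero.1 (qlPure_le_ordLe g 0 _ hB), map_zero, zero_sub]
    exact neg_mem (Submodule.smul_mem _ _ hB)
  | succ k ih =>
    suffices h' : qlPure F g (k + 2) d ≤ (qlPure F g (k + 1) (d - 1)).comap (mZ μ) from h' h
    refine qlPure_succ_le fun ν B hB => ?_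
    rw [Submodule.mem_comap, mZ_dR]
    refine sub_mem ?_ (Submodule.smul_mem _ _ hB)
    have := dR_mem_qlPure (ih hB) ν
    rwa [sub_add_cancel] at this

/-- Euler's identity. -/
lemma sum_dR_mZ {g : ℤ} {k : ℕ} {d : ℚ} {A : Op₂ F} (h : A ∈ qlPure F g k d) :
    ∑ μ, dR μ (mZ μ A) = -((k : ℂ) • A) := by
  induction k generalizing d A with
  | zero => simp [mem_ordLe_zero.1 (qlPure_le_ordLe g 0 _ h)]
  | succ k ih =>
    let S : Submodule ℂ (Op₂ F) := LinearMap.ker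
      (∑ μ, dR μ ∘ₗ mZ μ + ((k + 1 : ℕ) : ℂ) • LinearMap.id)
    have h' : qlPure F g (k + 1) d ≤ S := by
      refine qlPure_succ_le fun ν B hB => ?_
      rw [LinearMap.mem_ker]
      simp only [LinearMap.add_apply, LinearMap.sum_apply, LinearMap.comp_apply,
        LinearMap.smul_apply, LinearMap.id_apply, mZ_dR, map_sub, map_smul,
        Finset.sum_sub_distrib]
      have h1 : ∑ μ, dR μ (dR ν (mZ μ B)) = -((k : ℂ) • dR ν B) := by
        simp only [dR_dR _ ν]
        rw [← map_sum, ih hB, map_neg, map_smul]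
      have h2 : ∑ μ, (if ν = μ then (1 : ℂ) else 0) • dR μ B = dR ν B := by simp
      rw [h1, h2]
      push_cast
      module
    have h2 := h' h
    rw [LinearMap.mem_ker] at h2
    simp only [LinearMap.add_apply, LinearMap.sum_apply, LinearMap.comp_apply,
      LinearMap.smul_apply, LinearMap.id_apply] at h2
    rw [eq_neg_of_add_eq_zero_left h2]

/-- A homogeneous operator of positive order that is of lower order vanishes. -/
lemma eq_zero_of_mem_ordLe {g : ℤ} {n : ℕ} {d : ℚ} {A : Op₂ F}
    (h : A ∈ qlPure F g (n + 1) d) (h' : A ∈ ordLe F n) : A = 0 := by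
  -- Euler's identity recovers A from its products with coordinates, because the order n + 1 is
  -- nonzero.
  have key : (∀ μ, mZ μ A = 0) → A = 0 := by
    intro hz
    have := sum_dR_mZ h
    simp only [hz, map_zero, Finset.sum_const_zero] at this
    have h2 : ((n + 1 : ℕ) : ℂ) • A = 0 := neg_eq_zero.1 this.symm
    exact (smul_eq_zero.1 h2).resolve_left (Nat.cast_ne_zero.2 (Nat.succ_ne_zero n))
  induction n generalizing d A with
  | zero => exact key (mem_ordLe_zero.1 h')
  | succ n ih =>
    refine key fun μ => ih (mZ_mem_qlPure h μ) (mem_ordLe_succ.1 h' μ) fun hz => ?_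
    have h3 := sum_dR_mZ (mZ_mem_qlPure h μ)
    simp only [hz, map_zero, Finset.sum_const_zero] at h3
    have h2 : ((n + 1 : ℕ) : ℂ) • mZ μ A = 0 := neg_eq_zero.1 h3.symm
    exact (smul_eq_zero.1 h2).resolve_left (Nat.cast_ne_zero.2 (Nat.succ_ne_zero n))

/-- Each relative derivative contributes one sign and δW is symmetric. The parity of the order thus
fixes the exchange symmetry of a leading part. -/
lemma sw_of_mem_qlPure {g : ℤ} {k : ℕ} {d : ℚ} {A : Op₂ F} (h : A ∈ qlPure F g k d) :
    sw A = (-1 : ℂ) ^ k • A := by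
  induction k generalizing d A with
  | zero => obtain ⟨W, -, rfl⟩ := h; rw [sw_dlt, pow_zero, one_smul]
  | succ k ih =>
    let S : Submodule ℂ (Op₂ F) := LinearMap.ker (sw - (-1 : ℂ) ^ (k + 1) • LinearMap.id)
    have h' : qlPure F g (k + 1) d ≤ S := by
      refine qlPure_succ_le fun ν B hB => ?_
      rw [LinearMap.mem_ker, LinearMap.sub_apply, sw_dR, ih hB, LinearMap.smul_apply,
        LinearMap.id_apply, map_smul, pow_succ]
      module
    have h2 := h' h
    rw [LinearMap.mem_ker, LinearMap.sub_apply, sub_eq_zero] at h2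
    exact h2

lemma sw_mem_qlPure {g : ℤ} {k : ℕ} {d : ℚ} {A : Op₂ F} (h : A ∈ qlPure F g k d) :
    sw A ∈ qlPure F g k d := by
  rw [sw_of_mem_qlPure h]
  exact Submodule.smul_mem _ _ h

lemma dQL_mem_qlPure (G : GaugeCharge F) {m : ℕ} {g : ℤ} {k : ℕ} {d : ℚ} {A : Op₂ F}
    (h : A ∈ qlPure F g k d) (hm : (m : ZMod 2) = (g : ZMod 2)) :
    dQL G m A ∈ qlPure F (g + 1) k (d + 1) := by
  induction k generalizing d A with
  | zero =>
    obtain ⟨W, hW, rfl⟩ := h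
    rw [dQL_dlt]
    exact dlt_mem_qlPure (IsWick.dQ G hW hm)
  | succ k ih =>
    suffices h' : qlPure F g (k + 1) d ≤ (qlPure F (g + 1) (k + 1) (d + 1)).comap (dQL G m) from
      h' h
    refine qlPure_succ_le fun ν B hB => ?_
    rw [Submodule.mem_comap, dQL_dR]
    have := dR_mem_qlPure (ih hB) ν
    rwa [sub_add_cancel] at this

/-- Power counting: a homogeneous operator whose coefficients have dimension below their ghost
number vanishes. -/
lemma qlPure_eq_bot {g : ℤ} {k : ℕ} {d : ℚ} (h : d - k < g) : qlPure F g k d = ⊥ := by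
  induction k generalizing d with
  | zero =>
    refine eq_bot_iff.2 ?_
    rintro _ ⟨W, hW, rfl⟩
    rw [IsWick.eq_zero hW (by simpa using h), map_zero]
    exact zero_mem _
  | succ k ih =>
    refine eq_bot_iff.2 (qlPure_succ_le fun ν B hB => ?_)
    rw [ih (by push_cast at h; linarith)] at hB
    rw [(Submodule.mem_bot ℂ).1 hB, map_zero]
    exact zero_mem _

/-! ### Quasi-local operators -/

variable (F) in
/-- The quasi-local operators of order at most `n`. -/
def qlLe (g : ℤ) (d : ℚ) : ℕ → Submodule ℂ (Op₂ F)
  | 0 => qlPure F g 0 d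
  | n + 1 => qlLe g d n ⊔ qlPure F g (n + 1) d

variable (F) in
/-- The quasi-local operators. -/
def ql (g : ℤ) (d : ℚ) : Submodule ℂ (Op₂ F) := ⨆ k, qlPure F g k d

lemma qlPure_le_ql (g : ℤ) (d : ℚ) (k : ℕ) : qlPure F g k d ≤ ql F g d :=
  le_iSup (fun k => qlPure F g k d) k

lemma qlLe_le_ordLe (g : ℤ) (d : ℚ) (n : ℕ) : qlLe F g d n ≤ ordLe F n := by
  induction n with
  | zero => exact qlPure_le_ordLe g 0 d
  | succ n ih => exact sup_le (ih.trans (ordLe_le_succ n)) (qlPure_le_ordLe g (n + 1) d)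

lemma qlLe_mono (g : ℤ) (d : ℚ) : Monotone (qlLe F g d) :=
  monotone_nat_of_le_succ fun _ => le_sup_left

lemma qlPure_le_qlLe (g : ℤ) (d : ℚ) (n : ℕ) : qlPure F g n d ≤ qlLe F g d n := by
  cases n with
  | zero => exact le_rfl
  | succ n => exact le_sup_right

lemma exists_qlLe {g : ℤ} {d : ℚ} {A : Op₂ F} (h : A ∈ ql F g d) : ∃ n, A ∈ qlLe F g d n := by
  induction h using Submodule.iSup_induction' with
  | mem k A hA => exact ⟨k, qlPure_le_qlLe g d k hA⟩
  | zero => exact ⟨0, zero_mem _⟩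
  | add A B _ _ hA hB =>
    obtain ⟨n, hn⟩ := hA
    obtain ⟨m, hm⟩ := hB
    exact ⟨max n m, add_mem (qlLe_mono g d (le_max_left n m) hn)
      (qlLe_mono g d (le_max_right n m) hm)⟩

lemma exists_ordLe {g : ℤ} {d : ℚ} {A : Op₂ F} (h : A ∈ ql F g d) : ∃ n, A ∈ ordLe F n := by
  obtain ⟨n, hn⟩ := exists_qlLe h
  exact ⟨n, qlLe_le_ordLe g d n hn⟩

/-- Descent from some larger order: a top part above n is a difference of operators of lower order,
hence zero. -/
lemma mem_qlLe {g : ℤ} {d : ℚ} {n : ℕ} {A : Op₂ F} (h : A ∈ ql F g d) (h' : A ∈ ordLe F n) :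
    A ∈ qlLe F g d n := by
  obtain ⟨m, hm⟩ := exists_qlLe h
  induction m with
  | zero => exact qlLe_mono g d (Nat.zero_le n) hm
  | succ m ih =>
    by_cases hmn : m + 1 ≤ n
    · exact qlLe_mono g d hmn hm
    obtain ⟨B, hB, C, hC, rfl⟩ := Submodule.mem_sup.1 hm
    have hC0 : C = 0 := by
      refine eq_zero_of_mem_ordLe hC ?_
      have := sub_mem (ordLe_mono (by omega : n ≤ m) h') (qlLe_le_ordLe g d m hB)
      rwa [add_sub_cancel_left] at this
    rw [hC0, add_zero] at h h' ih ⊢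
    exact ih hB

/-- The leading part of a quasi-local operator. -/
lemma exists_top {g : ℤ} {d : ℚ} {n : ℕ} {A : Op₂ F} (h : A ∈ ql F g d)
    (h' : A ∈ ordLe F (n + 1)) : ∃ B ∈ qlPure F g (n + 1) d, A - B ∈ ordLe F n := by
  obtain ⟨C, hC, B, hB, rfl⟩ := Submodule.mem_sup.1 (mem_qlLe h h')
  exact ⟨B, hB, by rw [add_sub_cancel_right]; exact qlLe_le_ordLe g d n hC⟩

/-- A quasi-local operator without derivatives of `δ` is of the form `δ W`. -/
lemma exists_dlt {g : ℤ} {d : ℚ} {A : Op₂ F} (h : A ∈ ql F g d) (h' : A ∈ ordLe F 0) :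
    ∃ W, IsWick g d W ∧ A = dlt W := by
  obtain ⟨W, hW, h⟩ := mem_qlLe h h'
  exact ⟨W, hW, h.symm⟩

/-- Linear maps that respect the homogeneous parts respect quasi-local operators. -/
lemma ql_le_of {g : ℤ} {d : ℚ} {S : Submodule ℂ (Op₂ F)} (h : ∀ k, qlPure F g k d ≤ S) :
    ql F g d ≤ S := iSup_le h

lemma dR_mem_ql {g : ℤ} {d : ℚ} {A : Op₂ F} (h : A ∈ ql F g d) (μ : Fin 4) :
    dR μ A ∈ ql F g (d + 1) :=
  ql_le_of (S := (ql F g (d + 1)).comap (dR μ))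
    (fun k _ hA => qlPure_le_ql g (d + 1) (k + 1) (dR_mem_qlPure hA μ)) h

lemma dT_mem_ql {g : ℤ} {d : ℚ} {A : Op₂ F} (h : A ∈ ql F g d) (μ : Fin 4) :
    dT μ A ∈ ql F g (d + 1) :=
  ql_le_of (S := (ql F g (d + 1)).comap (dT μ))
    (fun k _ hA => qlPure_le_ql g (d + 1) k (dT_mem_qlPure hA μ)) h

lemma sw_mem_ql {g : ℤ} {d : ℚ} {A : Op₂ F} (h : A ∈ ql F g d) : sw A ∈ ql F g d :=
  ql_le_of (S := (ql F g d).comap sw) (fun k _ hA => qlPure_le_ql g d k (sw_mem_qlPure hA)) h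

lemma dQL_mem_ql (G : GaugeCharge F) {m : ℕ} {g : ℤ} {d : ℚ} {A : Op₂ F} (h : A ∈ ql F g d)
    (hm : (m : ZMod 2) = (g : ZMod 2)) : dQL G m A ∈ ql F (g + 1) (d + 1) :=
  ql_le_of (S := (ql F (g + 1) (d + 1)).comap (dQL G m))
    (fun k _ hA => qlPure_le_ql (g + 1) (d + 1) k (dQL_mem_qlPure G hA hm)) h

lemma d₁_mem_ql {g : ℤ} {d : ℚ} {A : Op₂ F} (h : A ∈ ql F g d) (μ : Fin 4) :
    d₁ μ A ∈ ql F g (d + 1) := by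
  rw [d₁_eq]
  exact sub_mem (Submodule.smul_mem _ _ (dT_mem_ql h μ)) (dR_mem_ql h μ)

lemma d₂_mem_ql {g : ℤ} {d : ℚ} {A : Op₂ F} (h : A ∈ ql F g d) (μ : Fin 4) :
    d₂ μ A ∈ ql F g (d + 1) := by
  rw [d₂_eq]
  exact add_mem (Submodule.smul_mem _ _ (dT_mem_ql h μ)) (dR_mem_ql h μ)

lemma dlt_mem_ql {g : ℤ} {d : ℚ} {W : OpMap F Mink} (h : IsWick g d W) : dlt W ∈ ql F g d :=
  qlPure_le_ql g d 0 (dlt_mem_qlPure h)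

/-- Power counting bounds the order of a quasi-local operator. -/
lemma mem_ordLe_of_mem_ql {g : ℤ} {d : ℚ} {n : ℕ} (hn : d - n < g + 1) {A : Op₂ F}
    (h : A ∈ ql F g d) : A ∈ ordLe F n := by
  refine ql_le_of (S := ordLe F n) (fun k => ?_) h
  by_cases hk : k ≤ n
  · exact (qlPure_le_ordLe g k d).trans (ordLe_mono hk)
  · rw [qlPure_eq_bot]
    · exact bot_le
    · have : (n : ℚ) + 1 ≤ k := by exact_mod_cast Nat.succ_le_of_lt (not_le.1 hk)
      linarith

/-! ### Comparison with the expansion in derivatives of `δ(x₂ - x₁)` -/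

/-- `X ↦ (∂/∂x₂)^μ X` for a list of indices. -/
def d₂Iter {k : ℕ} (μ : Fin k → Fin 4) : Op₂ F →ₗ[ℂ] Op₂ F :=
  (-1 : ℂ) ^ k • pre (LineDeriv.iteratedLineDerivOpCLM ℂ 𝓢(Mink × Mink, ℂ)
      (fun i => ((0, basisVec (μ i)) : Mink × Mink)))

lemma deltaDerivMul_eq {k : ℕ} (μ : Fin k → Fin 4) (W : OpMap F Mink) :
    deltaDerivMul μ W = d₂Iter μ (dlt W) := rfl

lemma d₂Iter_zero (μ : Fin 0 → Fin 4) (A : Op₂ F) : d₂Iter μ A = A := by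
  refine LinearMap.ext fun h => ?_
  simp [d₂Iter, pre_apply]

lemma d₂Iter_succ {k : ℕ} (μ : Fin (k + 1) → Fin 4) (A : Op₂ F) :
    d₂Iter μ A = d₂ (μ (Fin.last k)) (d₂Iter (Fin.init μ) A) := by
  refine LinearMap.ext fun h => ?_
  simp only [d₂Iter, LinearMap.smul_apply, pre_apply, d₂_apply, pow_succ,
    LineDeriv.iteratedLineDerivOpCLM_apply, LineDeriv.iteratedLineDerivOp_succ_right]
  simp only [mul_neg, mul_one, neg_smul]
  rfl

lemma d₂Iter_snoc {k : ℕ} (μ : Fin k → Fin 4) (ν : Fin 4) (A : Op₂ F) :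
    d₂Iter (Fin.snoc μ ν : Fin (k + 1) → Fin 4) A = d₂ ν (d₂Iter μ A) := by
  rw [d₂Iter_succ, Fin.snoc_last, Fin.init_snoc]

lemma dT_d₂ (μ ν : Fin 4) (A : Op₂ F) : dT μ (d₂ ν A) = d₂ ν (dT μ A) := by
  simp only [dT, LinearMap.add_apply, map_add, d₁_d₂, d₂_d₂ μ ν]

lemma dT_d₂Iter {k : ℕ} (μ : Fin k → Fin 4) (ν : Fin 4) (A : Op₂ F) :
    dT ν (d₂Iter μ A) = d₂Iter μ (dT ν A) := by
  induction k with
  | zero => simp only [d₂Iter_zero]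
  | succ k ih => rw [d₂Iter_succ, d₂Iter_succ, dT_d₂, ih]

variable (F) in
/-- The operators with an expansion in derivatives of `δ(x₂ - x₁)`. -/
def qlExp (g : ℤ) (d : ℚ) : Submodule ℂ (Op₂ F) :=
  ⨆ w : Σ k : ℕ, Fin k → Fin 4, (wickSub F g (d - (w.1 : ℚ))).map (d₂Iter w.2 ∘ₗ dlt)

lemma mem_qlExp {g : ℤ} {d : ℚ} {k : ℕ} (μ : Fin k → Fin 4) {W : OpMap F Mink}
    (h : IsWick g (d - (k : ℚ)) W) : d₂Iter μ (dlt W) ∈ qlExp F g d :=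
  Submodule.mem_iSup_of_mem ⟨k, μ⟩ ⟨W, h, rfl⟩

lemma qlExp_le_of {g : ℤ} {d : ℚ} {S : Submodule ℂ (Op₂ F)}
    (h : ∀ (k : ℕ) (μ : Fin k → Fin 4) (W : OpMap F Mink), IsWick g (d - (k : ℚ)) W →
      d₂Iter μ (dlt W) ∈ S) : qlExp F g d ≤ S :=
  iSup_le fun w => Submodule.map_le_iff_le_comap.2 fun W hW => h w.1 w.2 W hW

/-- As `dR` = `d₂` - `dT`/2, one term appends a derivative of δ and the other differentiates the
coefficient; both fit the dimension bound. -/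
lemma dR_mem_qlExp {g : ℤ} {d : ℚ} {A : Op₂ F} (h : A ∈ qlExp F g d) (ν : Fin 4) :
    dR ν A ∈ qlExp F g (d + 1) := by
  refine qlExp_le_of (S := (qlExp F g (d + 1)).comap (dR ν)) (fun k μ W hW => ?_) h
  have e : dR ν (d₂Iter μ (dlt W)) = d₂ ν (d₂Iter μ (dlt W))
      - (2⁻¹ : ℂ) • dT ν (d₂Iter μ (dlt W)) := by rw [d₂_eq]; module
  rw [Submodule.mem_comap, e, dT_d₂Iter, dT_dlt, ← d₂Iter_snoc]
  refine sub_mem (mem_qlExp _ (hW.mono ?_))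
    (Submodule.smul_mem _ _ (mem_qlExp _ ((hW.pdL ν).mono ?_)))
  · push_cast; linarith
  · linarith

lemma qlPure_le_qlExp (g : ℤ) (k : ℕ) (d : ℚ) : qlPure F g k d ≤ qlExp F g d := by
  induction k generalizing d with
  | zero =>
    rintro _ ⟨W, hW, rfl⟩
    have := mem_qlExp (k := 0) (d := d) (g := g) (fun i => i.elim0) (W := W) (by simpa using! hW)
    rwa [d₂Iter_zero] at this
  | succ k ih =>
    refine qlPure_succ_le fun ν B hB => ?_
    have := dR_mem_qlExp (ih _ hB) ν
    rwa [sub_add_cancel] at this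

lemma d₂Iter_mem_ql {g : ℤ} {k : ℕ} (μ : Fin k → Fin 4) {d : ℚ} {A : Op₂ F}
    (h : A ∈ ql F g (d - k)) : d₂Iter μ A ∈ ql F g d := by
  induction k generalizing d with
  | zero => rw [d₂Iter_zero]; simpa using h
  | succ k ih =>
    rw [d₂Iter_succ]
    have h1 : d₂Iter (Fin.init μ) A ∈ ql F g (d - 1) := by
      refine ih _ ?_
      have : d - 1 - (k : ℚ) = d - ((k + 1 : ℕ) : ℚ) := by push_cast; ring
      rwa [this]
    have h2 := d₂_mem_ql h1 (μ (Fin.last k))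
    rwa [sub_add_cancel] at h2

/-- Re-expansion between `d₂` and `dR` mixes orders, but a derivative costs one unit of dimension
whether it falls on δ or on the coefficient, so the bounds d - k are respected. -/
lemma qlExp_eq_ql (g : ℤ) (d : ℚ) : qlExp F g d = ql F g d :=
  le_antisymm (qlExp_le_of fun _ μ _ hW => d₂Iter_mem_ql μ (dlt_mem_ql hW))
    (ql_le_of fun k => qlPure_le_qlExp g k d)

lemma isQuasiLocal_iff {g : ℤ} {d : ℚ} {A : Op₂ F} : IsQuasiLocal g d A ↔ A ∈ ql F g d := by
  rw [← qlExp_eq_ql]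
  constructor
  · rintro ⟨K, W, hW, rfl⟩
    exact Submodule.sum_mem _ fun k _ => Submodule.sum_mem _ fun μ _ => mem_qlExp μ (hW k μ)
  · intro h
    induction h using Submodule.iSup_induction' with
    | mem w A hA =>
      obtain ⟨k, μ⟩ := w
      obtain ⟨W, hW, rfl⟩ := hA
      classical
      let V : (l : ℕ) → (Fin l → Fin 4) → OpMap F Mink := fun l ν =>
        if (⟨l, ν⟩ : Σ k : ℕ, Fin k → Fin 4) = ⟨k, μ⟩ then W else 0
      refine ⟨k, V, fun l ν => ?_, ?_⟩
      · by_cases h : (⟨l, ν⟩ : Σ k : ℕ, Fin k → Fin 4) = ⟨k, μ⟩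
        · cases h
          simpa [V] using! hW
        · simp only [V, h, if_false]
          exact isWick_zero _ _
      · rw [Finset.sum_eq_single k, Finset.sum_eq_single μ]
        · simp only [V, if_true]; rfl
        · intro ν _ hν
          have : ¬ (⟨k, ν⟩ : Σ k : ℕ, Fin k → Fin 4) = ⟨k, μ⟩ := fun h => hν (by simpa using h)
          simp only [V, this, if_false, deltaDerivMul_eq, map_zero]
        · simp
        · intro l _ hl
          refine Finset.sum_eq_zero fun ν _ => ?_
          have : ¬ (⟨l, ν⟩ : Σ k : ℕ, Fin k → Fin 4) = ⟨k, μ⟩ :=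
            fun h => hl (congrArg Sigma.fst h)
          simp only [V, this, if_false, deltaDerivMul_eq, map_zero]
        · simp
    | zero =>
      exact ⟨0, fun _ _ => 0, fun _ _ => isWick_zero _ _, by simp [deltaDerivMul_eq]⟩
    | add A B _ _ hA hB =>
      obtain ⟨K, W, hW, rfl⟩ := hA
      obtain ⟨K', W', hW', rfl⟩ := hB
      -- Padding with zero coefficients brings both sums to a common maximal order.
      have hext : ∀ (K M : ℕ) (W : (k : ℕ) → (Fin k → Fin 4) → OpMap F Mink), K ≤ M →
          ∑ k ∈ Finset.range (K + 1), ∑ μ : Fin k → Fin 4, deltaDerivMul μ (W k μ)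
          = ∑ k ∈ Finset.range (M + 1), ∑ μ : Fin k → Fin 4,
            deltaDerivMul μ (if k ≤ K then W k μ else 0) := by
        intro K M W hKM
        rw [← Finset.sum_subset (Finset.range_mono (Nat.succ_le_succ hKM))]
        · refine Finset.sum_congr rfl fun k hk => Finset.sum_congr rfl fun μ _ => ?_
          rw [if_pos (Nat.lt_succ_iff.1 (Finset.mem_range.1 hk))]
        · intro k _ hk
          refine Finset.sum_eq_zero fun μ _ => ?_
          rw [if_neg (fun h => hk (Finset.mem_range.2 (Nat.lt_succ_of_le h))), deltaDerivMul_eq,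
            map_zero, map_zero]
      refine ⟨max K K', fun k μ => (if k ≤ K then W k μ else 0) + (if k ≤ K' then W' k μ else 0),
        fun k μ => ?_, ?_⟩
      · refine IsWick.add ?_ ?_ <;> split_ifs
        exacts [hW k μ, isWick_zero _ _, hW' k μ, isWick_zero _ _]
      · rw [hext K _ W (le_max_left K K'), hext K' _ W' (le_max_right K K')]
        simp only [deltaDerivMul_eq, map_add, Finset.sum_add_distrib]

/-! ### Quasi-local operators as distributions -/

/-- Quasi-local operators have matrix elements that are tempered distributions. -/
lemma isOpDistribution_of_mem_ql {g : ℤ} {d : ℚ} {A : Op₂ F} (h : A ∈ ql F g d) :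
    IsOpDistribution A := by
  let S : Submodule ℂ (Op₂ F) :=
    { carrier := {A | IsOpDistribution A}
      zero_mem' := fun χ ψ => by simp [pair_zero_right, continuous_const]
      add_mem' := fun hA hB χ ψ => by
        simp only [LinearMap.add_apply, pair_add_right]
        exact (hA χ ψ).add (hB χ ψ)
      smul_mem' := fun c A hA χ ψ => by
        simp only [LinearMap.smul_apply, pair_smul_right]
        exact continuous_const.mul (hA χ ψ) }
  rw [← qlExp_eq_ql] at h
  refine qlExp_le_of (S := S) (fun k μ W hW => Submodule.smul_mem S _ ?_) h
  intro χ ψ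
  exact (hW.isOpDistribution χ ψ).comp (diagTest.continuous.comp
    (LineDeriv.iteratedLineDerivOpCLM ℂ 𝓢(Mink × Mink, ℂ) _).continuous)

/-- Quasi-local operators are supported on the diagonal. -/
lemma apply_eq_zero_of_mem_ql {g : ℤ} {d : ℚ} {A : Op₂ F} (h : A ∈ ql F g d)
    {u : 𝓢(Mink × Mink, ℂ)} (hu : ∀ x, (x, x) ∉ tsupport u) : A u = 0 := by
  let S : Submodule ℂ (Op₂ F) :=
    { carrier := {A | A u = 0}
      zero_mem' := rfl
      add_mem' := fun {A B} hA hB => by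
        change A u + B u = 0
        rw [show A u = 0 from hA, show B u = 0 from hB, add_zero]
      smul_mem' := fun c A hA => by
        change c • A u = 0
        rw [show A u = 0 from hA, smul_zero] }
  rw [← qlExp_eq_ql] at h
  refine qlExp_le_of (S := S) (fun k μ W hW => Submodule.smul_mem S _ ?_) h
  change W (diagTest (∂^{fun i => ((0, basisVec (μ i)) : Mink × Mink)} u)) = 0
  have : diagTest (∂^{fun i => ((0, basisVec (μ i)) : Mink × Mink)} u) = 0 := by
    ext x
    rw [diagTest_apply]
    by_contra hne
    exact hu x (SchwartzMap.tsupport_iteratedLineDerivOp_subset _ _ (subset_tsupport _ hne))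
  rw [this, map_zero]

/-! ### The differentials on cochains -/

variable (F) in
/-- `C ↦ δ C` as a linear map. -/
def cD : Cochain F →ₗ[ℂ] Cochain F where
  toFun := coDelta
  map_add' C C' := by
    funext I J
    simp only [coDelta, Pi.add_apply, pd₁_eq, pd₂_eq, map_add, Finset.sum_add_distrib, smul_add]
    abel
  map_smul' c C := by
    funext I J
    simp only [coDelta, Pi.smul_apply, pd₁_eq, pd₂_eq, map_smul, RingHom.id_apply,
      ← Finset.smul_sum, smul_add]
    rw [smul_comm c]

lemma cD_apply (C : Cochain F) (I J : Idx) :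
    cD F C I J = ∑ μ, d₁ μ (C (I ++ [μ]) J) + (-1 : ℂ) ^ I.length • ∑ μ, d₂ μ (C I (J ++ [μ])) :=
  rfl

/-- `d_Q` on cochains of degree `e`. -/
def dQC (G : GaugeCharge F) (e : ℕ) : Cochain F →ₗ[ℂ] Cochain F where
  toFun C I J := dQL G (I.length + J.length + e) (C I J)
  map_add' C C' := by funext I J; simp only [Pi.add_apply, map_add]
  map_smul' c C := by funext I J; simp only [Pi.smul_apply, map_smul, RingHom.id_apply]

lemma dQC_apply (G : GaugeCharge F) (e : ℕ) (C : Cochain F) (I J : Idx) :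
    dQC G e C I J = dQL G (I.length + J.length + e) (C I J) := rfl

lemma dQC_dQC (G : GaugeCharge F) (e : ℕ) (C : Cochain F) : dQC G (e + 1) (dQC G e C) = 0 := by
  funext I J
  rw [dQC_apply, dQC_apply, ← add_assoc, dQL_dQL]
  rfl

lemma dQC_add_two (G : GaugeCharge F) (e : ℕ) : dQC G (e + 2) = dQC G e := by
  refine LinearMap.ext fun C => ?_
  funext I J
  rw [dQC_apply, dQC_apply, ← add_assoc, dQL_add_two]

/-- A component of δC with n indices is built from components of C with n + 1 indices, so d_Q acts
on it with the sign of degree e + 1. In this convention the two differentials commute. -/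
lemma dQC_cD (G : GaugeCharge F) (e : ℕ) (C : Cochain F) :
    dQC G (e + 1) (cD F C) = cD F (dQC G e C) := by
  funext I J
  simp only [dQC_apply, cD_apply, map_add, map_smul, map_sum, dQL_d₁, dQL_d₂]
  have h1 : ∀ μ : Fin 4, (I ++ [μ]).length + J.length + e = I.length + J.length + (e + 1) := by
    intro μ; simp; omega
  have h2 : ∀ μ : Fin 4, I.length + (J ++ [μ]).length + e = I.length + J.length + (e + 1) := by
    intro μ; simp; omega
  simp only [h1, h2]

lemma anomaly_eq (G : GaugeCharge F) (C : Cochain F) :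
    anomaly G C = dQC G 0 C - Complex.I • cD F C := rfl

lemma neg_one_smul_op {E : Type} [NormedAddCommGroup E] [NormedSpace ℝ E] (A : OpMap F E) :
    (-1 : ℂ) • A = -A := neg_one_smul ℂ A

/-! ### Multivectors -/

lemma IsMultivector.add {V : Type} [AddCommGroup V] {X Y : Idx → V}
    (hX : IsMultivector X) (hY : IsMultivector Y) :
    IsMultivector (X + Y) :=
  ⟨fun μ ν => by rw [Pi.add_apply, Pi.add_apply, hX.1, hY.1, neg_add],
    fun I hI => by rw [Pi.add_apply, hX.2 I hI, hY.2 I hI, add_zero]⟩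

lemma IsMultivector.smul {V : Type} [AddCommGroup V] [Module ℂ V] {X : Idx → V} (c : ℂ)
    (hX : IsMultivector X) :
    IsMultivector (c • X) :=
  ⟨fun μ ν => by rw [Pi.smul_apply, Pi.smul_apply, hX.1, smul_neg],
    fun I hI => by rw [Pi.smul_apply, hX.2 I hI, smul_zero]⟩

/-- The components with two further indices are antisymmetric in these. -/
lemma IsMultivector.append_antisymm {V : Type} [AddCommGroup V] {X : Idx → V}
    (hX : IsMultivector X) (I : Idx) (μ ν : Fin 4) : X (I ++ [μ] ++ [ν]) = -X (I ++ [ν] ++ [μ]) := by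
  cases I with
  | nil => exact hX.1 μ ν
  | cons a I => rw [hX.2 _ (by simp), hX.2 _ (by simp), neg_zero]

lemma sum_antisymm_eq_zero {V : Type} [AddCommGroup V] [Module ℂ V] {f : Fin 4 → Fin 4 → V}
    (h : ∀ μ ν, f μ ν = -f ν μ) : ∑ μ, ∑ ν, f μ ν = 0 := by
  have h1 : ∑ μ, ∑ ν, f μ ν = -∑ μ, ∑ ν, f μ ν := by
    conv_lhs => rw [Finset.sum_comm]
    rw [← Finset.sum_neg_distrib]
    refine Finset.sum_congr rfl fun μ _ => ?_
    rw [← Finset.sum_neg_distrib]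
    exact Finset.sum_congr rfl fun ν _ => h ν μ
  have h2 : (2 : ℂ) • ∑ μ, ∑ ν, f μ ν = 0 := by
    rw [two_smul]
    nth_rewrite 1 [h1]
    exact neg_add_cancel _
  exact (smul_eq_zero.1 h2).resolve_left two_ne_zero

/-! ### Cochains -/

lemma IsCochain.symm {C : Cochain F} (h : IsCochain C) (I J : Idx) :
    C I J = (-1 : ℂ) ^ (I.length * J.length) • sw (C J I) := h.2.2 I J

lemma IsCochain.add {C C' : Cochain F} (h : IsCochain C) (h' : IsCochain C') :
    IsCochain (C + C') := by
  refine ⟨fun J => (h.1 J).add (h'.1 J), fun I => (h.2.1 I).add (h'.2.1 I), fun I J => ?_⟩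
  rw [sw_eq, Pi.add_apply, Pi.add_apply, Pi.add_apply, Pi.add_apply, h.symm I J, h'.symm I J,
    map_add, smul_add]

lemma IsCochain.smul {C : Cochain F} (c : ℂ) (h : IsCochain C) : IsCochain (c • C) := by
  refine ⟨fun J => (h.1 J).smul c, fun I => (h.2.1 I).smul c, fun I J => ?_⟩
  rw [sw_eq, Pi.smul_apply, Pi.smul_apply, Pi.smul_apply, Pi.smul_apply, h.symm I J, map_smul,
    smul_comm]

lemma IsCochain.sub {C C' : Cochain F} (h : IsCochain C) (h' : IsCochain C') :
    IsCochain (C - C') := by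
  rw [sub_eq_add_neg, ← neg_one_smul ℂ C']
  exact h.add (h'.smul _)

/-- Antisymmetry in the second group of indices follows from the graded symmetry. -/
lemma isCochain_of_left {C : Cochain F} (h : ∀ J, IsMultivector fun I => C I J)
    (hs : ∀ I J, C I J = (-1 : ℂ) ^ (I.length * J.length) • sw (C J I)) : IsCochain C := by
  refine ⟨h, fun I => ⟨fun μ ν => ?_, fun J hJ => ?_⟩, hs⟩
  · have h1 : C [μ, ν] I = -C [ν, μ] I := (h I).1 μ ν
    rw [hs I [μ, ν], h1, hs I [ν, μ], map_neg, smul_neg]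
    rfl
  · have h1 : C J I = 0 := (h I).2 J hJ
    rw [hs I J, h1, map_zero, smul_zero]

lemma IsCochain.dQC (G : GaugeCharge F) (e : ℕ) {C : Cochain F} (h : IsCochain C) :
    IsCochain (dQC G e C) := by
  refine isCochain_of_left (fun J => ⟨fun μ ν => ?_, fun I hI => ?_⟩) fun I J => ?_
  · have h1 : C [μ, ν] J = -C [ν, μ] J := (h.1 J).1 μ ν
    simp only [dQC_apply, h1, map_neg]
    rfl
  · have h1 : C I J = 0 := (h.1 J).2 I hI
    simp only [dQC_apply, h1, map_zero]
  · rw [dQC_apply, dQC_apply, h.symm I J, map_smul, dQL_sw, add_comm J.length]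

/-- The exchange maps the ∂₁-terms of (I, J) to the ∂₂-terms of (J, I); the sign (-1)^|I| in δ is
what makes this compatible with the graded symmetry. -/
lemma IsCochain.cD {C : Cochain F} (h : IsCochain C) : IsCochain (cD F C) := by
  refine isCochain_of_left (fun J => ⟨fun μ ν => ?_, fun I hI => ?_⟩) fun I J => ?_
  · simp only [cD_apply]
    have h1 : ∀ (a b ρ : Fin 4), C ([a, b] ++ [ρ]) J = 0 := fun a b ρ => (h.1 J).2 _ (by simp)
    have h2 : ∀ ρ, C [μ, ν] (J ++ [ρ]) = -C [ν, μ] (J ++ [ρ]) := fun ρ => (h.1 _).1 μ ν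
    simp only [h1, h2, map_zero, map_neg, Finset.sum_neg_distrib, Finset.sum_const_zero, zero_add,
      smul_neg]
    rfl
  · simp only [cD_apply]
    have h1 : ∀ ρ : Fin 4, C (I ++ [ρ]) J = 0 := fun ρ => (h.1 J).2 _ (by simp; omega)
    have h2 : ∀ ρ : Fin 4, C I (J ++ [ρ]) = 0 := fun ρ => (h.1 _).2 I hI
    simp only [h1, h2, map_zero, Finset.sum_const_zero, smul_zero, add_zero]
  · have h1 : ∀ ρ : Fin 4, C (I ++ [ρ]) J
        = (-1 : ℂ) ^ (I.length * J.length) • (-1 : ℂ) ^ J.length • sw (C J (I ++ [ρ])) := by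
      intro ρ
      rw [h.symm, smul_smul, ← pow_add]
      congr 2
      simp; ring
    have h2 : ∀ ρ : Fin 4, (-1 : ℂ) ^ I.length • C I (J ++ [ρ])
        = (-1 : ℂ) ^ (I.length * J.length) • sw (C (J ++ [ρ]) I) := by
      intro ρ
      rw [h.symm, smul_smul, ← pow_add]
      have : I.length + I.length * (J ++ [ρ]).length = I.length * J.length + 2 * I.length := by
        simp; ring
      rw [this, pow_add, pow_mul]
      norm_num
    rw [cD_apply, cD_apply]
    simp only [map_add, map_smul, map_sum, sw_d₁, sw_d₂]
    rw [Finset.smul_sum (r := (-1 : ℂ) ^ I.length)]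
    simp only [← map_smul (d₂ _), h1, h2, smul_add, Finset.smul_sum]
    simp only [map_smul]
    exact add_comm _ _

/-- The ∂₁∂₁ and ∂₂∂₂ terms vanish by antisymmetry of the indices. The mixed terms cancel because I
has gained an index in one of them, which flips the sign. -/
lemma cD_cD {C : Cochain F} (h : IsCochain C) : cD F (cD F C) = 0 := by
  funext I J
  have h1 : ∑ μ, ∑ ν, d₁ μ (d₁ ν (C (I ++ [μ] ++ [ν]) J)) = 0 :=
    sum_antisymm_eq_zero fun μ ν => by
      rw [(h.1 J).append_antisymm I μ ν, d₁_d₁, map_neg, map_neg]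
  have h2 : ∑ μ, ∑ ν, d₂ μ (d₂ ν (C I (J ++ [μ] ++ [ν]))) = 0 :=
    sum_antisymm_eq_zero fun μ ν => by
      rw [(h.2.1 I).append_antisymm J μ ν, d₂_d₂, map_neg, map_neg]
  have h3 : ∑ μ, ∑ ν, d₁ μ (d₂ ν (C (I ++ [μ]) (J ++ [ν])))
      = ∑ μ, ∑ ν, d₂ μ (d₁ ν (C (I ++ [ν]) (J ++ [μ]))) := by
    rw [Finset.sum_comm]
    simp only [d₁_d₂]
  have h4 : ∀ μ : Fin 4, (-1 : ℂ) ^ (I ++ [μ]).length = -(-1 : ℂ) ^ I.length := by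
    intro μ
    rw [List.length_append, List.length_singleton, pow_succ]
    ring
  simp only [cD_apply, map_add, map_smul, map_sum, Finset.sum_add_distrib, ← Finset.smul_sum,
    h1, h2, h3, h4, smul_zero, zero_add, add_zero]
  simp only [Pi.zero_apply, neg_smul, neg_add_cancel]

/-- The differential `d_Q + c δ` on cochains of degree `e` is followed by `d_Q - c δ`. -/
lemma gauge_differential_sq (G : GaugeCharge F) (e : ℕ) (c : ℂ) {R : Cochain F}
    (h : IsCochain R) :
    dQC G (e + 1) (dQC G e R + c • cD F R) - c • cD F (dQC G e R + c • cD F R) = 0 := by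
  rw [map_add, map_add, map_smul, map_smul, dQC_dQC, dQC_cD, cD_cD h]
  simp

/-! ### Components of the differential -/

lemma cD_nil (C : Cochain F) :
    cD F C [] [] = ∑ μ, d₁ μ (C [μ] []) + ∑ μ, d₂ μ (C [] [μ]) := by
  simp [cD_apply]

lemma cD_one (C : Cochain F) (μ : Fin 4) :
    cD F C [μ] [] = ∑ ν, d₁ ν (C [μ, ν] []) - ∑ ν, d₂ ν (C [μ] [ν]) := by
  simp [cD_apply, sub_eq_add_neg, neg_one_smul_op]

lemma cD_two {C : Cochain F} (h : IsCochain C) (μ ν : Fin 4) :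
    cD F C [μ, ν] [] = ∑ ρ, d₂ ρ (C [μ, ν] [ρ]) := by
  have h1 : ∀ ρ, C [μ, ν, ρ] [] = 0 := fun ρ => (h.1 []).2 _ (by simp)
  simp [cD_apply, h1]

lemma cD_one_one (C : Cochain F) (μ ν : Fin 4) :
    cD F C [μ] [ν] = ∑ ρ, d₁ ρ (C [μ, ρ] [ν]) - ∑ ρ, d₂ ρ (C [μ] [ν, ρ]) := by
  simp [cD_apply, sub_eq_add_neg, neg_one_smul_op]

lemma cD_two_one {C : Cochain F} (h : IsCochain C) (μ ν ρ : Fin 4) :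
    cD F C [μ, ν] [ρ] = ∑ σ, d₂ σ (C [μ, ν] [ρ, σ]) := by
  have h1 : ∀ σ, C [μ, ν, σ] [ρ] = 0 := fun σ => (h.1 [ρ]).2 _ (by simp)
  simp [cD_apply, h1]

lemma cD_two_two {C : Cochain F} (h : IsCochain C) (μ ν ρ σ : Fin 4) :
    cD F C [μ, ν] [ρ, σ] = 0 := by
  have h1 : ∀ a, C [μ, ν, a] [ρ, σ] = 0 := fun a => (h.1 _).2 _ (by simp)
  have h2 : ∀ a, C [μ, ν] [ρ, σ, a] = 0 := fun a => (h.2.1 _).2 _ (by simp)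
  simp [cD_apply, h1, h2]

lemma IsCochain.nil_one {C : Cochain F} (h : IsCochain C) (μ : Fin 4) :
    C [] [μ] = sw (C [μ] []) := by simpa using h.symm [] [μ]

lemma IsCochain.one_one {C : Cochain F} (h : IsCochain C) (μ ν : Fin 4) :
    C [μ] [ν] = -sw (C [ν] [μ]) := by
  simpa [neg_one_smul_op] using h.symm [μ] [ν]

lemma IsCochain.one_two {C : Cochain F} (h : IsCochain C) (μ ν ρ : Fin 4) :
    C [ρ] [μ, ν] = sw (C [μ, ν] [ρ]) := by simpa using h.symm [ρ] [μ, ν]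

/-! ### Cochains in a single degree -/

/-- The number of indices of a component. -/
def lvl (I J : Idx) : ℕ := I.length + J.length

/-- The components of `C` of degree different from `n` vanish. -/
def SupportedAt (n : ℕ) (C : Cochain F) : Prop := ∀ I J, lvl I J ≠ n → C I J = 0

lemma SupportedAt.cD {n : ℕ} {C : Cochain F} (h : SupportedAt (n + 1) C) :
    SupportedAt n (cD F C) := by
  intro I J hIJ
  have h1 : ∀ μ : Fin 4, C (I ++ [μ]) J = 0 := fun μ => h _ _ (by
    simp only [lvl, List.length_append, List.length_singleton] at hIJ ⊢; omega)
  have h2 : ∀ μ : Fin 4, C I (J ++ [μ]) = 0 := fun μ => h _ _ (by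
    simp only [lvl, List.length_append, List.length_singleton] at hIJ ⊢; omega)
  simp [cD_apply, h1, h2]

lemma SupportedAt.add {n : ℕ} {C C' : Cochain F} (h : SupportedAt n C) (h' : SupportedAt n C') :
    SupportedAt n (C + C') := fun I J hIJ => by
  rw [Pi.add_apply, Pi.add_apply, h I J hIJ, h' I J hIJ, add_zero]

/-- The cochain in degree one with components `r^μ`. -/
def cochain₁ (r : Fin 4 → Op₂ F) : Cochain F
  | [μ], [] => r μ
  | [], [μ] => sw (r μ)
  | _, _ => 0

/-- The cochain in degree two with given components. -/
def cochain₂ (r : Fin 4 → Fin 4 → Op₂ F) (s : Fin 4 → Fin 4 → Op₂ F) : Cochain F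
  | [μ, ν], [] => r μ ν
  | [], [μ, ν] => sw (r μ ν)
  | [μ], [ν] => s μ ν
  | _, _ => 0

/-- The cochain in degree three with given components. -/
def cochain₃ (r : Fin 4 → Fin 4 → Fin 4 → Op₂ F) : Cochain F
  | [μ, ν], [ρ] => r μ ν ρ
  | [ρ], [μ, ν] => sw (r μ ν ρ)
  | _, _ => 0

/-- The cochain in degree four with given components. -/
def cochain₄ (r : Fin 4 → Fin 4 → Fin 4 → Fin 4 → Op₂ F) : Cochain F
  | [μ, ν], [ρ, σ] => r μ ν ρ σ
  | _, _ => 0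

lemma isCochain₁ (r : Fin 4 → Op₂ F) : IsCochain (cochain₁ r) := by
  refine isCochain_of_left (fun J => ⟨fun μ ν => ?_, fun I hI => ?_⟩) fun I J => ?_
  · rcases J with _ | ⟨a, _ | ⟨b, J⟩⟩ <;> simp [cochain₁]
  · rcases I with _ | ⟨a, _ | ⟨b, I⟩⟩
    · simp at hI
    · simp at hI
    · rcases J with _ | ⟨c, _ | ⟨d, J⟩⟩ <;> simp [cochain₁]
  · rcases I with _ | ⟨a, _ | ⟨b, I⟩⟩ <;> rcases J with _ | ⟨c, _ | ⟨d, J⟩⟩ <;>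
      simp [cochain₁, sw_sw]

lemma isCochain₂ {r s : Fin 4 → Fin 4 → Op₂ F} (hr : ∀ μ ν, r μ ν = -r ν μ)
    (hs : ∀ μ ν, s μ ν = -sw (s ν μ)) : IsCochain (cochain₂ r s) := by
  refine isCochain_of_left (fun J => ⟨fun μ ν => ?_, fun I hI => ?_⟩) fun I J => ?_
  · rcases J with _ | ⟨a, _ | ⟨b, J⟩⟩ <;> simp [cochain₂, hr μ ν]
  · rcases I with _ | ⟨a, _ | ⟨b, _ | ⟨c, I⟩⟩⟩
    · simp at hI
    · simp at hI
    · simp at hI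
    · rcases J with _ | ⟨c, _ | ⟨d, J⟩⟩ <;> simp [cochain₂]
  · rcases I with _ | ⟨a, _ | ⟨b, _ | ⟨c, I⟩⟩⟩ <;>
    rcases J with _ | ⟨d, _ | ⟨f, _ | ⟨g, J⟩⟩⟩ <;>
    simp [cochain₂, sw_sw]
    rw [neg_one_smul_op]
    exact hs _ _

lemma isCochain₃ {r : Fin 4 → Fin 4 → Fin 4 → Op₂ F} (hr : ∀ μ ν ρ, r μ ν ρ = -r ν μ ρ) :
    IsCochain (cochain₃ r) := by
  refine isCochain_of_left (fun J => ⟨fun μ ν => ?_, fun I hI => ?_⟩) fun I J => ?_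
  · rcases J with _ | ⟨a, _ | ⟨b, J⟩⟩ <;> simp [cochain₃, hr μ ν]
  · rcases I with _ | ⟨a, _ | ⟨b, _ | ⟨c, I⟩⟩⟩
    · simp at hI
    · simp at hI
    · simp at hI
    · rcases J with _ | ⟨c, _ | ⟨d, J⟩⟩ <;> simp [cochain₃]
  · rcases I with _ | ⟨a, _ | ⟨b, _ | ⟨c, I⟩⟩⟩ <;>
    rcases J with _ | ⟨d, _ | ⟨f, _ | ⟨g, J⟩⟩⟩ <;>
    simp [cochain₃, sw_sw]

lemma isCochain₄ {r : Fin 4 → Fin 4 → Fin 4 → Fin 4 → Op₂ F}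
    (hr : ∀ μ ν ρ σ, r μ ν ρ σ = -r ν μ ρ σ) (hs : ∀ μ ν ρ σ, r μ ν ρ σ = sw (r ρ σ μ ν)) :
    IsCochain (cochain₄ r) := by
  refine isCochain_of_left (fun J => ⟨fun μ ν => ?_, fun I hI => ?_⟩) fun I J => ?_
  · rcases J with _ | ⟨a, _ | ⟨b, _ | ⟨c, J⟩⟩⟩ <;> simp [cochain₄, hr μ ν]
  · rcases I with _ | ⟨a, _ | ⟨b, _ | ⟨c, I⟩⟩⟩
    · simp at hI
    · simp at hI
    · simp at hI
    · rcases J with _ | ⟨c, _ | ⟨d, J⟩⟩ <;> simp [cochain₄]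
  · rcases I with _ | ⟨a, _ | ⟨b, _ | ⟨c, I⟩⟩⟩ <;>
    rcases J with _ | ⟨d, _ | ⟨f, _ | ⟨g, J⟩⟩⟩ <;>
    simp [cochain₄]
    rw [show (-1 : ℂ) ^ 4 = 1 by norm_num, one_smul]
    exact hs _ _ _ _

/-- Quasi-local cochains. -/
def IsQLCochain (g : ℤ) (d : ℚ) (C : Cochain F) : Prop := ∀ I J, C I J ∈ ql F (lvl I J + g) d

lemma IsQLCochain.add {g : ℤ} {d : ℚ} {C C' : Cochain F} (h : IsQLCochain g d C)
    (h' : IsQLCochain g d C') : IsQLCochain g d (C + C') := fun I J => add_mem (h I J) (h' I J)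

lemma IsQLCochain.smul {g : ℤ} {d : ℚ} {C : Cochain F} (c : ℂ) (h : IsQLCochain g d C) :
    IsQLCochain g d (c • C) := fun I J => Submodule.smul_mem _ c (h I J)

lemma IsQLCochain.sub {g : ℤ} {d : ℚ} {C C' : Cochain F} (h : IsQLCochain g d C)
    (h' : IsQLCochain g d C') : IsQLCochain g d (C - C') := fun I J => sub_mem (h I J) (h' I J)

lemma IsQLCochain.cD {g g' : ℤ} {d d' : ℚ} {C : Cochain F} (h : IsQLCochain g d C)
    (hg : g' = g + 1) (hd : d' = d + 1) : IsQLCochain g' d' (cD F C) := by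
  intro I J
  subst hg hd
  have h1 : ∀ μ : Fin 4, C (I ++ [μ]) J ∈ ql F (lvl I J + (g + 1)) d := fun μ => by
    convert! h (I ++ [μ]) J using 2
    simp only [lvl, List.length_append, List.length_singleton]
    push_cast; ring
  have h2 : ∀ μ : Fin 4, C I (J ++ [μ]) ∈ ql F (lvl I J + (g + 1)) d := fun μ => by
    convert! h I (J ++ [μ]) using 2
    simp only [lvl, List.length_append, List.length_singleton]
    push_cast; ring
  rw [cD_apply]
  exact add_mem (Submodule.sum_mem _ fun μ _ => d₁_mem_ql (h1 μ) μ)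
    (Submodule.smul_mem _ _ (Submodule.sum_mem _ fun μ _ => d₂_mem_ql (h2 μ) μ))

lemma IsQLCochain.dQC (G : GaugeCharge F) {e : ℕ} {g g' : ℤ} {d d' : ℚ} {C : Cochain F}
    (h : IsQLCochain g d C) (he : (e : ZMod 2) = (g : ZMod 2)) (hg : g' = g + 1)
    (hd : d' = d + 1) : IsQLCochain g' d' (dQC G e C) := by
  intro I J
  subst hg hd
  rw [← add_assoc]
  refine dQL_mem_ql G (h I J) ?_
  push_cast [lvl]
  rw [he]

/-! ### Leading parts of derivatives -/

lemma d₁_mem_ordLe {n : ℕ} {A : Op₂ F} (h : A ∈ ordLe F n) (μ : Fin 4) :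
    d₁ μ A ∈ ordLe F (n + 1) := by
  rw [d₁_eq]
  exact sub_mem (Submodule.smul_mem _ _ (ordLe_le_succ n (dT_mem_ordLe h μ))) (dR_mem_ordLe h μ)

lemma d₂_mem_ordLe {n : ℕ} {A : Op₂ F} (h : A ∈ ordLe F n) (μ : Fin 4) :
    d₂ μ A ∈ ordLe F (n + 1) := by
  rw [d₂_eq]
  exact add_mem (Submodule.smul_mem _ _ (ordLe_le_succ n (dT_mem_ordLe h μ))) (dR_mem_ordLe h μ)

/-- To leading order `d₁` is -`dR` and `d₂` is +`dR`, since total derivatives do not raise the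
order. -/
lemma d₁_top {n : ℕ} {A B : Op₂ F} (hA : A ∈ ordLe F (n + 1)) (h : A - B ∈ ordLe F n)
    (μ : Fin 4) : d₁ μ A + dR μ B ∈ ordLe F (n + 1) := by
  have e : d₁ μ A + dR μ B = (2⁻¹ : ℂ) • dT μ A - dR μ (A - B) := by
    rw [d₁_eq, map_sub]; module
  rw [e]
  exact sub_mem (Submodule.smul_mem _ _ (dT_mem_ordLe hA μ)) (dR_mem_ordLe h μ)

lemma d₂_top {n : ℕ} {A B : Op₂ F} (hA : A ∈ ordLe F (n + 1)) (h : A - B ∈ ordLe F n)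
    (μ : Fin 4) : d₂ μ A - dR μ B ∈ ordLe F (n + 1) := by
  have e : d₂ μ A - dR μ B = (2⁻¹ : ℂ) • dT μ A + dR μ (A - B) := by
    rw [d₂_eq, map_sub]; module
  rw [e]
  exact add_mem (Submodule.smul_mem _ _ (dT_mem_ordLe hA μ)) (dR_mem_ordLe h μ)

lemma sw_top {n : ℕ} {A B : Op₂ F} (h : A - B ∈ ordLe F n) : sw A - sw B ∈ ordLe F n := by
  rw [← map_sub]; exact sw_mem_ordLe h

lemma sum_dR_mem_qlPure {g : ℤ} {k : ℕ} {d : ℚ} {T : Fin 4 → Op₂ F}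
    (h : ∀ μ, T μ ∈ qlPure F g k d) : ∑ μ, dR μ (T μ) ∈ qlPure F g (k + 1) (d + 1) :=
  Submodule.sum_mem _ fun μ _ => dR_mem_qlPure (h μ) μ

/-- Division by the derivatives with respect to the second variable. -/
lemma exists_division {g : ℤ} {d : ℚ} {A : Op₂ F} (h : A ∈ ql F g d) :
    ∃ B : Fin 4 → Op₂ F, (∀ μ, B μ ∈ ql F g (d - 1)) ∧ A - ∑ μ, d₂ μ (B μ) ∈ ordLe F 0 := by
  obtain ⟨n, hn⟩ := exists_ordLe h
  induction n generalizing A with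
  | zero => exact ⟨0, fun _ => zero_mem _, by simpa using hn⟩
  | succ n ih =>
    obtain ⟨T, hT, hAT⟩ := exists_top h hn
    -- Chosen by Euler's identity: Σ `dR` (z T) = -(n + 1) T, so Σ `d₂` (c z T) equals T up to total
    -- derivatives, which have lower order.
    set c : ℂ := -((n + 1 : ℕ) : ℂ)⁻¹ with hc
    have hb : ∀ μ, c • mZ μ T ∈ ql F g (d - 1) := fun μ =>
      Submodule.smul_mem _ _ (qlPure_le_ql g _ n (mZ_mem_qlPure hT μ))
    have hb' : ∀ μ, mZ μ T ∈ ordLe F n := fun μ => qlPure_le_ordLe g n _ (mZ_mem_qlPure hT μ)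
    have hne : ((n + 1 : ℕ) : ℂ) ≠ 0 := Nat.cast_ne_zero.2 (Nat.succ_ne_zero n)
    have hcn : c * ((n + 1 : ℕ) : ℂ) = -1 := by rw [hc, neg_mul, inv_mul_cancel₀ hne]
    have e : A - ∑ μ, d₂ μ (c • mZ μ T) = (A - T) - (c * 2⁻¹) • ∑ μ, dT μ (mZ μ T) := by
      have h1 : ∑ μ, d₂ μ (c • mZ μ T) = (c * 2⁻¹) • ∑ μ, dT μ (mZ μ T) + T := by
        simp only [map_smul, d₂_eq, smul_add, Finset.sum_add_distrib, ← Finset.smul_sum,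
          sum_dR_mZ hT, smul_smul]
        rw [smul_neg, smul_smul, hcn]
        module
      rw [h1]; abel
    have hA' : A - ∑ μ, d₂ μ (c • mZ μ T) ∈ ql F g d := by
      refine sub_mem h (Submodule.sum_mem _ fun μ _ => ?_)
      have := d₂_mem_ql (hb μ) μ
      rwa [sub_add_cancel] at this
    obtain ⟨B, hB, hAB⟩ := ih hA' (by
      rw [e]
      exact sub_mem hAT (Submodule.smul_mem _ _
        (Submodule.sum_mem _ fun μ _ => dT_mem_ordLe (hb' μ) μ)))
    refine ⟨fun μ => c • mZ μ T + B μ, fun μ => add_mem (hb μ) (hB μ), ?_⟩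
    simp only [map_add, Finset.sum_add_distrib]
    rwa [← sub_sub]

/-! ### Corrections of a given degree -/

/-- A quasi-local cochain in degree `n + 1` whose differential is added to a cochain of degree
`g` and dimension `d` in order to lower its order in degree `n`. -/
structure Correction (g : ℤ) (d : ℚ) (n : ℕ) (R : Cochain F) : Prop where
  cochain : IsCochain R
  mem : ∀ I J, R I J ∈ ql F (n + g) (d - 1)
  supp : SupportedAt (n + 1) R

lemma Correction.zero (g : ℤ) (d : ℚ) (n : ℕ) : Correction g d n (0 : Cochain F) where
  cochain := isCochain_of_left (fun _ => ⟨fun _ _ => by simp, fun _ _ => rfl⟩) fun _ _ => by simp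
  mem _ _ := zero_mem _
  supp _ _ _ := rfl

lemma Correction.add {g : ℤ} {d : ℚ} {n : ℕ} {R R' : Cochain F} (h : Correction g d n R)
    (h' : Correction g d n R') : Correction g d n (R + R') where
  cochain := h.cochain.add h'.cochain
  mem I J := add_mem (h.mem I J) (h'.mem I J)
  supp := h.supp.add h'.supp

lemma Correction.isQLCochain {g : ℤ} {d : ℚ} {n : ℕ} {R : Cochain F} (h : Correction g d n R) :
    IsQLCochain (g - 1) (d - 1) R := by
  intro I J
  by_cases hIJ : lvl I J = n + 1
  · have := h.mem I J
    rwa [show (n : ℤ) + g = (lvl I J : ℤ) + (g - 1) by rw [hIJ]; push_cast; ring] at this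
  · rw [h.supp I J hIJ]
    exact zero_mem _

lemma Correction.isQLCochain_cD {g : ℤ} {d : ℚ} {n : ℕ} {R : Cochain F}
    (h : Correction g d n R) : IsQLCochain g d (cD F R) :=
  h.isQLCochain.cD (by ring) (by ring)

lemma Correction.cD_add {g : ℤ} {d : ℚ} {n : ℕ} {R : Cochain F}
    (h : Correction g d n R) (C : Cochain F) : cD F (C + cD F R) = cD F C := by
  rw [map_add, cD_cD h.cochain, add_zero]

/-! ### Reduction of membership statements to representative components -/

section components

variable {S : Submodule ℂ (Op₂ F)}

lemma cochain₁_mem (hsw : ∀ A ∈ S, sw A ∈ S) {r : Fin 4 → Op₂ F} (hr : ∀ μ, r μ ∈ S)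
    (I J : Idx) : cochain₁ r I J ∈ S := by
  unfold cochain₁
  split
  exacts [hr _, hsw _ (hr _), zero_mem _]

lemma cochain₂_mem (hsw : ∀ A ∈ S, sw A ∈ S) {r s : Fin 4 → Fin 4 → Op₂ F}
    (hr : ∀ μ ν, r μ ν ∈ S) (hs : ∀ μ ν, s μ ν ∈ S) (I J : Idx) : cochain₂ r s I J ∈ S := by
  unfold cochain₂
  split
  exacts [hr _ _, hsw _ (hr _ _), hs _ _, zero_mem _]

lemma cochain₃_mem (hsw : ∀ A ∈ S, sw A ∈ S) {r : Fin 4 → Fin 4 → Fin 4 → Op₂ F}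
    (hr : ∀ μ ν ρ, r μ ν ρ ∈ S) (I J : Idx) : cochain₃ r I J ∈ S := by
  unfold cochain₃
  split
  exacts [hr _ _ _, hsw _ (hr _ _ _), zero_mem _]

lemma cochain₄_mem {r : Fin 4 → Fin 4 → Fin 4 → Fin 4 → Op₂ F}
    (hr : ∀ μ ν ρ σ, r μ ν ρ σ ∈ S) (I J : Idx) : cochain₄ r I J ∈ S := by
  unfold cochain₄
  split
  exacts [hr _ _ _ _, zero_mem _]

lemma supportedAt_cochain₁ (r : Fin 4 → Op₂ F) : SupportedAt 1 (cochain₁ r) := by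
  intro I J h
  unfold cochain₁
  split
  · simp [lvl] at h
  · simp [lvl] at h
  · rfl

lemma supportedAt_cochain₂ (r s : Fin 4 → Fin 4 → Op₂ F) : SupportedAt 2 (cochain₂ r s) := by
  intro I J h
  unfold cochain₂
  split
  · simp [lvl] at h
  · simp [lvl] at h
  · simp [lvl] at h
  · rfl

lemma supportedAt_cochain₃ (r : Fin 4 → Fin 4 → Fin 4 → Op₂ F) :
    SupportedAt 3 (cochain₃ r) := by
  intro I J h
  unfold cochain₃
  split
  · simp [lvl] at h
  · simp [lvl] at h
  · rfl

lemma supportedAt_cochain₄ (r : Fin 4 → Fin 4 → Fin 4 → Fin 4 → Op₂ F) :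
    SupportedAt 4 (cochain₄ r) := by
  intro I J h
  unfold cochain₄
  split
  · simp [lvl] at h
  · rfl

variable {X : Cochain F}

lemma mem_of_lvl_zero (h : X [] [] ∈ S) {I J : Idx} (hIJ : lvl I J = 0) : X I J ∈ S := by
  rcases I with _ | ⟨a, I⟩ <;> rcases J with _ | ⟨b, J⟩ <;> simp [lvl] at hIJ
  exact h

/-- The graded symmetry leaves one component to check out of (I, J) and (J, I); the same reduction
serves degrees two and three. -/
lemma mem_of_lvl_one (hX : IsCochain X) (hsw : ∀ A ∈ S, sw A ∈ S) (h : ∀ μ, X [μ] [] ∈ S)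
    {I J : Idx} (hIJ : lvl I J = 1) : X I J ∈ S := by
  rcases I with _ | ⟨a, _ | ⟨a', I⟩⟩ <;> rcases J with _ | ⟨b, _ | ⟨b', J⟩⟩ <;>
    simp [lvl] at hIJ <;> try omega
  · rw [hX.nil_one]; exact hsw _ (h b)
  · exact h a

lemma mem_of_lvl_two (hX : IsCochain X) (hsw : ∀ A ∈ S, sw A ∈ S) (h : ∀ μ ν, X [μ, ν] [] ∈ S)
    (h' : ∀ μ ν, X [μ] [ν] ∈ S) {I J : Idx} (hIJ : lvl I J = 2) : X I J ∈ S := by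
  rcases I with _ | ⟨a, _ | ⟨a', _ | ⟨a'', I⟩⟩⟩ <;>
    rcases J with _ | ⟨b, _ | ⟨b', _ | ⟨b'', J⟩⟩⟩ <;>
    simp [lvl] at hIJ <;> try omega
  · have := hX.symm [] [b, b']
    simp only [List.length_nil, zero_mul, pow_zero, one_smul] at this
    rw [this]; exact hsw _ (h b b')
  · exact h' a b
  · exact h a a'

lemma mem_of_lvl_three (hX : IsCochain X) (hsw : ∀ A ∈ S, sw A ∈ S)
    (h : ∀ μ ν ρ, X [μ, ν] [ρ] ∈ S) {I J : Idx} (hIJ : lvl I J = 3) : X I J ∈ S := by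
  rcases I with _ | ⟨a, _ | ⟨a', _ | ⟨a'', I⟩⟩⟩
  · rw [(hX.2.1 []).2 J (by simp [lvl] at hIJ; omega)]; exact zero_mem _
  · rcases J with _ | ⟨b, _ | ⟨b', _ | ⟨b'', J⟩⟩⟩ <;> simp [lvl] at hIJ <;> try omega
    rw [hX.one_two]; exact hsw _ (h b b' a)
  · rcases J with _ | ⟨b, _ | ⟨b', J⟩⟩ <;> simp [lvl] at hIJ <;> try omega
    exact h a a' b
  · have h0 : X (a :: a' :: a'' :: I) J = 0 := (hX.1 J).2 _ (by simp)
    rw [h0]; exact zero_mem _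

end components

lemma isQL_component {g : ℤ} {d : ℚ} {C : Cochain F} (h : IsQLCochain g d C) {I J : Idx} {n : ℕ}
    (hIJ : lvl I J = n) : C I J ∈ ql F (n + g) d := hIJ ▸ h I J

/-! ### Removing derivatives of `δ`: degree zero -/

section stages

variable {g : ℤ} {d : ℚ} {C : Cochain F}

/-- No constraint is needed: division by `d₂` leaves a derivative-free remainder. The component is
exchange symmetric, so the average of the division and its exchange is again a division, and δ of a
cochain in degree one has this averaged shape; hence the factor -1/2. -/
lemma exists_correction_zero (hC : IsCochain C) (hq : IsQLCochain g d C) :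
    ∃ R, Correction g d 0 R ∧ ∀ I J, lvl I J = 0 → (C + cD F R) I J ∈ ordLe F 0 := by
  obtain ⟨B, hB, hAB⟩ := exists_division (isQL_component hq (I := []) (J := []) (n := 0) rfl)
  set A := C [] [] with hA
  have hsw : sw A = A := by simpa using (hC.symm [] []).symm
  refine ⟨cochain₁ fun μ => (-2⁻¹ : ℂ) • sw (B μ), ⟨isCochain₁ _, ?_, supportedAt_cochain₁ _⟩, ?_⟩
  · exact cochain₁_mem (fun _ => sw_mem_ql) fun μ => Submodule.smul_mem _ _ (sw_mem_ql (hB μ))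
  · refine fun I J => mem_of_lvl_zero ?_
    have e : (C + cD F (cochain₁ fun μ => (-2⁻¹ : ℂ) • sw (B μ))) [] []
        = (2⁻¹ : ℂ) • (A - ∑ μ, d₂ μ (B μ)) + (2⁻¹ : ℂ) • sw (A - ∑ μ, d₂ μ (B μ)) := by
      rw [Pi.add_apply, Pi.add_apply, cD_nil, ← hA]
      simp only [cochain₁, map_smul, sw_sw, map_sub, hsw, map_sum, sw_d₂, ← Finset.smul_sum]
      module
    rw [e]
    exact add_mem (Submodule.smul_mem _ _ hAB) (Submodule.smul_mem _ _ (sw_mem_ordLe hAB))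

/-! ### Removing derivatives of `δ`: degree one -/

/-- Homotopy of Koszul type: the correction is the leading part T times a coordinate, split into an
antisymmetric family r for ([μν], ∅) and a graded symmetric family s for (μ; ν). To leading order δ
yields -Σ `dR` (r + s), which must cancel T. -/
lemma exists_correction_one_step (hC : IsCochain C) (hq : IsQLCochain g d C)
    (hZ : cD F C [] [] ∈ ordLe F 0) {N : ℕ} (hN : ∀ μ, C [μ] [] ∈ ordLe F (N + 1)) :
    ∃ R, Correction g d 1 R ∧ ∀ μ, (C + cD F R) [μ] [] ∈ ordLe F N := by
  choose T hT hCT using fun μ =>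
    exists_top (isQL_component hq (I := [μ]) (J := []) (n := 1) rfl) (hN μ)
  set ε : ℂ := (-1) ^ (N + 1) with hε
  have hε2 : ε * ε = 1 := by rw [hε, ← pow_add, ← two_mul, pow_mul]; norm_num
  have hswT : ∀ μ, sw (T μ) = ε • T μ := fun μ => sw_of_mem_qlPure (hT μ)
  set D := ∑ ν, dR ν (T ν) with hD
  have hDpure : (ε - 1) • D ∈ qlPure F ((1 : ℕ) + g) (N + 1 + 1) (d + 1) :=
    Submodule.smul_mem _ _ (sum_dR_mem_qlPure hT)
  -- The leading part of δC in degree zero is -D + εD. Hence the divergence D vanishes for ε = -1,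
  -- while for ε = 1 it is unconstrained but drops out below.
  have hD0 : (ε - 1) • D = 0 := by
    refine eq_zero_of_mem_ordLe hDpure ?_
    have e : (ε - 1) • D = cD F C [] [] - ∑ μ, (d₁ μ (C [μ] []) + dR μ (T μ))
        - ∑ μ, (d₂ μ (sw (C [μ] [])) - dR μ (sw (T μ))) := by
      rw [cD_nil]
      simp only [hC.nil_one, hswT, map_smul, Finset.sum_add_distrib, Finset.sum_sub_distrib,
        ← Finset.smul_sum, ← hD]
      module
    rw [e]
    refine sub_mem (sub_mem (ordLe_mono (Nat.zero_le _) hZ) (Submodule.sum_mem _ fun μ _ => ?_))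
      (Submodule.sum_mem _ fun μ _ => ?_)
    · exact d₁_top (hN μ) (hCT μ) μ
    · exact d₂_top (sw_mem_ordLe (hN μ)) (sw_top (hCT μ)) μ
  have hε' : ε = 1 ∨ ε = -1 := neg_one_pow_eq_or ℂ (N + 1)
  -- Eigenvalue of the homotopy on T: Euler's identity contributes -2(N + 1), and commuting z_μ past
  -- the divergence in the mixed terms contributes ε - 1.
  set b : ℂ := ε - 1 - 2 * ((N + 1 : ℕ) : ℂ) with hb
  have hb0 : b ≠ 0 := by
    rcases hε' with h | h <;> rw [hb, h]
    · have : ((2 * (N + 1) : ℕ) : ℂ) ≠ 0 := Nat.cast_ne_zero.2 (by omega)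
      push_cast at this ⊢
      intro h0; apply this; linear_combination -h0
    · have : ((2 * (N + 2) : ℕ) : ℂ) ≠ 0 := Nat.cast_ne_zero.2 (by omega)
      push_cast at this ⊢
      intro h0; apply this; linear_combination -h0
  set r : Fin 4 → Fin 4 → Op₂ F := fun μ ν => b⁻¹ • (mZ ν (T μ) - mZ μ (T ν)) with hr
  -- The second term is dictated by the graded symmetry, since the exchange multiplies z T by -ε.
  set s : Fin 4 → Fin 4 → Op₂ F := fun μ ν => b⁻¹ • (mZ ν (T μ) + ε • mZ μ (T ν)) with hs
  have hmZ : ∀ μ ν, mZ μ (T ν) ∈ qlPure F ((1 : ℕ) + g) N (d - 1) :=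
    fun μ ν => mZ_mem_qlPure (hT ν) μ
  have hr_anti : ∀ μ ν, r μ ν = -r ν μ := fun μ ν => by simp only [hr]; module
  have hs_symm : ∀ μ ν, s μ ν = -sw (s ν μ) := fun μ ν => by
    simp only [hs, map_smul, map_add, sw_mZ, hswT, smul_neg, smul_smul, smul_add, mul_assoc, hε2,
      mul_one]
    module
  have hrm : ∀ μ ν, r μ ν ∈ qlPure F ((1 : ℕ) + g) N (d - 1) := fun μ ν =>
    Submodule.smul_mem _ _ (sub_mem (hmZ ν μ) (hmZ μ ν))
  have hsm : ∀ μ ν, s μ ν ∈ qlPure F ((1 : ℕ) + g) N (d - 1) := fun μ ν =>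
    Submodule.smul_mem _ _ (add_mem (hmZ ν μ) (Submodule.smul_mem _ _ (hmZ μ ν)))
  refine ⟨cochain₂ r s, ⟨isCochain₂ hr_anti hs_symm, ?_, supportedAt_cochain₂ r s⟩, fun μ => ?_⟩
  · exact cochain₂_mem (fun _ => sw_mem_ql) (fun μ ν => qlPure_le_ql _ _ _ (hrm μ ν))
      (fun μ ν => qlPure_le_ql _ _ _ (hsm μ ν))
  · have hsum : ∑ ν, dR ν (r μ ν + s μ ν) = T μ := by
      have h1 : ∑ ν, dR ν (mZ μ (T ν)) = mZ μ D + T μ := by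
        rw [hD, map_sum]
        simp only [mZ_dR, Finset.sum_sub_distrib, ite_smul, one_smul, zero_smul,
          Finset.sum_ite_eq', Finset.mem_univ, if_true]
        abel
      have h2 : ∑ ν, dR ν (r μ ν + s μ ν) = b⁻¹ • ((2 : ℂ) • ∑ ν, dR ν (mZ ν (T μ))
          + (ε - 1) • ∑ ν, dR ν (mZ μ (T ν))) := by
        simp only [hr, hs, Finset.smul_sum, ← Finset.sum_add_distrib]
        refine Finset.sum_congr rfl fun ν _ => ?_
        simp only [map_add, map_smul, map_sub]
        module
      have h3 : (ε - 1) • mZ μ D = 0 := by rw [← map_smul, hD0, map_zero]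
      rw [h2, h1, sum_dR_mZ (hT μ), smul_add (ε - 1), h3, zero_add]
      have h4 : (2 : ℂ) • -(((N + 1 : ℕ) : ℂ) • T μ) + (ε - 1) • T μ = b • T μ := by
        rw [hb]; module
      rw [h4, smul_smul, inv_mul_cancel₀ hb0, one_smul]
    have e : (C + cD F (cochain₂ r s)) [μ] [] = (C [μ] [] - T μ)
        + (2⁻¹ : ℂ) • ∑ ν, dT ν (r μ ν - s μ ν) := by
      rw [Pi.add_apply, Pi.add_apply, cD_one]
      simp only [cochain₂, d₁_eq, d₂_eq, Finset.sum_sub_distrib, Finset.sum_add_distrib, map_sub,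
        ← Finset.smul_sum]
      simp only [map_add, Finset.sum_add_distrib] at hsum
      rw [← hsum]
      module
    rw [e]
    refine add_mem (hCT μ) (Submodule.smul_mem _ _ (Submodule.sum_mem _ fun ν _ => ?_))
    exact dT_mem_ordLe (sub_mem (qlPure_le_ordLe _ _ _ (hrm μ ν))
      (qlPure_le_ordLe _ _ _ (hsm μ ν))) ν

lemma exists_correction_one (hC : IsCochain C) (hq : IsQLCochain g d C)
    (hZ : cD F C [] [] ∈ ordLe F 0) :
    ∃ R, Correction g d 1 R ∧ ∀ I J, lvl I J = 1 → (C + cD F R) I J ∈ ordLe F 0 := by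
  -- The cochain is quantified because every step replaces C by C + δR.
  suffices h : ∀ N, ∀ C : Cochain F, IsCochain C → IsQLCochain g d C →
      cD F C [] [] ∈ ordLe F 0 → (∀ μ, C [μ] [] ∈ ordLe F N) →
      ∃ R, Correction g d 1 R ∧ ∀ μ, (C + cD F R) [μ] [] ∈ ordLe F 0 by
    choose n hn using fun μ => exists_ordLe (hq [μ] [])
    obtain ⟨R, hR, hCR⟩ := h (∑ μ, n μ) C hC hq hZ fun μ =>
      ordLe_mono (Finset.single_le_sum (f := n) (fun _ _ => Nat.zero_le _) (Finset.mem_univ μ))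
        (hn μ)
    exact ⟨R, hR, fun I J => mem_of_lvl_one (hC.add hR.cochain.cD) (fun _ => sw_mem_ordLe) hCR⟩
  intro N
  induction N with
  | zero => exact fun C hC hq hZ hN => ⟨0, Correction.zero g d 1, by simpa using hN⟩
  | succ N ih =>
    intro C hC hq hZ hN
    obtain ⟨R, hR, hCR⟩ := exists_correction_one_step hC hq hZ hN
    obtain ⟨R', hR', hCR'⟩ := ih (C + cD F R) (hC.add hR.cochain.cD) (hq.add hR.isQLCochain_cD)
      (by rwa [hR.cD_add]) hCR
    exact ⟨R + R', hR.add hR', by rwa [map_add, ← add_assoc]⟩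

/-! ### Removing derivatives of `δ`: degree two -/

/-- On these components δ acts through ∂₂ alone, so plain division suffices; antisymmetrising the
quotient in μ, ν makes it a cochain without changing the result. -/
lemma exists_correction_two_left (hC : IsCochain C) (hq : IsQLCochain g d C) :
    ∃ R, Correction g d 2 R ∧ ∀ μ ν, (C + cD F R) [μ, ν] [] ∈ ordLe F 0 := by
  choose B hB hCB using fun μ ν =>
    exists_division (isQL_component hq (I := [μ, ν]) (J := []) (n := 2) rfl)
  set r : Fin 4 → Fin 4 → Fin 4 → Op₂ F := fun μ ν ρ => (-2⁻¹ : ℂ) • (B μ ν ρ - B ν μ ρ) with hr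
  have hra : ∀ μ ν ρ, r μ ν ρ = -r ν μ ρ := fun μ ν ρ => by simp only [hr]; module
  refine ⟨cochain₃ r, ⟨isCochain₃ hra, ?_, supportedAt_cochain₃ r⟩, fun μ ν => ?_⟩
  · exact cochain₃_mem (fun _ => sw_mem_ql) fun μ ν ρ =>
      Submodule.smul_mem _ _ (sub_mem (hB μ ν ρ) (hB ν μ ρ))
  · have hanti : C [μ, ν] [] = -C [ν, μ] [] := (hC.1 []).1 μ ν
    have e : (C + cD F (cochain₃ r)) [μ, ν] [] = (2⁻¹ : ℂ) • (C [μ, ν] [] - ∑ ρ, d₂ ρ (B μ ν ρ))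
        - (2⁻¹ : ℂ) • (C [ν, μ] [] - ∑ ρ, d₂ ρ (B ν μ ρ)) := by
      rw [Pi.add_apply, Pi.add_apply, cD_two (isCochain₃ hra)]
      simp only [cochain₃, hr, map_smul, map_sub, Finset.sum_sub_distrib, ← Finset.smul_sum]
      rw [hanti]
      module
    rw [e]
    exact sub_mem (Submodule.smul_mem _ _ (hCB μ ν)) (Submodule.smul_mem _ _ (hCB ν μ))

/-- Removing the second derivatives of `δ` in the components with one index in each place. -/
lemma exists_correction_two_middle (hC : IsCochain C) (hq : IsQLCochain g d C)
    (hZ : ∀ μ, cD F C [μ] [] ∈ ordLe F 0) (h₀ : ∀ μ ν, C [μ, ν] [] ∈ ordLe F 0)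
    (h₂ : ∀ μ ν, C [μ] [ν] ∈ ordLe F 2) :
    ∃ R, Correction g d 2 R ∧ (∀ μ ν, (C + cD F R) [μ, ν] [] ∈ ordLe F 0) ∧
      ∀ μ ν, (C + cD F R) [μ] [ν] ∈ ordLe F 1 := by
  choose T hT hCT using fun μ ν =>
    exists_top (isQL_component hq (I := [μ]) (J := [ν]) (n := 2) rfl) (h₂ μ ν)
  -- Second-order parts are even under the exchange, so the sign in the graded symmetry becomes
  -- antisymmetry.
  have hTa : ∀ μ ν, T μ ν = -T ν μ := by
    intro μ ν
    rw [← sub_eq_zero, sub_neg_eq_add]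
    refine eq_zero_of_mem_ordLe (add_mem (hT μ ν) (hT ν μ)) ?_
    have h1 : sw (T ν μ) = T ν μ := by
      rw [sw_of_mem_qlPure (hT ν μ)]; norm_num
    have e : T μ ν + T ν μ = -(C [μ] [ν] - T μ ν) - (sw (C [ν] [μ]) - sw (T ν μ)) := by
      rw [h1, hC.one_one μ ν]; abel
    rw [e]
    exact sub_mem (neg_mem (hCT μ ν)) (sw_top (hCT ν μ))
  -- In δC the terms from ([μν], ∅) have order at most one and cannot cancel the third-order
  -- divergence of T.
  have hTdiv : ∀ μ, ∑ ν, dR ν (T μ ν) = 0 := by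
    intro μ
    refine eq_zero_of_mem_ordLe (sum_dR_mem_qlPure (hT μ)) ?_
    have e : ∑ ν, dR ν (T μ ν) = ∑ ν, d₁ ν (C [μ, ν] []) - cD F C [μ] []
        - ∑ ν, (d₂ ν (C [μ] [ν]) - dR ν (T μ ν)) := by
      rw [cD_one, Finset.sum_sub_distrib]; abel
    rw [e]
    refine sub_mem (sub_mem (Submodule.sum_mem _ fun ν _ => ?_) (ordLe_mono (Nat.zero_le _) (hZ μ)))
      (Submodule.sum_mem _ fun ν _ => d₂_top (h₂ μ ν) (hCT μ ν) ν)
    exact ordLe_le_succ 1 (d₁_mem_ordLe (h₀ μ ν) ν)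
  set t : Fin 4 → Fin 4 → Fin 4 → Fin 4 → Op₂ F := fun μ ν ρ σ => mZ ρ (mZ σ (T μ ν)) with ht
  have htm : ∀ μ ν ρ σ, t μ ν ρ σ ∈ qlPure F ((2 : ℕ) + g) 0 (d - 1 - 1) := fun μ ν ρ σ =>
    mZ_mem_qlPure (mZ_mem_qlPure (hT μ ν) σ) ρ
  have ht1 : ∀ μ ν ρ σ, t μ ν ρ σ = -t ν μ ρ σ := fun μ ν ρ σ => by
    simp only [ht]; rw [hTa μ ν, map_neg, map_neg]
  have ht2 : ∀ μ ν ρ σ, t μ ν ρ σ = t μ ν σ ρ := fun μ ν ρ σ => mZ_mZ ρ σ _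
  -- Three coordinates applied to the vanishing divergence isolate this cyclic sum of coefficients.
  have ht3 : ∀ μ a b c, t μ a b c + t μ b a c + t μ c a b = 0 := by
    intro μ a b c
    have hz : ∀ ν, mZ a (mZ b (mZ c (T μ ν))) = 0 := fun ν =>
      mem_ordLe_zero.1 (qlPure_le_ordLe _ _ _ (htm μ ν b c)) a
    have h1 : mZ a (mZ b (mZ c (∑ ν, dR ν (T μ ν)))) = 0 := by rw [hTdiv]; simp
    simp only [map_sum, mZ_dR, map_sub, hz, map_zero, zero_sub,
      Finset.sum_sub_distrib, ite_smul, one_smul, zero_smul, Finset.sum_ite_eq', Finset.mem_univ,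
      if_true, Finset.sum_neg_distrib] at h1
    simp only [ht]
    rw [← neg_eq_zero, ← h1]
    abel
  -- A second potential for T: t is projected onto a tensor that is antisymmetric in each index pair
  -- and under exchange of the pairs. The factor 1/8 is the normalisation for which `h4` below
  -- holds.
  set Y : Fin 4 → Fin 4 → Fin 4 → Fin 4 → Op₂ F := fun a b c e =>
    (8⁻¹ : ℂ) • (t a c b e - t b c a e - t a e b c + t b e a c) with hY
  have hYm : ∀ a b c e, Y a b c e ∈ qlPure F ((2 : ℕ) + g) 0 (d - 1 - 1) := fun a b c e =>
    Submodule.smul_mem _ _ (add_mem (sub_mem (sub_mem (htm _ _ _ _) (htm _ _ _ _)) (htm _ _ _ _))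
      (htm _ _ _ _))
  have hY1 : ∀ a b c e, Y a b c e = -Y b a c e := fun a b c e => by simp only [hY]; module
  have hY2 : ∀ a b c e, Y a b c e = -Y a b e c := fun a b c e => by simp only [hY]; module
  have hY3 : ∀ a b c e, Y a b c e = -Y c e a b := fun a b c e => by
    simp only [hY]
    rw [ht1 a c b e, ht1 b c a e, ht1 a e b c, ht1 b e a c, ht2 c a b e, ht2 c b a e, ht2 e a b c,
      ht2 e b a c]
    module
  have hYsw : ∀ a b c e, sw (Y a b c e) = Y a b c e := fun a b c e => by
    rw [sw_of_mem_qlPure (hYm a b c e), pow_zero, one_smul]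
  -- Since Y is antisymmetric in the last pair, a further ∂₂-divergence of r vanishes; the
  -- components ([μν], ∅) treated before are not disturbed.
  set r : Fin 4 → Fin 4 → Fin 4 → Op₂ F := fun μ ν ρ => ∑ σ, d₂ σ (Y μ ν ρ σ) with hr
  have hra : ∀ μ ν ρ, r μ ν ρ = -r ν μ ρ := fun μ ν ρ => by
    simp only [hr]
    rw [← Finset.sum_neg_distrib]
    exact Finset.sum_congr rfl fun σ _ => by rw [hY1, map_neg]
  have hcD0 : ∀ μ ν, cD F (cochain₃ r) [μ, ν] [] = 0 := by
    intro μ ν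
    rw [cD_two (isCochain₃ hra)]
    simp only [cochain₃, hr, map_sum]
    exact sum_antisymm_eq_zero fun ρ σ => by rw [hY2, d₂_d₂, map_neg, map_neg]
  have hcD1 : ∀ μ ν, cD F (cochain₃ r) [μ] [ν]
      = (2 : ℂ) • ∑ ρ, ∑ σ, d₁ ρ (d₂ σ (Y μ ρ ν σ)) := by
    intro μ ν
    rw [cD_one_one]
    simp only [cochain₃, hr, map_sum, sw_d₂, hYsw]
    have h1 : ∑ ρ, ∑ σ, d₂ ρ (d₁ σ (Y ν ρ μ σ)) = -∑ ρ, ∑ σ, d₁ ρ (d₂ σ (Y μ ρ ν σ)) := by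
      rw [Finset.sum_comm, ← Finset.sum_neg_distrib]
      refine Finset.sum_congr rfl fun ρ _ => ?_
      rw [← Finset.sum_neg_distrib]
      refine Finset.sum_congr rfl fun σ _ => ?_
      rw [← d₁_d₂, hY3 ν σ μ ρ, map_neg, map_neg]
    rw [h1]
    module
  -- Relative derivatives commute, so only the part of Y symmetric in ρ, σ contributes, and this is
  -- a multiple of t. Euler's identity in orders one and two recovers 2T from the second derivatives
  -- of t.
  have hYT : ∀ μ ν, ∑ ρ, ∑ σ, dR ρ (dR σ (Y μ ρ ν σ)) = (2⁻¹ : ℂ) • T μ ν := by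
    intro μ ν
    have h1 : ∑ ρ, ∑ σ, dR ρ (dR σ (t μ ν ρ σ)) = (2 : ℂ) • T μ ν := by
      have h2 : ∀ σ, ∑ ρ, dR ρ (mZ ρ (mZ σ (T μ ν))) = -mZ σ (T μ ν) := fun σ => by
        rw [sum_dR_mZ (mZ_mem_qlPure (hT μ ν) σ)]; norm_num
      have h3 : ∀ σ, ∑ ρ, dR ρ (dR σ (mZ ρ (mZ σ (T μ ν)))) = -dR σ (mZ σ (T μ ν)) := fun σ => by
        rw [← map_neg, ← h2 σ, map_sum]
        exact Finset.sum_congr rfl fun ρ _ => dR_dR _ _ _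
      rw [Finset.sum_comm]
      simp only [ht, h3, Finset.sum_neg_distrib]
      rw [sum_dR_mZ (hT μ ν), neg_neg]
      norm_num
    have h4 : ∀ ρ σ, Y μ ρ ν σ + Y μ σ ν ρ = (2⁻¹ : ℂ) • t μ ν ρ σ := by
      intro ρ σ
      simp only [hY]
      -- Only the pair symmetries of t and two instances of the cyclic identity enter.
      linear_combination (norm := module) (8⁻¹ : ℂ) • (ht2 μ ν σ ρ - ht1 ρ ν μ σ - ht1 σ ν μ ρ
        - ht2 μ σ ρ ν - ht2 μ ρ σ ν + ht1 ρ σ μ ν + ht3 ν μ ρ σ - ht1 μ ν ρ σ - ht3 μ ν ρ σ)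
    have h5 : ∑ ρ, ∑ σ, dR ρ (dR σ (Y μ σ ν ρ)) = ∑ ρ, ∑ σ, dR ρ (dR σ (Y μ ρ ν σ)) := by
      rw [Finset.sum_comm]
      exact Finset.sum_congr rfl fun ρ _ => Finset.sum_congr rfl fun σ _ => dR_dR _ _ _
    have h6 : ∑ ρ, ∑ σ, dR ρ (dR σ (Y μ ρ ν σ + Y μ σ ν ρ)) = T μ ν := by
      simp only [h4, map_smul, ← Finset.smul_sum, h1, smul_smul]
      norm_num
    simp only [map_add, Finset.sum_add_distrib, h5] at h6
    rw [← h6]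
    module
  refine ⟨cochain₃ r, ⟨isCochain₃ hra, ?_, supportedAt_cochain₃ r⟩, fun μ ν => ?_, fun μ ν => ?_⟩
  · refine cochain₃_mem (fun _ => sw_mem_ql) fun μ ν ρ => Submodule.sum_mem _ fun σ _ => ?_
    have := d₂_mem_ql (qlPure_le_ql _ _ _ (hYm μ ν ρ σ)) σ
    rwa [sub_add_cancel] at this
  · rw [Pi.add_apply, Pi.add_apply, hcD0, add_zero]
    exact h₀ μ ν
  · rw [Pi.add_apply, Pi.add_apply, hcD1]
    have hlow : ∀ ρ σ, d₁ ρ (d₂ σ (Y μ ρ ν σ)) + dR ρ (dR σ (Y μ ρ ν σ)) ∈ ordLe F 1 := by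
      intro ρ σ
      have hY0 := qlPure_le_ordLe _ _ _ (hYm μ ρ ν σ)
      refine d₁_top (d₂_mem_ordLe hY0 σ) ?_ ρ
      rw [d₂_eq, add_sub_cancel_right]
      exact Submodule.smul_mem _ _ (dT_mem_ordLe hY0 σ)
    have e : C [μ] [ν] + (2 : ℂ) • ∑ ρ, ∑ σ, d₁ ρ (d₂ σ (Y μ ρ ν σ)) = (C [μ] [ν] - T μ ν)
        + (2 : ℂ) • ∑ ρ, ∑ σ, (d₁ ρ (d₂ σ (Y μ ρ ν σ)) + dR ρ (dR σ (Y μ ρ ν σ))) := by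
      simp only [Finset.sum_add_distrib, hYT]
      module
    rw [e]
    exact add_mem (hCT μ ν) (Submodule.smul_mem _ _ (Submodule.sum_mem _ fun ρ _ =>
      Submodule.sum_mem _ fun σ _ => hlow ρ σ))

end stages

/-! ### Degree two: first derivatives of δ, and conclusion -/

section stages

variable {g : ℤ} {d : ℚ} {C : Cochain F}

lemma eq_zero_of_eq_neg {V : Type} [AddCommGroup V] [Module ℂ V] {v : V} (h : v = -v) :
    v = 0 := by
  have h1 : (2 : ℂ) • v = 0 := by rw [two_smul]; nth_rewrite 2 [h]; exact add_neg_cancel v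
  exact (smul_eq_zero.1 h1).resolve_left two_ne_zero

/-- A family that is symmetric in the first and antisymmetric in the last two indices vanishes. -/
lemma eq_zero_of_symm_antisymm {ι V : Type} [AddCommGroup V] [Module ℂ V] {X : ι → ι → ι → V}
    (h : ∀ a b c, X a b c = X b a c) (h' : ∀ a b c, X a b c = -X a c b) (a b c : ι) :
    X a b c = 0 := by
  have h1 : X a b c = -X a b c := by
    conv_lhs => rw [h, h', h, h', h, h']
    simp
  exact eq_zero_of_eq_neg h1

/-- Of two coordinates, one is consumed by the outer derivative and the other by the first-order
operator, in both ways. Thus a divergence determines the symmetric part of the coefficients. -/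
lemma mZ_mZ_sum_dR {g : ℤ} {d : ℚ} {T : Fin 4 → Op₂ F} (hT : ∀ ν, T ν ∈ qlPure F g 1 d)
    (a b : Fin 4) : mZ b (mZ a (∑ ν, dR ν (T ν))) = -(mZ a (T b) + mZ b (T a)) := by
  have hz : ∀ ν, mZ b (mZ a (T ν)) = 0 := fun ν =>
    mem_ordLe_zero.1 (qlPure_le_ordLe _ _ _ (mZ_mem_qlPure (hT ν) a)) b
  have h : ∀ ν, mZ b (mZ a (dR ν (T ν))) = -((if ν = b then (1 : ℂ) else 0) • mZ a (T ν)
      + (if ν = a then (1 : ℂ) else 0) • mZ b (T ν)) := fun ν => by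
    rw [mZ_dR, map_sub, mZ_dR, map_smul, hz, map_zero]
    abel
  simp only [map_sum, h, ite_smul, one_smul, zero_smul, Finset.sum_neg_distrib,
    Finset.sum_add_distrib, Finset.sum_ite_eq', Finset.mem_univ, if_true]

/-- No correction is required here. First-order parts are odd under the exchange, so T is symmetric
in its two indices, whereas the vanishing divergence makes z_c T_ab antisymmetric in b, c; a tensor
with both symmetries is zero. -/
lemma mem_ordLe_zero_of_order_one (hC : IsCochain C) (hq : IsQLCochain g d C)
    (hZ : ∀ μ, cD F C [μ] [] ∈ ordLe F 0) (h₀ : ∀ μ ν, C [μ, ν] [] ∈ ordLe F 0)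
    (h₁ : ∀ μ ν, C [μ] [ν] ∈ ordLe F 1) (μ ν : Fin 4) : C [μ] [ν] ∈ ordLe F 0 := by
  choose T hT hCT using fun μ ν =>
    exists_top (isQL_component hq (I := [μ]) (J := [ν]) (n := 2) rfl) (h₁ μ ν)
  have hTs : ∀ μ ν, T μ ν = T ν μ := by
    intro μ ν
    rw [← sub_eq_zero]
    refine eq_zero_of_mem_ordLe (sub_mem (hT μ ν) (hT ν μ)) ?_
    have h1 : sw (T ν μ) = -T ν μ := by
      rw [sw_of_mem_qlPure (hT ν μ)]; norm_num [neg_one_smul_op]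
    have e : T μ ν - T ν μ = -(C [μ] [ν] - T μ ν) - (sw (C [ν] [μ]) - sw (T ν μ)) := by
      rw [h1, hC.one_one μ ν]; abel
    rw [e]
    exact sub_mem (neg_mem (hCT μ ν)) (sw_top (hCT ν μ))
  have hTdiv : ∀ μ, ∑ ν, dR ν (T μ ν) = 0 := by
    intro μ
    refine eq_zero_of_mem_ordLe (sum_dR_mem_qlPure (hT μ)) ?_
    have e : ∑ ν, dR ν (T μ ν) = ∑ ν, d₁ ν (C [μ, ν] []) - cD F C [μ] []
        - ∑ ν, (d₂ ν (C [μ] [ν]) - dR ν (T μ ν)) := by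
      rw [cD_one, Finset.sum_sub_distrib]; abel
    rw [e]
    exact sub_mem (sub_mem (Submodule.sum_mem _ fun ν _ => d₁_mem_ordLe (h₀ μ ν) ν)
      (ordLe_mono (Nat.zero_le _) (hZ μ)))
      (Submodule.sum_mem _ fun ν _ => d₂_top (h₁ μ ν) (hCT μ ν) ν)
  have hX : ∀ a b c, mZ c (T a b) = 0 := eq_zero_of_symm_antisymm
    (fun a b c => by rw [hTs a b]) fun a b c => by
      have h1 := mZ_mZ_sum_dR (hT a) b c
      rw [hTdiv, map_zero, map_zero] at h1
      rw [eq_neg_iff_add_eq_zero, add_comm, ← neg_eq_zero, ← h1]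
  have h0 : T μ ν = 0 := by
    have h1 := sum_dR_mZ (hT μ ν)
    simpa [hX] using h1
  simpa [h0] using hCT μ ν

lemma exists_correction_two (hd : d ≤ g + 4) (hC : IsCochain C) (hq : IsQLCochain g d C)
    (hZ : ∀ μ, cD F C [μ] [] ∈ ordLe F 0) :
    ∃ R, Correction g d 2 R ∧ ∀ I J, lvl I J = 2 → (C + cD F R) I J ∈ ordLe F 0 := by
  obtain ⟨R, hR, h₀⟩ := exists_correction_two_left hC hq
  have hC' := hC.add hR.cochain.cD
  have hq' := hq.add hR.isQLCochain_cD
  have hZ' : ∀ μ, cD F (C + cD F R) [μ] [] ∈ ordLe F 0 := by rwa [hR.cD_add]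
  -- Power counting: two indices leave room for at most two derivatives, so a single step suffices.
  obtain ⟨S, hS, h₀', h₁⟩ := exists_correction_two_middle hC' hq' hZ' h₀ fun μ ν =>
    mem_ordLe_of_mem_ql (by push_cast; linarith)
      (isQL_component hq' (I := [μ]) (J := [ν]) (n := 2) rfl)
  have hC'' := hC'.add hS.cochain.cD
  have hq'' := hq'.add hS.isQLCochain_cD
  have h₂ := mem_ordLe_zero_of_order_one hC'' hq'' (by rwa [hS.cD_add]) h₀' h₁
  have e : C + cD F (R + S) = C + cD F R + cD F S := by rw [map_add, add_assoc]
  refine ⟨R + S, hR.add hS, fun I J => ?_⟩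
  rw [e]
  exact mem_of_lvl_two hC'' (fun _ => sw_mem_ordLe) h₀' h₂

/-! ### Removing derivatives of `δ`: degree three -/

/-- A family that is antisymmetric under three transpositions generating all permutations. -/
lemma pair_symm_of_antisymm {ι V : Type} [AddCommGroup V] {Y : ι → ι → ι → ι → V}
    (h₁ : ∀ a b c e, Y a b c e = -Y b a c e) (h₂ : ∀ a b c e, Y a b c e = -Y a b e c)
    (h₃ : ∀ a b c e, Y a b c e = -Y a e c b) (a b c e : ι) : Y a b c e = Y c e a b := by
  -- Exchanging the two pairs is an even permutation, written here as six of the given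
  -- transpositions.
  rw [h₁ a b c e, h₃ b a c e, h₁ b e c a, h₂ e b c a, h₃ e b a c, h₁ e c a b]
  simp

/-- Only first derivatives survive power counting, and the correction in degree four is the tensor X
of their coefficients itself, by Euler's identity. The point is that X must be symmetric under
exchange of its index pairs to be a cochain, and δC being derivative-free in degree two guarantees
this. -/
lemma exists_correction_three (hd : d ≤ g + 4) (hC : IsCochain C) (hq : IsQLCochain g d C)
    (hZ : ∀ μ ν, cD F C [μ, ν] [] ∈ ordLe F 0) (hZ' : ∀ μ ν, cD F C [μ] [ν] ∈ ordLe F 0) :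
    ∃ R, Correction g d 3 R ∧ ∀ I J, lvl I J = 3 → (C + cD F R) I J ∈ ordLe F 0 := by
  have h₁ : ∀ μ ν ρ, C [μ, ν] [ρ] ∈ ordLe F 1 := fun μ ν ρ =>
    mem_ordLe_of_mem_ql (by push_cast; linarith)
      (isQL_component hq (I := [μ, ν]) (J := [ρ]) (n := 3) rfl)
  choose T hT hCT using fun μ ν ρ =>
    exists_top (isQL_component hq (I := [μ, ν]) (J := [ρ]) (n := 3) rfl) (h₁ μ ν ρ)
  have hswT : ∀ μ ν ρ, sw (T μ ν ρ) = -T μ ν ρ := fun μ ν ρ => by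
    rw [sw_of_mem_qlPure (hT μ ν ρ)]; norm_num [neg_one_smul_op]
  have hTa : ∀ μ ν ρ, T μ ν ρ = -T ν μ ρ := by
    intro μ ν ρ
    rw [← sub_eq_zero, sub_neg_eq_add]
    refine eq_zero_of_mem_ordLe (add_mem (hT μ ν ρ) (hT ν μ ρ)) ?_
    have hanti : C [μ, ν] [ρ] = -C [ν, μ] [ρ] := (hC.1 [ρ]).1 μ ν
    have e : T μ ν ρ + T ν μ ρ = -(C [μ, ν] [ρ] - T μ ν ρ) - (C [ν, μ] [ρ] - T ν μ ρ) := by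
      rw [hanti]; abel
    rw [e]
    exact sub_mem (neg_mem (hCT μ ν ρ)) (hCT ν μ ρ)
  have hTdiv : ∀ μ ν, ∑ ρ, dR ρ (T μ ν ρ) = 0 := by
    intro μ ν
    refine eq_zero_of_mem_ordLe (sum_dR_mem_qlPure (hT μ ν)) ?_
    have e : ∑ ρ, dR ρ (T μ ν ρ) = cD F C [μ, ν] []
        - ∑ ρ, (d₂ ρ (C [μ, ν] [ρ]) - dR ρ (T μ ν ρ)) := by
      rw [cD_two hC, Finset.sum_sub_distrib]; abel
    rw [e]
    exact sub_mem (ordLe_mono (Nat.zero_le _) (hZ μ ν))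
      (Submodule.sum_mem _ fun ρ _ => d₂_top (h₁ μ ν ρ) (hCT μ ν ρ) ρ)
  -- The exchange is odd on first-order parts, and `d₁`, `d₂` have opposite leading parts; together
  -- these signs give the difference.
  have hTdiv' : ∀ μ ν, ∑ ρ, dR ρ (T μ ρ ν - T ν ρ μ) = 0 := by
    intro μ ν
    refine eq_zero_of_mem_ordLe
      (sum_dR_mem_qlPure fun ρ => sub_mem (hT μ ρ ν) (hT ν ρ μ)) ?_
    have e : ∑ ρ, dR ρ (T μ ρ ν - T ν ρ μ) = ∑ ρ, (d₁ ρ (C [μ, ρ] [ν]) + dR ρ (T μ ρ ν))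
        - ∑ ρ, (d₂ ρ (sw (C [ν, ρ] [μ])) - dR ρ (sw (T ν ρ μ))) - cD F C [μ] [ν] := by
      rw [cD_one_one]
      simp only [hC.one_two, hswT, Finset.sum_add_distrib, Finset.sum_sub_distrib, map_sub,
        map_neg, Finset.sum_neg_distrib]
      abel
    rw [e]
    exact sub_mem (sub_mem
      (Submodule.sum_mem _ fun ρ _ => d₁_top (h₁ μ ρ ν) (hCT μ ρ ν) ρ)
      (Submodule.sum_mem _ fun ρ _ => d₂_top (sw_mem_ordLe (h₁ ν ρ μ)) (sw_top (hCT ν ρ μ)) ρ))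
      (ordLe_mono (Nat.zero_le _) (hZ' μ ν))
  set X : Fin 4 → Fin 4 → Fin 4 → Fin 4 → Op₂ F := fun a b c e => mZ e (T a b c) with hX
  have hXm : ∀ a b c e, X a b c e ∈ qlPure F ((3 : ℕ) + g) 0 (d - 1) := fun a b c e =>
    mZ_mem_qlPure (hT a b c) e
  have hXa : ∀ a b c e, X a b c e = -X b a c e := fun a b c e => by
    simp only [hX]; rw [hTa, map_neg]
  have hXb : ∀ a b c e, X a b c e = -X a b e c := fun a b c e => by
    have h1 := mZ_mZ_sum_dR (hT a b) c e
    rw [hTdiv, map_zero, map_zero] at h1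
    rw [eq_neg_iff_add_eq_zero, add_comm, ← neg_eq_zero, ← h1]
  have hXc : ∀ a b c e, X a b c e - X c e a b = -(X a e c b - X c b a e) := fun a b c e => by
    have h1 := mZ_mZ_sum_dR (fun ρ => sub_mem (hT a ρ c) (hT c ρ a)) b e
    rw [hTdiv', map_zero, map_zero] at h1
    simp only [map_sub] at h1
    simp only [hX]
    rw [eq_neg_iff_add_eq_zero, ← neg_eq_zero, h1]
    abel
  -- The part of X odd under exchange of the pairs changes sign under (ab), (ce) and (be), hence is
  -- totally antisymmetric. The pair exchange is an even permutation, so this part is also even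
  -- under it, and therefore zero.
  have hXs : ∀ a b c e, X a b c e = X c e a b := fun a b c e => by
    have h1 := pair_symm_of_antisymm (Y := fun a b c e => X a b c e - X c e a b)
      (fun a b c e => by rw [hXa a b c e, hXb c e a b]; abel)
      (fun a b c e => by rw [hXb a b c e, hXa c e a b]; abel) hXc a b c e
    have h2 : X a b c e - X c e a b = -(X a b c e - X c e a b) := by
      rw [neg_sub]; exact h1
    exact sub_eq_zero.1 (eq_zero_of_eq_neg h2)
  have hXsw : ∀ a b c e, sw (X a b c e) = X a b c e := fun a b c e => by
    rw [sw_of_mem_qlPure (hXm a b c e), pow_zero, one_smul]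
  have hR : IsCochain (cochain₄ X) := isCochain₄ hXa fun a b c e => by rw [hXsw, hXs]
  refine ⟨cochain₄ X, ⟨hR, ?_, supportedAt_cochain₄ X⟩, fun I J =>
    mem_of_lvl_three (hC.add hR.cD) (fun _ => sw_mem_ordLe) fun μ ν ρ => ?_⟩
  · exact cochain₄_mem fun a b c e => qlPure_le_ql _ _ _ (hXm a b c e)
  · have e : (C + cD F (cochain₄ X)) [μ, ν] [ρ] = (C [μ, ν] [ρ] - T μ ν ρ)
        + (2⁻¹ : ℂ) • ∑ σ, dT σ (X μ ν ρ σ) := by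
      rw [Pi.add_apply, Pi.add_apply, cD_two_one hR]
      have h1 := sum_dR_mZ (hT μ ν ρ)
      simp only [cochain₄, d₂_eq, Finset.sum_add_distrib, ← Finset.smul_sum]
      simp only [hX, h1]
      norm_num
      abel
    rw [e]
    exact add_mem (hCT μ ν ρ) (Submodule.smul_mem _ _ (Submodule.sum_mem _ fun σ _ =>
      dT_mem_ordLe (qlPure_le_ordLe _ _ _ (hXm μ ν ρ σ)) σ))

end stages

/-! ### Removing all derivatives of `δ` -/

section normalisation

variable {g : ℤ} {d : ℚ} {C : Cochain F}

lemma IsQLCochain.mem_ordLe_zero (hd : d ≤ g + 4) (hq : IsQLCochain g d C) {I J : Idx}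
    (h : 4 ≤ lvl I J) : C I J ∈ ordLe F 0 := by
  refine mem_ordLe_of_mem_ql ?_ (hq I J)
  have : (4 : ℚ) ≤ (lvl I J : ℚ) := by exact_mod_cast h
  push_cast
  linarith

lemma exists_correction (hd : d ≤ g + 4) (hC : IsCochain C) (hq : IsQLCochain g d C) (n : ℕ)
    (hZ : ∀ I J, lvl I J < n → cD F C I J ∈ ordLe F 0) :
    ∃ R, Correction g d n R ∧ ∀ I J, lvl I J = n → (C + cD F R) I J ∈ ordLe F 0 := by
  match n with
  | 0 => exact exists_correction_zero hC hq
  | 1 => exact exists_correction_one hC hq (hZ _ _ (by simp [lvl]))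
  | 2 => exact exists_correction_two hd hC hq fun μ => hZ _ _ (by simp [lvl])
  | 3 =>
    exact exists_correction_three hd hC hq (fun μ ν => hZ _ _ (by simp [lvl]))
      (fun μ ν => hZ _ _ (by simp [lvl]))
  | n + 4 =>
    refine ⟨0, Correction.zero g d _, fun I J h => ?_⟩
    rw [map_zero, add_zero]
    exact hq.mem_ordLe_zero hd (by omega)

variable (G : GaugeCharge F)

lemma dQC_mem_ordLe (e : ℕ) {n : ℕ} {I J : Idx} (h : C I J ∈ ordLe F n) :
    dQC G e C I J ∈ ordLe F n := dQL_mem_ordLe G _ h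

/-- d_Q does not raise the order, so wherever C is derivative-free, closedness up to such terms
passes to δC. -/
lemma cD_mem_ordLe_zero {e : ℕ} {c : ℂ} (hc : c ≠ 0) {I J : Idx}
    (h : (dQC G e C - c • cD F C) I J ∈ ordLe F 0) (h' : C I J ∈ ordLe F 0) :
    cD F C I J ∈ ordLe F 0 := by
  have e1 : cD F C I J = c⁻¹ • (dQC G e C I J - (dQC G e C - c • cD F C) I J) := by
    simp only [Pi.sub_apply, Pi.smul_apply, sub_sub_cancel, smul_smul, inv_mul_cancel₀ hc, one_smul]
  rw [e1]
  exact Submodule.smul_mem _ _ (sub_mem (dQC_mem_ordLe G e h') h)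

lemma parity_pred {e : ℕ} (he : (e : ZMod 2) = (g : ZMod 2)) :
    ((e + 1 : ℕ) : ZMod 2) = ((g - 1 : ℤ) : ZMod 2) := by
  push_cast
  rw [he]
  generalize (g : ZMod 2) = a
  revert a
  decide

/-- A quasi-local cochain that is closed up to terms without derivatives of `δ` is cohomologous to
one without derivatives of `δ`. -/
theorem exists_forall_mem_ordLe_zero {e : ℕ} {c : ℂ} (hc : c ≠ 0) (hd : d ≤ g + 4)
    (he : (e : ZMod 2) = (g : ZMod 2)) (hC : IsCochain C) (hq : IsQLCochain g d C)
    (hZ : ∀ I J, (dQC G (e + 2) C - c • cD F C) I J ∈ ordLe F 0) :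
    ∃ R, IsCochain R ∧ IsQLCochain (g - 1) (d - 1) R ∧
      ∀ I J, (C + (dQC G (e + 1) R + c • cD F R)) I J ∈ ordLe F 0 := by
  have key : ∀ n, ∃ R, IsCochain R ∧ IsQLCochain (g - 1) (d - 1) R ∧
      ∀ I J, lvl I J < n → (C + (dQC G (e + 1) R + c • cD F R)) I J ∈ ordLe F 0 := by
    intro n
    induction n with
    | zero =>
      exact ⟨0, (Correction.zero g d 0).cochain, (Correction.zero g d 0).isQLCochain,
        fun I J h => absurd h (Nat.not_lt_zero _)⟩
    | succ n ih =>
      obtain ⟨R, hR, hRq, hRn⟩ := ih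
      set C' := C + (dQC G (e + 1) R + c • cD F R) with hC'def
      have hC' : IsCochain C' := hC.add ((hR.dQC G _).add (hR.cD.smul c))
      have hq' : IsQLCochain g d C' := hq.add
        ((hRq.dQC G (parity_pred he) (by ring) (by ring)).add ((hRq.cD (by ring) (by ring)).smul c))
      have hZ' : ∀ I J, (dQC G (e + 2) C' - c • cD F C') I J ∈ ordLe F 0 := by
        have e1 : dQC G (e + 2) C' - c • cD F C' = dQC G (e + 2) C - c • cD F C := by
          have := gauge_differential_sq G (e + 1) c hR
          rw [hC'def, map_add, map_add (cD F), smul_add, add_sub_add_comm, this, add_zero]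
        rwa [e1]
      -- The induction hypothesis makes δC' derivative-free below degree n. In degree n - 1 this
      -- involves the components of degree n and constrains their leading parts.
      obtain ⟨S, hS, hSn⟩ := exists_correction hd hC' hq' n fun I J h =>
        cD_mem_ordLe_zero G hc (hZ' I J) (hRn I J h)
      -- The factor c⁻¹ compensates the coefficient of δ.
      refine ⟨R + c⁻¹ • S, hR.add (hS.cochain.smul _), hRq.add (hS.isQLCochain.smul _),
        fun I J h => ?_⟩
      have e2 : C + (dQC G (e + 1) (R + c⁻¹ • S) + c • cD F (R + c⁻¹ • S))
          = C' + cD F S + c⁻¹ • dQC G (e + 1) S := by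
        simp only [hC'def, map_add, map_smul, smul_add, smul_smul, mul_inv_cancel₀ hc, one_smul]
        abel
      -- S sits in degree n + 1: d_Q S is invisible up to degree n, and δS is concentrated in degree
      -- n, so earlier degrees stay normalised.
      have hS0 : S I J = 0 := hS.supp I J (by omega)
      have e3 : (C' + cD F S + c⁻¹ • dQC G (e + 1) S) I J = (C' + cD F S) I J := by
        rw [Pi.add_apply, Pi.add_apply, Pi.smul_apply, Pi.smul_apply, dQC_apply, hS0, map_zero,
          smul_zero, add_zero]
      rw [e2, e3]
      rcases Nat.lt_succ_iff_lt_or_eq.1 h with h | h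
      · rw [Pi.add_apply, Pi.add_apply, hS.supp.cD I J (by omega), add_zero]
        exact hRn I J h
      · exact hSn I J h
  -- From degree four on, power counting excludes derivatives of δ.
  obtain ⟨R, hR, hRq, hRn⟩ := key 4
  refine ⟨R, hR, hRq, fun I J => ?_⟩
  by_cases h : lvl I J < 4
  · exact hRn I J h
  · refine IsQLCochain.mem_ordLe_zero hd (hq.add ((hRq.dQC G (parity_pred he) ?_ ?_).add
      ((hRq.cD ?_ ?_).smul c))) (not_lt.1 h) <;> ring

end normalisation

/-! ### Cochains without derivatives of `δ` -/

/-- The normal form of a cochain without derivatives of `δ`. -/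
structure IsLocalForm (C : Cochain F) (W : Idx → OpMap F Mink) : Prop where
  cochain : IsCochain C
  multivector : IsMultivector W
  nil : ∀ I, C I [] = dlt (W I)
  one_one : ∀ μ ν, C [μ] [ν] = -dlt (W [μ, ν])
  two_one : ∀ μ ν ρ, C [μ, ν] [ρ] = 0
  two_two : ∀ μ ν ρ σ, C [μ, ν] [ρ, σ] = 0

section localForm

variable {C C' : Cochain F} {W W' : Idx → OpMap F Mink}

/-- Multiplication by z_ν kills every term except the one with derivative ν and returns -B_ν, so the
summands can be read off one by one. -/
lemma eq_zero_of_sum_dR_mem {B : Fin 4 → Op₂ F} (hB : ∀ ν, B ν ∈ ordLe F 0)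
    (h : ∑ ν, dR ν (B ν) ∈ ordLe F 0) (ν : Fin 4) : B ν = 0 := by
  have h1 := mem_ordLe_zero.1 h ν
  have h2 : ∀ a, mZ ν (dR a (B a)) = -((if a = ν then (1 : ℂ) else 0) • B a) := fun a => by
    rw [mZ_dR, mem_ordLe_zero.1 (hB a), map_zero, zero_sub]
  simpa only [map_sum, h2, ite_smul, one_smul, zero_smul, Finset.sum_neg_distrib,
    Finset.sum_ite_eq', Finset.mem_univ, if_true, neg_eq_zero] using h1

lemma eq_zero_of_sum_d₂_mem {B : Fin 4 → Op₂ F} (hB : ∀ ν, B ν ∈ ordLe F 0)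
    (h : ∑ ν, d₂ ν (B ν) ∈ ordLe F 0) (ν : Fin 4) : B ν = 0 := by
  refine eq_zero_of_sum_dR_mem hB ?_ ν
  have e : ∑ ν, dR ν (B ν) = ∑ ν, d₂ ν (B ν) - (2⁻¹ : ℂ) • ∑ ν, dT ν (B ν) := by
    simp only [d₂_eq, Finset.sum_add_distrib, ← Finset.smul_sum]
    abel
  rw [e]
  exact sub_mem h (Submodule.smul_mem _ _ (Submodule.sum_mem _ fun ν _ => dT_mem_ordLe (hB ν) ν))

/-- The first-order part of δC is a relative divergence of derivative-free operators, so each of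
them vanishes. In (μ, ∅) this ties the (μ; ν) component to the ([μν], ∅) one with a minus sign; in
([μν], ∅) and ([μν]; ρ) it makes the components with three and four indices vanish. -/
lemma exists_isLocalForm {g : ℤ} {d : ℚ} (hC : IsCochain C) (hq : IsQLCochain g d C)
    (h₀ : ∀ I J, C I J ∈ ordLe F 0) (hZ : ∀ I J, cD F C I J ∈ ordLe F 0) :
    ∃ W, (∀ I : Idx, IsWick (I.length + g) d (W I)) ∧ IsLocalForm C W := by
  choose W hW hCW using fun I => exists_dlt (hq I []) (h₀ I [])
  have h1 : ∀ μ ν, C [μ, ν] [] + C [μ] [ν] = 0 := fun μ => by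
    refine eq_zero_of_sum_dR_mem (fun ν => add_mem (h₀ _ _) (h₀ _ _)) ?_
    have e : ∑ ν, dR ν (C [μ, ν] [] + C [μ] [ν]) = -cD F C [μ] []
        + (2⁻¹ : ℂ) • ∑ ν, dT ν (C [μ, ν] [] - C [μ] [ν]) := by
      rw [cD_one]
      simp only [d₁_eq, d₂_eq, map_add, map_sub, Finset.sum_add_distrib, Finset.sum_sub_distrib,
        ← Finset.smul_sum]
      module
    rw [e]
    exact add_mem (neg_mem (hZ _ _)) (Submodule.smul_mem _ _
      (Submodule.sum_mem _ fun ν _ => dT_mem_ordLe (sub_mem (h₀ _ _) (h₀ _ _)) ν))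
  refine ⟨W, fun I => by simpa [lvl] using hW I, hC, ⟨fun μ ν => ?_, fun I hI => ?_⟩, hCW,
    fun μ ν => ?_, fun μ ν => ?_, fun μ ν ρ => ?_⟩
  · refine dlt_injective ?_
    rw [map_neg, ← hCW, ← hCW]
    exact (hC.1 []).1 μ ν
  · refine dlt_injective ?_
    rw [map_zero, ← hCW]
    exact (hC.1 []).2 I hI
  · rw [← hCW, eq_neg_iff_add_eq_zero, add_comm]
    exact h1 μ ν
  · exact eq_zero_of_sum_d₂_mem (fun ρ => h₀ _ _) (by rw [← cD_two hC]; exact hZ _ _)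
  · exact eq_zero_of_sum_d₂_mem (fun σ => h₀ _ _) (by rw [← cD_two_one hC]; exact hZ _ _)

/-- Up to degree three the form and the graded symmetry cover all components; beyond that power
counting does. -/
lemma IsLocalForm.mem_ordLe_zero {g : ℤ} {d : ℚ} (h : IsLocalForm C W) (hd : d ≤ g + 4)
    (hq : IsQLCochain g d C) (I J : Idx) : C I J ∈ ordLe F 0 := by
  have hsw : ∀ A ∈ ordLe F 0, sw A ∈ ordLe F 0 := fun _ => sw_mem_ordLe
  have hnil : ∀ I, C I [] ∈ ordLe F 0 := fun I => by rw [h.nil]; exact dlt_mem_ordLe _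
  by_cases h4 : 4 ≤ lvl I J
  · exact hq.mem_ordLe_zero hd h4
  · obtain h0 | h0 | h0 | h0 : lvl I J = 0 ∨ lvl I J = 1 ∨ lvl I J = 2 ∨ lvl I J = 3 := by omega
    · exact mem_of_lvl_zero (hnil _) h0
    · exact mem_of_lvl_one h.cochain hsw (fun _ => hnil _) h0
    · exact mem_of_lvl_two h.cochain hsw (fun _ _ => hnil _)
        (fun μ ν => by rw [h.one_one]; exact neg_mem (dlt_mem_ordLe _)) h0
    · exact mem_of_lvl_three h.cochain hsw
        (fun μ ν ρ => by rw [h.two_one]; exact zero_mem _) h0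

lemma IsLocalForm.unique (h : IsLocalForm C W) (h' : IsLocalForm C W') : W = W' :=
  funext fun I => dlt_injective (by rw [← h.nil, h'.nil])

lemma IsLocalForm.add (h : IsLocalForm C W) (h' : IsLocalForm C' W') :
    IsLocalForm (C + C') (W + W') where
  cochain := h.cochain.add h'.cochain
  multivector := h.multivector.add h'.multivector
  nil I := by simp only [Pi.add_apply, h.nil, h'.nil, map_add]
  one_one μ ν := by simp only [Pi.add_apply, h.one_one, h'.one_one, map_add, neg_add]
  two_one μ ν ρ := by simp only [Pi.add_apply, h.two_one, h'.two_one, add_zero]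
  two_two μ ν ρ σ := by simp only [Pi.add_apply, h.two_two, h'.two_two, add_zero]

lemma IsLocalForm.smul (c : ℂ) (h : IsLocalForm C W) : IsLocalForm (c • C) (c • W) where
  cochain := h.cochain.smul c
  multivector := h.multivector.smul c
  nil I := by simp only [Pi.smul_apply, h.nil, map_smul]
  one_one μ ν := by simp only [Pi.smul_apply, h.one_one, map_smul, smul_neg]
  two_one μ ν ρ := by simp only [Pi.smul_apply, h.two_one, smul_zero]
  two_two μ ν ρ σ := by simp only [Pi.smul_apply, h.two_two, smul_zero]

lemma IsLocalForm.dQC (G : GaugeCharge F) (e : ℕ) (h : IsLocalForm C W) :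
    IsLocalForm (dQC G e C) fun I => dQL G (I.length + e) (W I) where
  cochain := h.cochain.dQC G e
  multivector := ⟨fun μ ν => by beta_reduce; rw [h.multivector.1 μ ν, map_neg]; rfl,
    fun I hI => by beta_reduce; rw [h.multivector.2 I hI, map_zero]⟩
  nil I := by rw [dQC_apply, h.nil, dQL_dlt]; rfl
  one_one μ ν := by rw [dQC_apply, h.one_one, map_neg, dQL_dlt]; rfl
  two_one μ ν ρ := by rw [dQC_apply, h.two_one, map_zero]
  two_two μ ν ρ σ := by rw [dQC_apply, h.two_two, map_zero]

/-- The minus sign in the (μ; ν) components lets ∂₁ and ∂₂ combine into the total derivative, which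
acts on the coefficient. -/
lemma IsLocalForm.cD (h : IsLocalForm C W) :
    IsLocalForm (cD F C) fun I => ∑ μ, pdL μ (W (I ++ [μ])) := by
  have h3 : ∀ μ ν ρ, W [μ, ν, ρ] = 0 := fun μ ν ρ => h.multivector.2 _ (by simp)
  have h12 : ∀ μ ν ρ, C [ρ] [μ, ν] = 0 := fun μ ν ρ => by
    rw [h.cochain.one_two, h.two_one, map_zero]
  have hT : ∀ μ W, d₁ μ (dlt W) + d₂ μ (dlt W) = (dlt (pdL μ W) : Op₂ F) := fun μ W => by
    rw [← dT_dlt, d₁_eq, d₂_eq]; module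
  refine ⟨h.cochain.cD, ⟨fun μ ν => ?_, fun I hI => ?_⟩, fun I => ?_, fun μ ν => ?_,
    fun μ ν ρ => ?_, fun μ ν ρ σ => cD_two_two h.cochain _ _ _ _⟩
  · simp [h3]
  · have : ∀ μ, W (I ++ [μ]) = 0 := fun μ => h.multivector.2 _ (by simp; omega)
    simp [this]
  · rcases I with _ | ⟨a, _ | ⟨b, _ | ⟨c, I⟩⟩⟩
    · rw [cD_nil, map_sum, ← Finset.sum_add_distrib]
      refine Finset.sum_congr rfl fun μ _ => ?_
      rw [h.cochain.nil_one, h.nil, sw_dlt, hT]; rfl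
    · rw [cD_one, map_sum, ← Finset.sum_sub_distrib]
      refine Finset.sum_congr rfl fun μ _ => ?_
      rw [h.one_one, h.nil, map_neg, sub_neg_eq_add, hT]; rfl
    · rw [cD_two h.cochain]
      simp [h.two_one, h3]
    · have h1 : ∀ μ, W (a :: b :: c :: I ++ [μ]) = 0 := fun μ => h.multivector.2 _ (by simp)
      have h2 : CausalGauge.cD F C (a :: b :: c :: I) [] = 0 :=
        (h.cochain.cD.1 []).2 _ (by simp)
      rw [h2]
      simp only [h1, map_zero, Finset.sum_const_zero]
  · rw [cD_one_one]
    simp [h.two_one, h12, h3]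
  · rw [cD_two_one h.cochain]
    simp [h.two_two]

end localForm

/-! ### The normal form of the anomalies -/

section anomalies

variable {G : GaugeCharge F} {T : Idx → OpMap F Mink} {T₂ A R : Cochain F}
  {W W' : Idx → OpMap F Mink}

lemma isFiniteRenormalization_iff :
    IsFiniteRenormalization R ↔ IsCochain R ∧ IsQLCochain 0 4 R := by
  refine ⟨fun h => ⟨h.cochain, fun I J => ?_⟩, fun h => ⟨h.1, fun I J => ?_⟩⟩
  · simpa [lvl] using isQuasiLocal_iff.1 (h.quasiLocal I J)
  · simpa [lvl] using isQuasiLocal_iff.2 (h.2 I J)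

lemma isNormalForm_iff (hA : IsCochain A) :
    IsNormalForm A W ↔ IsLocalForm A W ∧ ∀ I : Idx, IsWick (I.length + 1) 5 (W I) := by
  constructor
  · intro h
    refine ⟨⟨hA, h.multivector, fun I => ?_, h.A₄, h.A₅, h.A₆⟩, h.wick⟩
    rcases I with _ | ⟨a, _ | ⟨b, _ | ⟨c, I⟩⟩⟩
    · exact h.A₁
    · exact h.A₂ a
    · exact h.A₃ a b
    · have h1 : A (a :: b :: c :: I) [] = 0 := (hA.1 []).2 _ (by simp)
      rw [h1, h.multivector.2 _ (by simp), map_zero]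
  · rintro ⟨h, hW⟩
    exact ⟨h.multivector, hW, h.nil _, fun μ => h.nil _, fun μ ν => h.nil _, h.one_one, h.two_one,
      h.two_two⟩

lemma IsCochain.anomaly (G : GaugeCharge F) (h : IsCochain T₂) : IsCochain (anomaly G T₂) :=
  (h.dQC G 0).sub (h.cD.smul _)

lemma anomaly_eq_add (G : GaugeCharge F) (C : Cochain F) :
    anomaly G C = dQC G 0 C + (-Complex.I) • cD F C := by
  rw [anomaly_eq, sub_eq_add_neg]
  exact congrArg _ (neg_smul Complex.I (cD F C)).symm

lemma anomaly_add (G : GaugeCharge F) (T₂ R : Cochain F) :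
    anomaly G (T₂ + R) = anomaly G T₂ + anomaly G R := by
  simp only [anomaly_eq, map_add, smul_add]
  abel

lemma IsQLCochain.anomaly (G : GaugeCharge F) (h : IsQLCochain 0 4 R) :
    IsQLCochain 1 5 (anomaly G R) := by
  have h1 : IsQLCochain 1 5 (CausalGauge.dQC G 0 R) := h.dQC G (by simp) (by norm_num) (by norm_num)
  have h2 : IsQLCochain 1 5 (CausalGauge.cD F R) := h.cD (by norm_num) (by norm_num)
  rw [anomaly_eq]
  exact h1.sub (h2.smul _)

/-- The Wess–Zumino consistency conditions. -/
lemma dQC_anomaly (G : GaugeCharge F) (h : IsCochain T₂) :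
    dQC G 1 (anomaly G T₂) - (-Complex.I) • cD F (anomaly G T₂) = 0 := by
  have := gauge_differential_sq G 0 (-Complex.I) h
  rwa [← anomaly_eq_add] at this

lemma dQC_I_eq_anomaly (G : GaugeCharge F) (R : Cochain F) :
    dQC G 2 R - Complex.I • cD F R = anomaly G R := by rw [anomaly_eq, dQC_add_two]

/-- The differentials d_Q + iδ and d_Q - iδ compose to zero; this is the freedom in a
renormalization that leaves the anomalies unchanged. -/
lemma anomaly_coboundary (G : GaugeCharge F) {S : Cochain F} (h : IsCochain S) :
    anomaly G (dQC G 1 S + Complex.I • cD F S) = 0 := by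
  rw [← dQC_I_eq_anomaly]
  exact gauge_differential_sq G 1 Complex.I h

/-- A quasi-local operator is supported on the diagonal, while no point is causally later than
itself. Hence R does not contribute where causal factorisation is demanded. -/
lemma IsChronological.add (h : IsChronological T T₂) (hR : IsFiniteRenormalization R) :
    IsChronological T (T₂ + R) := by
  obtain ⟨hRc, hRq⟩ := isFiniteRenormalization_iff.1 hR
  refine ⟨h.cochain.add hRc, fun I J χ ψ => ?_, fun I J f g u hu hfg => ?_⟩
  · simp only [Pi.add_apply, LinearMap.add_apply, pair_add_right]
    exact (h.distribution I J χ ψ).add (isOpDistribution_of_mem_ql (hRq I J) χ ψ)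
  · have h0 : R I J u = 0 := by
      refine apply_eq_zero_of_mem_ql (hRq I J) fun x hx => ?_
      have hsub : tsupport u ⊆ tsupport f ×ˢ tsupport g := by
        refine closure_minimal ?_ ((isClosed_tsupport _).prod (isClosed_tsupport _))
        rintro ⟨a, b⟩ hab
        rw [Function.mem_support, hu] at hab
        exact ⟨subset_tsupport _ (left_ne_zero_of_mul hab),
          subset_tsupport _ (right_ne_zero_of_mul hab)⟩
      refine hfg x (hsub hx).1 x (hsub hx).2 ?_
      simp [ForwardCone]
    rw [Pi.add_apply, Pi.add_apply, LinearMap.add_apply, h0, add_zero]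
    exact h.causality I J f g u hu hfg

/-- The consistency condition makes the anomaly closed, and the change (d_Q - iδ)R allowed by the
normalisation with c = -i is exactly the effect of a renormalization. -/
theorem exists_isNormalForm (hT₂ : IsCochain T₂) (hA : IsQLCochain 1 5 (anomaly G T₂)) :
    ∃ (R : Cochain F) (W : Idx → OpMap F Mink),
      IsFiniteRenormalization R ∧ IsNormalForm (anomaly G (T₂ + R)) W := by
  have hI : -Complex.I ≠ 0 := neg_ne_zero.2 Complex.I_ne_zero
  obtain ⟨R, hR, hRq, h₀⟩ := exists_forall_mem_ordLe_zero G (e := 1) (g := 1) hI (by norm_num)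
    (by simp) (hT₂.anomaly G) hA fun I J => by
      rw [dQC_add_two, dQC_anomaly G hT₂]
      exact zero_mem _
  have hRq' : IsQLCochain 0 4 R := by convert! hRq using 1; norm_num
  have e : anomaly G T₂ + (dQC G (1 + 1) R + (-Complex.I) • cD F R) = anomaly G (T₂ + R) := by
    rw [anomaly_add, anomaly_eq_add G R, dQC_add_two G 0]
  rw [e] at h₀
  have hc := hT₂.add hR
  obtain ⟨W, hW, hl⟩ := exists_isLocalForm (hc.anomaly G)
    (by rw [anomaly_add]; exact hA.add (hRq'.anomaly G)) h₀ fun I J =>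
      cD_mem_ordLe_zero G (e := 1) hI (by rw [dQC_anomaly G hc]; exact zero_mem _) (h₀ I J)
  exact ⟨R, W, isFiniteRenormalization_iff.2 ⟨hR, hRq'⟩,
    (isNormalForm_iff (hc.anomaly G)).2 ⟨hl, hW⟩⟩

/-- The consistency conditions for a normal form. -/
lemma IsNormalForm.descent (hT₂ : IsCochain T₂) (h : IsNormalForm (anomaly G T₂) W) (I : Idx) :
    dQ G (I.length + 1) (W I) = -(Complex.I • ∑ μ, pd μ (W (I ++ [μ]))) := by
  have hl := ((isNormalForm_iff (hT₂.anomaly G)).1 h).1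
  have h1 := dQC_anomaly G hT₂
  have h2 := congrFun (congrFun h1 I) []
  rw [Pi.sub_apply, Pi.sub_apply, Pi.smul_apply, Pi.smul_apply, (hl.dQC G 1).nil, hl.cD.nil,
    ← map_smul, ← map_sub] at h2
  have h3 := dlt_injective (h2.trans (map_zero dlt).symm)
  rw [sub_eq_zero] at h3
  rw [dQ_eq, h3]
  simp only [pd_eq]
  module

/-! ### Derivative-free renormalizations and uniqueness of the normal form -/

/-- The cochain without derivatives of `δ` with given components. -/
def localCochain (B : Idx → OpMap F Mink) : Cochain F
  | I, [] => dlt (B I)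
  | [], J => dlt (B J)
  | [μ], [ν] => -dlt (B [μ, ν])
  | _, _ => 0

lemma isLocalForm_localCochain {B : Idx → OpMap F Mink} (hB : IsMultivector B) :
    IsLocalForm (localCochain B) B := by
  refine ⟨isCochain_of_left (fun J => ⟨fun μ ν => ?_, fun I hI => ?_⟩) fun I J => ?_, hB,
    fun I => ?_, fun μ ν => rfl, fun μ ν ρ => rfl, fun μ ν ρ σ => rfl⟩
  · rcases J with _ | ⟨a, J⟩
    · simp only [localCochain]
      rw [hB.1, map_neg]
    · simp [localCochain]
  · rcases I with _ | ⟨a, _ | ⟨b, I⟩⟩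
    · simp at hI
    · simp at hI
    · rcases J with _ | ⟨c, J⟩
      · simp only [localCochain]
        rw [hB.2 _ hI, map_zero]
      · simp [localCochain]
  · rcases I with _ | ⟨a, _ | ⟨b, I⟩⟩ <;> rcases J with _ | ⟨c, _ | ⟨e, J⟩⟩ <;>
      simp [localCochain, sw_dlt]
    rw [hB.1, map_neg]
    exact neg_neg _
  · rcases I with _ | ⟨a, I⟩ <;> rfl

lemma isQLCochain_localCochain {B : Idx → OpMap F Mink} {d : ℚ}
    (hB : ∀ I : Idx, IsWick I.length d (B I)) : IsQLCochain 0 d (localCochain B) := by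
  intro I J
  unfold localCochain
  split
  · simpa [lvl] using dlt_mem_ql (hB _)
  · simpa [lvl] using dlt_mem_ql (hB _)
  · simpa [lvl] using dlt_mem_ql (hB [_, _])
  · exact zero_mem _

/-- The anomaly of a cochain without derivatives of `δ`. -/
lemma IsLocalForm.anomaly (G : GaugeCharge F) {B : Idx → OpMap F Mink} (h : IsLocalForm R B) :
    IsLocalForm (anomaly G R)
      ((fun I => dQL G (I.length + 0) (B I))
        + (-Complex.I) • fun I => ∑ μ, pdL μ (B (I ++ [μ]))) := by
  rw [anomaly_eq_add]
  exact (h.dQC G 0).add (h.cD.smul _)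

/-- Packs the three formulas into one identity of multivectors; with more than two indices both
sides vanish. -/
lemma differByCoboundary_iff (hW : IsMultivector W) (hW' : IsMultivector W') :
    DifferByCoboundary G W W' ↔ ∃ B, IsMultivector B ∧ (∀ I : Idx, IsWick I.length 4 (B I)) ∧
      W' = W + ((fun I => dQL G (I.length + 0) (B I))
        + (-Complex.I) • fun I => ∑ μ, pdL μ (B (I ++ [μ]))) := by
  refine exists_congr fun B => and_congr_right fun hB => and_congr_right fun _ => ?_
  have h3 : ∀ μ ν ρ, B [μ, ν, ρ] = 0 := fun μ ν ρ => hB.2 _ (by simp)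
  constructor
  · rintro ⟨h0, h1, h2⟩
    funext I
    simp only [Pi.add_apply, Pi.smul_apply]
    rcases I with _ | ⟨a, _ | ⟨b, _ | ⟨c, I⟩⟩⟩
    · rw [h0]
      simp only [dQ_eq, pd_eq, List.nil_append, List.length_nil]
      module
    · rw [h1]
      simp only [dQ_eq, pd_eq, List.cons_append, List.nil_append, List.length_cons,
        List.length_nil]
      module
    · rw [h2]
      simp [dQ_eq, h3]
    · have h4 : ∀ μ, B (a :: b :: c :: I ++ [μ]) = 0 := fun μ => hB.2 _ (by simp)
      rw [hW.2 _ (by simp), hW'.2 _ (by simp), hB.2 (a :: b :: c :: I) (by simp)]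
      simp only [h4, map_zero, Finset.sum_const_zero, smul_zero, add_zero]
  · rintro rfl
    refine ⟨?_, fun μ => ?_, fun μ ν => ?_⟩
    · simp only [Pi.add_apply, Pi.smul_apply, dQ_eq, pd_eq, List.nil_append, List.length_nil]
      module
    · simp only [Pi.add_apply, Pi.smul_apply, dQ_eq, pd_eq, List.cons_append, List.nil_append,
        List.length_cons, List.length_nil]
      module
    · simp [dQ_eq, h3]

/-- The difference of two renormalizations with normal-form anomalies has a derivative-free anomaly.
Up to a term with zero anomaly it is itself derivative-free, and the anomaly of such a cochain is
the coboundary of its coefficients. Conversely any B, placed on the diagonal, is a renormalization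
with that effect. -/
theorem exists_isNormalForm_iff (hT₂ : IsCochain T₂) (hA : IsQLCochain 1 5 (anomaly G T₂))
    (hR : IsFiniteRenormalization R) (hW : IsNormalForm (anomaly G (T₂ + R)) W)
    (hW' : IsMultivector W') :
    (∃ R' : Cochain F, IsFiniteRenormalization R' ∧ IsNormalForm (anomaly G (T₂ + R')) W') ↔
      DifferByCoboundary G W W' := by
  obtain ⟨hRc, hRq⟩ := isFiniteRenormalization_iff.1 hR
  have hc := hT₂.add hRc
  obtain ⟨hl, hWw⟩ := (isNormalForm_iff (hc.anomaly G)).1 hW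
  rw [differByCoboundary_iff hW.multivector hW']
  constructor
  · rintro ⟨R', hR', hN⟩
    obtain ⟨hRc', hRq'⟩ := isFiniteRenormalization_iff.1 hR'
    have hc' := hT₂.add hRc'
    have hl' := ((isNormalForm_iff (hc'.anomaly G)).1 hN).1
    have hρ : IsCochain (R' - R) := hRc'.sub hRc
    have hρq : IsQLCochain 0 4 (R' - R) := hRq'.sub hRq
    have hq : ∀ R, IsQLCochain 0 4 R → IsQLCochain 1 5 (anomaly G (T₂ + R)) := fun R h => by
      rw [anomaly_add]; exact hA.add (h.anomaly G)
    have e : anomaly G (R' - R) = anomaly G (T₂ + R') - anomaly G (T₂ + R) := by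
      have e0 : T₂ + R' = T₂ + R + (R' - R) := by abel
      rw [e0, anomaly_add G (T₂ + R), add_sub_cancel_left]
    have hZ : ∀ I J, anomaly G (R' - R) I J ∈ ordLe F 0 := fun I J => by
      rw [e]
      exact sub_mem (hl'.mem_ordLe_zero (by norm_num) (hq _ hRq') I J)
        (hl.mem_ordLe_zero (by norm_num) (hq _ hRq) I J)
    -- The same normalisation one ghost number and one dimension below that of the anomalies, now
    -- with c = i.
    obtain ⟨S, hS, hSq, h₀⟩ := exists_forall_mem_ordLe_zero G (e := 0) (g := 0) Complex.I_ne_zero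
      (by norm_num) (by simp) hρ hρq fun I J => by
        rw [zero_add, dQC_I_eq_anomaly]; exact hZ I J
    rw [zero_add] at h₀
    set ρ := R' - R + (dQC G 1 S + Complex.I • cD F S) with hρdef
    have hρa : anomaly G ρ = anomaly G (R' - R) := by
      rw [hρdef, anomaly_add, anomaly_coboundary G hS, add_zero]
    have hρc : IsCochain ρ := hρ.add ((hS.dQC G 1).add (hS.cD.smul _))
    have hρq' : IsQLCochain 0 4 ρ := hρq.add
      ((hSq.dQC G (by simp) (by norm_num) (by norm_num)).add
        ((hSq.cD (by norm_num) (by norm_num)).smul _))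
    obtain ⟨B, hB, hBl⟩ := exists_isLocalForm hρc hρq' h₀ fun I J =>
      cD_mem_ordLe_zero G (e := 2) Complex.I_ne_zero
        (by rw [dQC_I_eq_anomaly, hρa]; exact hZ I J) (h₀ I J)
    refine ⟨B, hBl.multivector, by simpa using hB, hl'.unique ?_⟩
    have e2 : anomaly G (T₂ + R') = anomaly G (T₂ + R) + anomaly G ρ := by
      rw [hρa, e, add_sub_cancel]
    rw [e2]
    exact hl.add (hBl.anomaly G)
  · rintro ⟨B, hB, hBw, rfl⟩
    have hBl := isLocalForm_localCochain hB
    refine ⟨R + localCochain B, isFiniteRenormalization_iff.2 ⟨hRc.add hBl.cochain,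
      hRq.add (isQLCochain_localCochain hBw)⟩, ?_⟩
    rw [← add_assoc, anomaly_add]
    have h1 := hl.add (hBl.anomaly G)
    refine (isNormalForm_iff h1.cochain).2 ⟨h1, fun I =>
      (hWw I).add (IsWick.add ?_ (IsWick.smul _ ?_))⟩
    · have := (hBw I).dQ G (k := I.length + 0) (by simp)
      norm_num at this
      exact this
    · have h2 : ∀ μ, IsWick (I.length + 1) 5 (pdL μ (B (I ++ [μ]))) := fun μ => by
        have := (hBw (I ++ [μ])).pdL μ
        norm_num at this
        exact this
      exact Submodule.sum_mem (wickSub F (I.length + 1) 5) fun μ _ => h2 μ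

end anomalies

end

end CausalGauge

/-! ### The theorem on second-order anomalies -/

theorem mainTheorem7 (F : FieldContent) (G : GaugeCharge F)
    (T : Idx → OpMap F Mink) (hT : IsInteraction G T)
    (T₂ : Cochain F) (hT₂ : IsChronological T T₂)
    (hA : ∀ I J : Idx, IsQuasiLocal (I.length + J.length + 1) 5 (anomaly G T₂ I J)) :
    -- finite renormalizations yield chronological products again
    (∀ R : Cochain F, IsFiniteRenormalization R → IsChronological T (T₂ + R)) ∧
    -- some finite renormalization brings the anomalies to normal form
    (∃ (R : Cochain F) (W : Idx → OpMap F Mink),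
      IsFiniteRenormalization R ∧ IsNormalForm (anomaly G (T₂ + R)) W) ∧
    -- the descent equations hold for every normal form
    (∀ (R : Cochain F) (W : Idx → OpMap F Mink),
      IsFiniteRenormalization R → IsNormalForm (anomaly G (T₂ + R)) W →
      dQ G 1 (W []) = -(Complex.I • ∑ μ, pd μ (W [μ])) ∧
      (∀ μ, dQ G 2 (W [μ]) = -(Complex.I • ∑ ν, pd ν (W [μ, ν]))) ∧
      (∀ μ ν, dQ G 3 (W [μ, ν]) = 0)) ∧
    -- two normal forms differ by coboundaries, and every such change occurs
    (∀ (R : Cochain F) (W : Idx → OpMap F Mink),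
      IsFiniteRenormalization R → IsNormalForm (anomaly G (T₂ + R)) W →
      ∀ W' : Idx → OpMap F Mink, IsMultivector W' →
        ((∃ R' : Cochain F,
            IsFiniteRenormalization R' ∧ IsNormalForm (anomaly G (T₂ + R')) W') ↔
          DifferByCoboundary G W W')) := by
  have hc := hT₂.cochain
  have hq : IsQLCochain 1 5 (anomaly G T₂) := fun I J => by
    simpa [lvl] using isQuasiLocal_iff.1 (hA I J)
  refine ⟨fun R hR => hT₂.add hR, exists_isNormalForm hc hq, fun R W hR hW => ?_,
    fun R W hR hW W' hW' => exists_isNormalForm_iff hc hq hR hW hW'⟩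
  have hd := hW.descent (hc.add hR.cochain)
  have h3 : ∀ μ ν ρ, W [μ, ν, ρ] = 0 := fun μ ν ρ => hW.multivector.2 _ (by simp)
  -- For two indices the divergence involves only components with three indices, which vanish.
  refine ⟨hd [], fun μ => hd [μ], fun μ ν => (hd [μ, ν]).trans ?_⟩
  simp [h3, pd_eq]
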